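/- An additively separable hedonic game (ASHG) consists of a finite loopless digraph $G=(V,E)$ and a weight function $w:V\times V\to\mathbb{Z}$ with $w(u,v)=0$ whenever $uv\notin E$. For $v\in V$ and $S\subseteq V$ put $p_v(S)=\sum_{u\in S\setminus\{v\}}w(v,u)$. A partition $\pi$ of $V$ is Nash stable if for every $S\in\pi$ and every $v\in S$ we have $p_v(S)\ge 0$ and $p_v(S)\ge p_v(S')$ for all $S'\in\pi$. Let $n=|V|$, let $\Delta$ be the maximum degree of the underlying undirected graph of $G$, and let $W=\max_{u,v}|w(u,v)|$. Theorem. Assume the Exponential Time Hypothesis, in the form: 3-SAT on formulas with $n$ variables and $m$ clauses cannot be decided in time $2^{o(n)}(n+m)^{O(1)}$. Then there is a constant $p$ such that no algorithm decides, given an ASHG whose underlying graph has pathwidth at most $p$, whether it admits a Nash stable partition in time $\Delta^{o(\Delta)}(nW)^{O(1)}$. Here algorithms are deterministic multi-tape Turing machines, weights are given in binary, and the bound $\Delta^{o(\Delta)}(nW)^{O(1)}$ is read as $C\cdot\max(\Delta,2)^{f(\Delta)}\cdot(\max(n,1)\max(W,1))^{k}$ with constants $C,k$ and a function $f$ with $f(\Delta)/\Delta\to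 0$ as $\Delta\to\infty$. -/

import Mathlib

open Computability

/-! ### Additively separable hedonic games -/

/-- An additively separable hedonic game on the agents `0, …, n - 1`: a loopless digraph together
with an integer weight function that vanishes outside the arcs. Arcs of weight `0` are allowed. -/
structure ASHG where
  /-- number of agents -/
  n : ℕ
  /-- the digraph of the game -/
  graph : Digraph (Fin n)
  loopless : ∀ v, ¬ graph.Adj v v
  /-- `w v u` is the utility that `v` gains from being in the same coalition as `u` -/
  w : Fin n → Fin n → ℤ
  w_eq_zero : ∀ u v, ¬ graph.Adj u v → w u v = 0

namespace ASHG

/-- The underlying graph: forget the directions of all arcs. -/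
def underlying (G : ASHG) : SimpleGraph (Fin G.n) := G.graph.toSimpleGraphInclusive

open Classical in
/-- `Δ`, the maximum degree of the underlying graph. -/
noncomputable def maxDeg (G : ASHG) : ℕ := G.underlying.maxDegree

/-- `W`, the maximum absolute weight. -/
def maxWeight (G : ASHG) : ℕ :=
  Finset.univ.sup fun a : Fin G.n × Fin G.n => (G.w a.1 a.2).natAbs

/-- The utility that `v` derives from being placed in the coalition `S`. -/
def utility (G : ASHG) (v : Fin G.n) (S : Finset (Fin G.n)) : ℤ :=
  ∑ u ∈ S.erase v, G.w v u

/-- A partition into coalitions is Nash stable if no agent can strictly increase its utility by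
forming a singleton coalition or by joining another coalition of the partition. -/
def IsNashStable (G : ASHG) (π : Finpartition (Finset.univ : Finset (Fin G.n))) : Prop :=
  ∀ S ∈ π.parts, ∀ v ∈ S,
    0 ≤ G.utility v S ∧ ∀ S' ∈ π.parts, G.utility v S' ≤ G.utility v S

/-- The question of the decision problem Nash Stability. -/
def HasNashStablePartition (G : ASHG) : Prop :=
  ∃ π : Finpartition (Finset.univ : Finset (Fin G.n)), G.IsNashStable π

end ASHG

/-! ### Pathwidth -/

/-- A path decomposition of `G`: a sequence of bags such that every vertex and every edge lies in
some bag, and the bags that contain a given vertex are consecutive. -/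
structure PathDecomposition {V : Type*} (G : SimpleGraph V) where
  /-- number of bags -/
  length : ℕ
  /-- the bags -/
  bag : Fin length → Finset V
  vertex_mem : ∀ v, ∃ i, v ∈ bag i
  edge_mem : ∀ u v, G.Adj u v → ∃ i, u ∈ bag i ∧ v ∈ bag i
  consecutive : ∀ i j k, i ≤ j → j ≤ k → ∀ v, v ∈ bag i → v ∈ bag k → v ∈ bag j

/-- The pathwidth of a finite graph: the least `p` such that some path decomposition has all its
bags of size at most `p + 1`. (A graph without vertices gets the value `0`.) -/
noncomputable def pathwidth {V : Type*} [Fintype V] (G : SimpleGraph V) : ℕ :=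
  sInf {p : ℕ | ∃ D : PathDecomposition G, ∀ i, (D.bag i).card ≤ p + 1}

/-- The infimum in the definition of the pathwidth is attained. -/
theorem pathwidth_le_iff {V : Type*} [Fintype V] (G : SimpleGraph V) (p : ℕ) :
    pathwidth G ≤ p ↔ ∃ D : PathDecomposition G, ∀ i, (D.bag i).card ≤ p + 1 := by
  constructor
  · intro h
    have hne : {p : ℕ | ∃ D : PathDecomposition G, ∀ i, (D.bag i).card ≤ p + 1}.Nonempty :=
      ⟨Fintype.card V,
        { length := 1
          bag := fun _ => Finset.univ
          vertex_mem := fun v => ⟨0, Finset.mem_univ v⟩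
          edge_mem := fun u v _ => ⟨0, Finset.mem_univ u, Finset.mem_univ v⟩
          consecutive := fun _ _ _ _ _ v _ _ => Finset.mem_univ v },
        fun _ => (Finset.card_le_univ _).trans (Nat.le_succ _)⟩
    obtain ⟨D, hD⟩ := Nat.sInf_mem hne
    exact ⟨D, fun i => (hD i).trans (Nat.succ_le_succ h)⟩
  · exact fun h => Nat.sInf_le h

/-! ### 3-SAT -/

/-- A 3-CNF formula with variables `0, …, n - 1`. A literal is a pair of a variable and the truth
value that satisfies the literal; a clause consists of three literals, which may coincide. -/
structure ThreeCNF where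
  /-- number of variables -/
  n : ℕ
  /-- the list of clauses -/
  clauses : List (Fin 3 → Fin n × Bool)

/-- The question of the decision problem 3-SAT. -/
def ThreeCNF.Satisfiable (φ : ThreeCNF) : Prop :=
  ∃ a : Fin φ.n → Bool, ∀ c ∈ φ.clauses, ∃ i, a (c i).1 = (c i).2

/-! ### Encodings of instances by strings

Both encodings are sequences of comma-terminated fields. Weights are written in binary. Numbers of
agents and variables, and their indices, are written in unary; this changes the length of an input
only polynomially. -/

/-- A field with the number `k` in unary. -/
def unaryField (k : ℕ) : List Γ' := List.replicate k (Γ'.bit true) ++ [Γ'.comma]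

/-- A field with the integer `z`: a sign bit (`true` for negative numbers), followed by the binary
digits of the absolute value, least significant digit first. -/
def intField (z : ℤ) : List Γ' :=
  Γ'.bit (decide (z < 0)) :: (z.natAbs.bits.map Γ'.bit ++ [Γ'.comma])

/-- `s` encodes the game `G`: the number of agents, followed by a list of all arcs in an arbitrary
order, each of them given by its tail, its head and its weight. -/
def ASHG.IsEncoding (G : ASHG) (s : List Γ') : Prop :=
  ∃ l : List (Fin G.n × Fin G.n), l.Nodup ∧ (∀ a, a ∈ l ↔ G.graph.Adj a.1 a.2) ∧
    s = unaryField G.n ++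
      l.flatMap fun a => unaryField a.1 ++ unaryField a.2 ++ intField (G.w a.1 a.2)

/-- The encoding of a formula: the number of variables, followed by the literals of the clauses in
order, each of them given by a bit for its sign and the index of its variable. -/
def ThreeCNF.encode (φ : ThreeCNF) : List Γ' :=
  unaryField φ.n ++ φ.clauses.flatMap fun c =>
    (List.ofFn c).flatMap fun x => Γ'.bit x.2 :: unaryField x.1

/-! ### Algorithms and running times -/

/-- Some (deterministic, multi-tape) Turing machine decides the problem `L` on the instances of
type `α`, and it halts after at most `T a` steps when it is started on any encoding of the
instance `a`. Here `IsEncoding a s` says that the string `s` encodes `a`. -/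
def DecidableInTime {α : Type} (IsEncoding : α → List Γ' → Prop) (L : α → Prop) (T : α → ℝ) :
    Prop :=
  ∃ M : Turing.TM2ComputableAux Γ' Bool, ∀ a s, IsEncoding a s →
    ∃ (b : Bool) (t : ℕ), (b = true ↔ L a) ∧ (t : ℝ) ≤ T a ∧
      Nonempty (Turing.TM2OutputsInTime M.tm (s.map M.inputAlphabet.symm)
        (some ([b].map M.outputAlphabet.symm)) t)

/-- The Exponential Time Hypothesis, in the form: 3-SAT on formulas with `n` variables and `m`
clauses cannot be decided in time `2 ^ o(n) * (n + m) ^ O(1)`. This is implied by the form that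
excludes the running times `c ^ n * (n + m) ^ O(1)` for some `c > 1`. -/
def ETH : Prop :=
  ¬ ∃ (f : ℕ → ℝ) (C k : ℕ), f =o[Filter.atTop] (fun n : ℕ => (n : ℝ)) ∧
    DecidableInTime (fun φ s => s = ThreeCNF.encode φ) ThreeCNF.Satisfiable
      (fun φ => C * (2 : ℝ) ^ f φ.n * ((φ.n + φ.clauses.length + 1 : ℕ) : ℝ) ^ k)

/-- Nash Stability, restricted to the games whose underlying graph has pathwidth at most `p`, can
be decided in time `Δ ^ o(Δ) * (n * W) ^ O(1)`. The maxima serve only to keep the bound from being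
`0`, or independent of the instance, when `Δ ≤ 1` or `n = 0` or `W = 0`. -/
def NashStabilitySolvable (p : ℕ) : Prop :=
  ∃ (f : ℕ → ℝ) (C k : ℕ), f =o[Filter.atTop] (fun d : ℕ => (d : ℝ)) ∧
    DecidableInTime (α := {G : ASHG // pathwidth G.underlying ≤ p})
      (fun G s => G.1.IsEncoding s) (fun G => G.1.HasNashStablePartition)
      (fun G => C * ((max G.1.maxDeg 2 : ℕ) : ℝ) ^ f G.1.maxDeg *
        ((max G.1.n 1 * max G.1.maxWeight 1 : ℕ) : ℝ) ^ k)

/-! The proof reduces 3-SAT with `n` variables to games of pathwidth at most 9 whose maximum degree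
is `O(n / log n)`. The variables are cut into blocks of `b`, about `(log n) / 2`, variables. A block
has `2 ^ b = O(√n)` assignments. There is an item for every block and an item for every assignment,
and a partition encodes a truth assignment: a block takes the value of the assignment item in its
coalition.

Every clause has a layer with its own copies of all items, so few agents suffice to separate layers.
A hub gives the copies of item `i` in two consecutive layers the weights `2 ^ i` and `-2 ^ i`. Items
dislike hubs, so a stable hub has utility 0, and no coalition may offer it more. The offers of all
coalitions add up to 0, hence each of them is 0, and uniqueness of binary expansions shows that both
layers induce the same partition of the items (`eq_of_binary_balance`, `color_itm`).

The check agent of a clause likes its three literals, who do not tolerate it, and dislikes the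
garbage agent and the assignment items. Literals that all avoid assignment items would attract the
check agent, even from the coalition of the garbage agent, where the balance is `3 - 2`. So some
literal shares a coalition with an assignment item (`exists_lit_of_stable`). This costs the literal
1 if the assignment satisfies it and 2 otherwise, and only its block can repay 1. Hence the block is
there, the assignment item is unique, and it satisfies the literal (`satisfiable_of_stable`).
Conversely, a satisfying assignment yields a stable partition in which every utility is 0
(`exists_stable_of_satisfiable`).

Apart from the items, a layer has seven agents, and items are adjacent only to these and to the two
hubs of the preceding layer. This gives bags of size 10 (`pathwidth_le_nine`). With `D = O(n / b)`
bounding the degree, `D * log D = O(n)`, so `Δ ^ o(Δ)` is `2 ^ o(n)`. The weights are at most `3 * 2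
^ D`, so `W ^ O(1)` contributes `2 ^ O(D)`, up to a constant factor, which is `2 ^ o(n)` too
(`isLittleO_exponent`, `time_game_le`).

The reduction must be carried out by a Turing machine. Structured stack programs are compiled to
`TM2` statements (`reach_code`) and prefixed to a given machine (`outputsInTime_thenMachine`). A
calculus of polynomial time functions, closed under branching, loops and bounded iteration, then
produces the program that writes the game (`polyTime_gameCode`). -/

/-! ### A small imperative language on stacks -/

/-- Structured programs that manipulate stacks, which are indexed by natural numbers. -/
inductive Prog (A : Type) : Type
  | skip : Prog A
  | push (k : ℕ) (a : A) : Prog A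
  | seq (p q : Prog A) : Prog A
  | pop (k : ℕ) (f : Option A → Prog A) : Prog A
  | loop (k : ℕ) (f : A → Prog A) : Prog A

namespace Prog

variable {A : Type}

/-- `Runs p s s' t`: started with the stacks `s`, the program `p` ends after exactly `t` steps with
the stacks `s'`. -/
inductive Runs : Prog A → (ℕ → List A) → (ℕ → List A) → ℕ → Prop
  | skip (s) : Runs skip s s 1
  | push (k a s) : Runs (push k a) s (Function.update s k (a :: s k)) 1
  | seq {p q s s' s'' t t'} : Runs p s s' t → Runs q s' s'' t' → Runs (seq p q) s s'' (t + t')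
  | pop {k f s s' t} : Runs (f (s k).head?) (Function.update s k (s k).tail) s' t →
      Runs (pop k f) s s' (t + 1)
  | loop_nil {k f s} : s k = [] → Runs (loop k f) s s 1
  | loop_cons {k f s s' s'' t t' a l} : s k = a :: l → Runs (f a) (Function.update s k l) s' t →
      Runs (loop k f) s' s'' t' → Runs (loop k f) s s'' (t + t' + 1)

/-- The program points of a program. -/
def Pos : Prog A → Type
  | skip => Unit
  | push _ _ => Unit
  | seq p q => Pos p ⊕ Pos q
  | pop _ f => Option (Σ o, Pos (f o))
  | loop _ f => Option (Σ a, Pos (f a))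

/-- The first program point. -/
def entry : (p : Prog A) → Pos p
  | skip => ()
  | push _ _ => ()
  | seq p _ => Sum.inl (entry p)
  | pop _ _ => none
  | loop _ _ => none

/-- The set of program points is finite. -/
@[reducible]
noncomputable def fintypePos [Fintype A] : (p : Prog A) → Fintype (Pos p)
  | skip => inferInstanceAs (Fintype Unit)
  | push _ _ => inferInstanceAs (Fintype Unit)
  | seq p q =>
    letI := fintypePos p
    letI := fintypePos q
    inferInstanceAs (Fintype (Pos p ⊕ Pos q))
  | pop _ f =>
    letI := fun o => fintypePos (f o)
    inferInstanceAs (Fintype (Option (Σ o, Pos (f o))))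
  | loop _ f =>
    letI := fun a => fintypePos (f a)
    inferInstanceAs (Fintype (Option (Σ a, Pos (f a))))

/-- A bound for the stacks used by a program. -/
def width [Fintype A] : Prog A → ℕ
  | skip => 0
  | push k _ => k + 1
  | seq p q => max (width p) (width q)
  | pop k f => max (k + 1) (Finset.univ.sup fun o => width (f o))
  | loop k f => max (k + 1) (Finset.univ.sup fun a => width (f a))

/-! ### Compilation of programs into Turing machine statements -/

section Code

variable (R : ℕ) [NeZero R] {K : Type} (Γ : K → Type) {Λ σ : Type}

/-- The stack alphabets of a machine that has `R` stacks for a program next to other stacks. -/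
abbrev StackAlphabet (A : Type) : Fin R ⊕ K → Type := Sum.elim (fun _ => A) Γ

/-- Combine the stacks of a program with the other stacks. -/
def joinStacks {R : ℕ} {K : Type} {Γ : K → Type} (s : ℕ → List A) (T : ∀ k, List (Γ k)) :
    ∀ k, List (StackAlphabet R Γ A k)
  | Sum.inl i => s i
  | Sum.inr k => T k

/-- Compilation of a program into statements of a Turing machine. -/
def code : (p : Prog A) → (Pos p → Λ) → Λ → Pos p →
    Turing.TM2.Stmt (StackAlphabet R Γ A) Λ (Option A × σ)
  | skip, _, exit, _ => .goto fun _ => exit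
  | push k a, _, exit, _ => .push (Sum.inl (Fin.ofNat R k)) (fun _ => a) (.goto fun _ => exit)
  | seq p q, lift, exit, x => match x with
    | Sum.inl y => code p (fun y => lift (Sum.inl y)) (lift (Sum.inr (entry q))) y
    | Sum.inr y => code q (fun y => lift (Sum.inr y)) exit y
  | pop k f, lift, exit, x => match x with
    | none => .pop (Sum.inl (Fin.ofNat R k)) (fun v o => (o, v.2))
        (.goto fun v => lift (some ⟨v.1, entry (f v.1)⟩))
    | some ⟨o, y⟩ => code (f o) (fun y => lift (some ⟨o, y⟩)) exit y
  | loop k f, lift, exit, x => match x with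
    | none => .pop (Sum.inl (Fin.ofNat R k)) (fun v o => (o, v.2))
        (.goto fun v => match v.1 with
          | none => exit
          | some a => lift (some ⟨a, entry (f a)⟩))
    | some ⟨a, y⟩ => code (f a) (fun y => lift (some ⟨a, y⟩)) (lift none) y

variable {R Γ}

/-- Reduction modulo `R` is harmless below `R`, which is why compiled programs need `width ≤ R`. -/
theorem joinStacks_apply {k : ℕ} (hk : k < R) (s : ℕ → List A) (T : ∀ k, List (Γ k)) :
    joinStacks s T (Sum.inl (Fin.ofNat R k)) = s k :=
  congrArg s (Nat.mod_eq_of_lt hk)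

variable [DecidableEq K]

theorem update_joinStacks {k : ℕ} (hk : k < R) (s : ℕ → List A) (T : ∀ k, List (Γ k))
    (l : List A) :
    Function.update (joinStacks s T) (Sum.inl (Fin.ofNat R k)) l =
      joinStacks (Function.update s k l) T := by
  funext x
  rcases x with i | x
  · by_cases h : i = Fin.ofNat R k
    · subst h
      refine (Function.update_self _ _ _).trans (Eq.symm ?_)
      exact (congrArg (Function.update s k l) (Nat.mod_eq_of_lt hk)).trans
        (Function.update_self _ _ _)
    · have hne : (i : ℕ) ≠ k := by
        rintro rfl
        exact h (by ext; simp)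
      refine (Function.update_of_ne (fun e => h (Sum.inl_injective e)) _ _).trans (Eq.symm ?_)
      exact Function.update_of_ne hne _ _
  · exact Function.update_of_ne (by simp) _ _

theorem stepAux_push {k : ℕ} (hk : k < R) (s : ℕ → List A) (T : ∀ k, List (Γ k)) (f : σ → A)
    (q : Turing.TM2.Stmt (StackAlphabet R Γ A) Λ σ) (v : σ) :
    Turing.TM2.stepAux (.push (Sum.inl (Fin.ofNat R k)) f q) v (joinStacks s T) =
      Turing.TM2.stepAux q v (joinStacks (Function.update s k (f v :: s k)) T) :=
  congrArg (Turing.TM2.stepAux q v) <|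
    (congrArg (fun l : List A => Function.update (joinStacks (R := R) s T)
      (Sum.inl (Fin.ofNat R k)) (f v :: l)) (joinStacks_apply hk s T)).trans
        (update_joinStacks hk s T _)

theorem stepAux_pop {k : ℕ} (hk : k < R) (s : ℕ → List A) (T : ∀ k, List (Γ k))
    (f : σ → Option A → σ) (q : Turing.TM2.Stmt (StackAlphabet R Γ A) Λ σ) (v : σ) :
    Turing.TM2.stepAux (.pop (Sum.inl (Fin.ofNat R k)) f q) v (joinStacks s T) =
      Turing.TM2.stepAux q (f v (s k).head?)
        (joinStacks (Function.update s k (s k).tail) T) :=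
  (congrArg (fun l : List A => Turing.TM2.stepAux q (f v l.head?)
    (Function.update (joinStacks (R := R) s T) (Sum.inl (Fin.ofNat R k)) l.tail))
      (joinStacks_apply hk s T)).trans
        (congrArg (Turing.TM2.stepAux q (f v (s k).head?)) (update_joinStacks hk s T _))

/-- `c'` is reached from `c` in exactly `n` steps. -/
def Reach {K : Type} [DecidableEq K] {Γ : K → Type} {Λ σ : Type}
    (m : Λ → Turing.TM2.Stmt Γ Λ σ) (n : ℕ) (c c' : Turing.TM2.Cfg Γ Λ σ) : Prop :=
  (flip bind (Turing.TM2.step m))^[n] (some c) = some c'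

theorem Reach.trans {K : Type} [DecidableEq K] {Γ : K → Type} {Λ σ : Type}
    {m : Λ → Turing.TM2.Stmt Γ Λ σ} {n n' : ℕ} {c c' c'' : Turing.TM2.Cfg Γ Λ σ}
    (h : Reach m n c c') (h' : Reach m n' c' c'') : Reach m (n + n') c c'' := by
  rw [Reach, add_comm, Function.iterate_add_apply, h, h']

theorem Reach.step {K : Type} [DecidableEq K] {Γ : K → Type} {Λ σ : Type}
    {m : Λ → Turing.TM2.Stmt Γ Λ σ} (l : Λ) (v : σ) (S : ∀ k, List (Γ k)) :
    Reach m 1 ⟨some l, v, S⟩ (Turing.TM2.stepAux (m l) v S) := rfl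

theorem Reach.congr {K : Type} [DecidableEq K] {Γ : K → Type} {Λ σ : Type}
    {m : Λ → Turing.TM2.Stmt Γ Λ σ} {n : ℕ} {c c' c'' : Turing.TM2.Cfg Γ Λ σ}
    (h : Reach m n c c') (e : c' = c'') : Reach m n c c'' := e ▸ h

/-- Induction on the run. Labels and exit are arbitrary, so that the code of a subprogram may sit
anywhere in a larger machine. The step counts agree exactly because `Runs` charges one unit per
push, pop, skip and loop test. The last popped symbol stays in the state, hence the existential
`o'`. -/
theorem reach_code [Fintype A] (m : Λ → Turing.TM2.Stmt (StackAlphabet R Γ A) Λ (Option A × σ))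
    {p : Prog A} {s s' : ℕ → List A} {t : ℕ} (h : Runs p s s' t) (hR : p.width ≤ R)
    (lift : Pos p → Λ) (exit : Λ) (hm : ∀ x, m (lift x) = code R Γ p lift exit x)
    (o : Option A) (v : σ) (T : ∀ k, List (Γ k)) :
    ∃ o', Reach m t ⟨some (lift p.entry), (o, v), joinStacks s T⟩
      ⟨some exit, (o', v), joinStacks s' T⟩ := by
  induction h generalizing exit o with
  | skip s =>
    refine ⟨o, ?_⟩
    have := Reach.step (m := m) (lift (entry skip)) (o, v) (joinStacks s T)
    rw [hm] at this
    exact this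
  | push k a s =>
    refine ⟨o, ?_⟩
    refine (Reach.step _ _ _).congr ?_
    rw [hm]
    exact stepAux_push hR s T (fun _ => a) _ (o, v)
  | @seq p q s s' s'' t t' _ _ ih1 ih2 =>
    obtain ⟨o1, h1⟩ := ih1 ((le_max_left _ _).trans hR) (fun y => lift (Sum.inl y))
      (lift (Sum.inr (entry q))) (fun x => hm (Sum.inl x)) o
    obtain ⟨o2, h2⟩ := ih2 ((le_max_right _ _).trans hR) (fun y => lift (Sum.inr y))
      exit (fun x => hm (Sum.inr x)) o1
    exact ⟨o2, h1.trans h2⟩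
  | @pop k f s s' t _ ih =>
    have hk : k < R := lt_of_lt_of_le (Nat.lt_succ_self k) ((le_max_left _ _).trans hR)
    have hf : ∀ o, (f o).width ≤ R := fun o =>
      (Finset.le_sup (f := fun o => width (f o)) (Finset.mem_univ o)).trans
        ((le_max_right _ _).trans hR)
    obtain ⟨o2, h2⟩ := ih (hf _) (fun y => lift (some ⟨_, y⟩)) exit
      (fun x => hm (some ⟨_, x⟩)) (s k).head?
    refine ⟨o2, ?_⟩
    rw [add_comm]
    refine Reach.trans ?_ h2
    refine (Reach.step _ _ _).congr ?_
    rw [hm]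
    exact stepAux_pop hk s T _ _ (o, v)
  | @loop_nil k f s hs =>
    have hk : k < R := lt_of_lt_of_le (Nat.lt_succ_self k) ((le_max_left _ _).trans hR)
    refine ⟨none, ?_⟩
    refine (Reach.step _ _ _).congr ?_
    rw [hm]
    refine (stepAux_pop hk s T _ _ (o, v)).trans ?_
    have e : Function.update s k (s k).tail = s := by
      rw [hs, List.tail_nil, ← hs, Function.update_eq_self]
    rw [e, hs]
    rfl
  | @loop_cons k f s s' s'' t t' a l hs _ _ ih1 ih2 =>
    have hk : k < R := lt_of_lt_of_le (Nat.lt_succ_self k) ((le_max_left _ _).trans hR)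
    have hf : ∀ a, (f a).width ≤ R := fun a =>
      (Finset.le_sup (f := fun a => width (f a)) (Finset.mem_univ a)).trans
        ((le_max_right _ _).trans hR)
    obtain ⟨o1, h1⟩ := ih1 (hf _) (fun y => lift (some ⟨a, y⟩)) (lift none)
      (fun x => hm (some ⟨a, x⟩)) (some a)
    obtain ⟨o2, h2⟩ := ih2 hR lift exit hm o1
    refine ⟨o2, ?_⟩
    rw [add_comm]
    refine Reach.trans ?_ (h1.trans h2)
    refine (Reach.step _ _ _).congr ?_
    rw [hm]
    refine (stepAux_pop hk s T _ _ (o, v)).trans ?_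
    rw [hs]
    rfl

end Code

theorem update_joinStacks_inr {R : ℕ} {K : Type} [DecidableEq K] {Γ : K → Type} (s : ℕ → List A)
    (T : ∀ k, List (Γ k)) (k : K) (l : List (Γ k)) :
    Function.update (joinStacks (R := R) s T) (Sum.inr k) l =
      joinStacks s (Function.update T k l) := by
  funext x
  rcases x with i | x
  · exact Function.update_of_ne (by simp) _ _
  · by_cases h : x = k
    · subst h
      exact (Function.update_self _ _ _).trans
        (show l = Function.update T x l x from (Function.update_self x l T).symm)
    · exact (Function.update_of_ne (fun e => h (Sum.inr_injective e)) _ _).trans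
        (Function.update_of_ne h _ _).symm

end Prog

namespace Prog

/-! ### Embedding a machine into one with more stacks, labels and states -/

section Lift

theorem joinStacks_nil {A : Type} {R : ℕ} {K : Type} {Γ : K → Type} :
    joinStacks (R := R) (Γ := Γ) (fun _ => ([] : List A)) (fun _ => []) = fun _ => [] := by
  funext k
  rcases k with k | k <;> rfl

variable {A : Type} {R : ℕ} {K : Type} [DecidableEq K] {Γ : K → Type} {Λ Λ' σ : Type}

theorem stepAux_pop_of_eq [NeZero R] {k : ℕ} (hk : k < R) {s s' : ℕ → List A} (T : ∀ k, List (Γ k))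
    (f : σ → Option A → σ) (q : Turing.TM2.Stmt (StackAlphabet R Γ A) Λ σ) (v : σ) {o : Option A}
    (ho : (s k).head? = o) (hs : Function.update s k (s k).tail = s') :
    Turing.TM2.stepAux (.pop (Sum.inl (Fin.ofNat R k)) f q) v (joinStacks s T) =
      Turing.TM2.stepAux q (f v o) (joinStacks s' T) := by
  subst ho hs
  exact stepAux_pop hk s T f q v

/-- A statement of a machine as a statement of a machine with additional stacks, labels and
states. -/
def liftStmt (lift : Λ → Λ') :
    Turing.TM2.Stmt Γ Λ σ → Turing.TM2.Stmt (StackAlphabet R Γ A) Λ' (Option A × σ)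
  | .push k f q => .push (Sum.inr k) (fun v => f v.2) (liftStmt lift q)
  | .peek k f q => .peek (Sum.inr k) (fun v o => (v.1, f v.2 o)) (liftStmt lift q)
  | .pop k f q => .pop (Sum.inr k) (fun v o => (v.1, f v.2 o)) (liftStmt lift q)
  | .load f q => .load (fun v => (v.1, f v.2)) (liftStmt lift q)
  | .branch f q q' => .branch (fun v => f v.2) (liftStmt lift q) (liftStmt lift q')
  | .goto f => .goto fun v => lift (f v.2)
  | .halt => .halt

/-- A configuration of a machine as a configuration of a machine with additional stacks, labels and
states. -/
def liftCfg (lift : Λ → Λ') (o : Option A) (s : ℕ → List A) (c : Turing.TM2.Cfg Γ Λ σ) :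
    Turing.TM2.Cfg (StackAlphabet R Γ A) Λ' (Option A × σ) :=
  ⟨c.l.map lift, (o, c.var), joinStacks s c.stk⟩

theorem stepAux_liftStmt (lift : Λ → Λ') (o : Option A) (s : ℕ → List A)
    (q : Turing.TM2.Stmt Γ Λ σ) (v : σ) (T : ∀ k, List (Γ k)) :
    Turing.TM2.stepAux (liftStmt (R := R) lift q) (o, v) (joinStacks s T) =
      liftCfg lift o s (Turing.TM2.stepAux q v T) := by
  induction q generalizing v T with
  | push k f q ih =>
    refine Eq.trans ?_ (ih _ _)
    exact congrArg (Turing.TM2.stepAux (liftStmt lift q) (o, v)) (update_joinStacks_inr s T k _)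
  | peek k f q ih => exact ih _ _
  | pop k f q ih =>
    refine Eq.trans ?_ (ih _ _)
    exact congrArg (Turing.TM2.stepAux (liftStmt lift q) _) (update_joinStacks_inr s T k _)
  | load f q ih => exact ih _ _
  | branch f q q' ih ih' =>
    simp only [liftStmt, Turing.TM2.stepAux]
    cases f v
    · exact ih' _ _
    · exact ih _ _
  | goto f => rfl
  | halt => rfl

theorem Reach.lift {m : Λ → Turing.TM2.Stmt Γ Λ σ}
    {m' : Λ' → Turing.TM2.Stmt (StackAlphabet R Γ A) Λ' (Option A × σ)} (lift : Λ → Λ')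
    (hm : ∀ l, m' (lift l) = liftStmt lift (m l)) (o : Option A) (s : ℕ → List A)
    {n : ℕ} {c c' : Turing.TM2.Cfg Γ Λ σ} (h : Reach m n c c') :
    Reach m' n (liftCfg lift o s c) (liftCfg lift o s c') := by
  -- Ranging over optional configurations lets the induction pass through a halted machine as well.
  have key : ∀ (n : ℕ) (x : Option (Turing.TM2.Cfg Γ Λ σ)),
      (flip bind (Turing.TM2.step m'))^[n] (x.map (liftCfg lift o s)) =
        ((flip bind (Turing.TM2.step m))^[n] x).map (liftCfg lift o s) := by
    intro n
    induction n with
    | zero => intro x; rfl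
    | succ n ih =>
      intro x
      rw [Function.iterate_succ_apply, Function.iterate_succ_apply, ← ih]
      congr 1
      rcases x with _ | ⟨l, v, T⟩
      · rfl
      · rcases l with _ | l
        · rfl
        · refine congrArg some ?_
          change Turing.TM2.stepAux (m' (lift l)) (o, v) (joinStacks s T) = _
          rw [hm]
          exact stepAux_liftStmt lift o s (m l) v T
  have := key n (some c)
  rw [show (flip bind (Turing.TM2.step m))^[n] (some c) = some c' from h] at this
  exact this

end Lift

/-! ### Running a program before a machine -/

section Compose

variable (M : Turing.TM2ComputableAux Γ' Bool) (p : Prog Γ')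

/-- The machine that runs a program, moves the contents of stack `1` to the input stack of another
machine, and runs that machine. -/
noncomputable def thenMachine : Turing.TM2ComputableAux Γ' Bool :=
  letI := fintypePos p
  letI := M.tm.ΛFin
  letI := M.tm.σFin
  letI := M.tm.kFin
  { tm :=
    { K := Fin (p.width + 2) ⊕ M.tm.K
      k₀ := Sum.inl 0
      k₁ := Sum.inr M.tm.k₁
      Γ := StackAlphabet (p.width + 2) M.tm.Γ Γ'
      Λ := Pos p ⊕ Option M.tm.Λ
      main := Sum.inl p.entry
      σ := Option Γ' × M.tm.σ
      initialState := (none, M.tm.initialState)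
      Γk₀Fin := inferInstanceAs (Fintype Γ')
      m := fun
        | Sum.inl x => code (p.width + 2) M.tm.Γ p Sum.inl (Sum.inr none) x
        | Sum.inr none => .pop (Sum.inl (Fin.ofNat _ 1)) (fun v o => (o, v.2)) <|
            .branch (fun v => v.1.isSome)
              (.push (Sum.inr M.tm.k₀) (fun v => M.inputAlphabet.symm (v.1.getD Γ'.blank)) <|
                .goto fun _ => Sum.inr none)
              (.goto fun _ => Sum.inr (some M.tm.main))
        | Sum.inr (some l) => liftStmt (fun l => Sum.inr (some l)) (M.tm.m l) }
    inputAlphabet := Equiv.refl _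
    outputAlphabet := M.outputAlphabet }

theorem initList_stk (tm : Turing.FinTM2) (s : List (tm.Γ tm.k₀)) :
    (Turing.initList tm s).stk = Function.update (fun _ => []) tm.k₀ s := by
  funext k
  by_cases h : k = tm.k₀
  · subst h
    simp [Turing.initList]
  · simp [Turing.initList, h]

theorem haltList_stk (tm : Turing.FinTM2) (s : List (tm.Γ tm.k₁)) :
    (Turing.haltList tm s).stk = Function.update (fun _ => []) tm.k₁ s := by
  funext k
  by_cases h : k = tm.k₁
  · subst h
    simp [Turing.haltList]
  · simp [Turing.haltList, h]

/-- Moving symbols one by one reverses their order, so the program has to leave its output reversed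
on stack `1`. The extra step is the final pop from the empty stack. -/
theorem reach_transfer (o : Option Γ') (v : M.tm.σ) (l : List Γ')
    (T : ∀ k, List (M.tm.Γ k)) :
    Reach (thenMachine M p).tm.m (l.length + 1)
      ⟨some (Sum.inr none), (o, v), joinStacks (Function.update (fun _ => []) 1 l) T⟩
      ⟨some (Sum.inr (some M.tm.main)), (none, v), joinStacks (fun _ => [])
        (Function.update T M.tm.k₀ ((l.map M.inputAlphabet.symm).reverse ++ T M.tm.k₀))⟩ := by
  have h1 : 1 < p.width + 2 := by omega
  induction l generalizing o T with
  | nil =>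
    refine (Reach.step _ _ _).congr ?_
    refine (stepAux_pop_of_eq h1 T _ _ (o, v) (s := Function.update (fun _ => []) 1 [])
      (o := none) (s' := fun _ => []) (by simp) (by simp)).trans ?_
    exact congrArg (fun T => (⟨some (Sum.inr (some M.tm.main)), (none, v),
      joinStacks (R := p.width + 2) (fun _ => []) T⟩ : (thenMachine M p).tm.Cfg))
      (Function.update_eq_self M.tm.k₀ T).symm
  | cons a l ih =>
    rw [List.length_cons, add_comm (l.length + 1)]
    refine Reach.trans ((Reach.step _ _ _).congr ?_) ((ih (some a)
      (Function.update T M.tm.k₀ (M.inputAlphabet.symm a :: T M.tm.k₀))).congr ?_)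
    · refine (stepAux_pop_of_eq h1 T _ _ (o, v) (o := some a)
        (s' := Function.update (fun _ => []) 1 l) (by simp) (by simp)).trans ?_
      exact congrArg (fun S => (⟨some (Sum.inr none), (some a, v), S⟩ :
        (thenMachine M p).tm.Cfg))
        (update_joinStacks_inr (R := p.width + 2) (Function.update (fun _ => []) 1 l) T M.tm.k₀ _)
    · simp

-- The three phases are the program, the transfer and the given machine. The program may leave
-- nothing but its output behind, since a halting configuration requires all stacks other than the
-- output stack to be empty.
variable {M p} in
theorem outputsInTime_thenMachine {s out : List Γ'} {t : ℕ}
    (h : Runs p (Function.update (fun _ => []) 0 s)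
      (Function.update (fun _ => []) 1 out.reverse) t) {r : List Bool} {t' : ℕ}
    (hM : Nonempty (Turing.TM2OutputsInTime M.tm (out.map M.inputAlphabet.symm)
      (some (r.map M.outputAlphabet.symm)) t')) :
    Nonempty (Turing.TM2OutputsInTime (thenMachine M p).tm
      (s.map (thenMachine M p).inputAlphabet.symm)
      (some (r.map (thenMachine M p).outputAlphabet.symm)) (t + (out.length + 1) + t')) := by
  obtain ⟨⟨⟨n, hn⟩, hle⟩⟩ := hM
  obtain ⟨o, h1⟩ := reach_code (R := p.width + 2) (Γ := M.tm.Γ) (thenMachine M p).tm.m h (by omega)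
    Sum.inl (Sum.inr none) (fun x => rfl) none M.tm.initialState (fun _ => [])
  have h2 := reach_transfer M p o M.tm.initialState out.reverse (fun _ => [])
  have h3 : Reach M.tm.m n (Turing.initList M.tm (out.map M.inputAlphabet.symm))
      (Turing.haltList M.tm (r.map M.outputAlphabet.symm)) := hn
  have h4 := Reach.lift (m' := (thenMachine M p).tm.m) (R := p.width + 2)
    (fun l => Sum.inr (some l)) (fun l => rfl) none (fun _ => []) h3
  rw [List.length_reverse] at h2
  have h12 := (h1.trans h2).congr (c'' := liftCfg (fun l => Sum.inr (some l)) none (fun _ => [])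
    (Turing.initList M.tm (out.map M.inputAlphabet.symm))) (by
      refine congrArg (fun T => (⟨some (Sum.inr (some M.tm.main)), (none, M.tm.initialState),
        joinStacks (R := p.width + 2) (fun _ => []) T⟩ : (thenMachine M p).tm.Cfg)) ?_
      rw [initList_stk]
      simp)
  have h5 := h12.trans h4
  refine ⟨⟨⟨t + (out.length + 1) + n, ?_⟩, by
    change n ≤ t' at hle
    change t + (out.length + 1) + n ≤ _
    omega⟩⟩
  have e1 : Turing.initList (thenMachine M p).tm (s.map (thenMachine M p).inputAlphabet.symm) =
      ⟨some (Sum.inl p.entry), (none, M.tm.initialState),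
        joinStacks (Function.update (fun _ => []) 0 s) (fun _ => [])⟩ := by
    refine congrArg (fun S => (⟨some (Sum.inl p.entry), (none, M.tm.initialState), S⟩ :
        (thenMachine M p).tm.Cfg)) ?_
    refine (initList_stk _ _).trans ?_
    have e : s.map (thenMachine M p).inputAlphabet.symm = s := List.map_id s
    rw [e]
    refine Eq.trans ?_ (update_joinStacks (R := p.width + 2) (Nat.succ_pos _) (fun _ => [])
      (fun _ => []) s)
    rw [joinStacks_nil]
    rfl
  have e2 : Turing.haltList (thenMachine M p).tm
      (r.map (thenMachine M p).outputAlphabet.symm) =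
      liftCfg (fun l => Sum.inr (some l)) none (fun _ => [])
        (Turing.haltList M.tm (r.map M.outputAlphabet.symm)) := by
    refine congrArg (fun S => (⟨none, (none, M.tm.initialState), S⟩ :
        (thenMachine M p).tm.Cfg)) ?_
    refine (haltList_stk _ _).trans (Eq.trans ?_ (congrArg _ (haltList_stk _ _).symm))
    refine Eq.trans ?_ (update_joinStacks_inr (R := p.width + 2) (fun _ => []) (fun _ => [])
      M.tm.k₁ _)
    rw [joinStacks_nil]
    rfl
  rw [e1]
  refine Eq.trans h5 ?_
  exact congrArg some e2.symm

end Compose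

end Prog

/-! ### Polynomially bounded functions -/

/-- `b` is bounded by a polynomial. -/
def PolyBound (b : ℕ → ℕ) : Prop := ∃ c k : ℕ, ∀ B, b B ≤ c * (B + 1) ^ k

namespace PolyBound

theorem const (c : ℕ) : PolyBound fun _ => c := ⟨c, 0, by simp⟩

theorem id : PolyBound fun B => B := ⟨1, 1, by simp⟩

theorem add {b b' : ℕ → ℕ} (h : PolyBound b) (h' : PolyBound b') :
    PolyBound fun B => b B + b' B := by
  obtain ⟨c, k, hb⟩ := h
  obtain ⟨c', k', hb'⟩ := h'
  refine ⟨c + c', k + k', fun B => ?_⟩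
  have h1 : (B + 1) ^ k ≤ (B + 1) ^ (k + k') := Nat.pow_le_pow_right (by omega) (by omega)
  have h2 : (B + 1) ^ k' ≤ (B + 1) ^ (k + k') := Nat.pow_le_pow_right (by omega) (by omega)
  calc b B + b' B ≤ c * (B + 1) ^ k + c' * (B + 1) ^ k' := add_le_add (hb B) (hb' B)
    _ ≤ c * (B + 1) ^ (k + k') + c' * (B + 1) ^ (k + k') := by gcongr
    _ = _ := by ring

theorem mul {b b' : ℕ → ℕ} (h : PolyBound b) (h' : PolyBound b') :
    PolyBound fun B => b B * b' B := by
  obtain ⟨c, k, hb⟩ := h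
  obtain ⟨c', k', hb'⟩ := h'
  refine ⟨c * c', k + k', fun B => ?_⟩
  calc b B * b' B ≤ c * (B + 1) ^ k * (c' * (B + 1) ^ k') := Nat.mul_le_mul (hb B) (hb' B)
    _ = _ := by ring

theorem comp {b b' : ℕ → ℕ} (h : PolyBound b) (h' : PolyBound b') :
    PolyBound fun B => b (b' B) := by
  obtain ⟨c, k, hb⟩ := h
  obtain ⟨c', k', hb'⟩ := h'
  refine ⟨c * (c' + 1) ^ k, k' * k, fun B => (hb _).trans ?_⟩
  have : b' B + 1 ≤ (c' + 1) * (B + 1) ^ k' := by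
    have := hb' B
    have : 1 ≤ (B + 1) ^ k' := Nat.one_le_pow _ _ (by omega)
    linarith
  calc c * (b' B + 1) ^ k ≤ c * ((c' + 1) * (B + 1) ^ k') ^ k := by gcongr
    _ = _ := by rw [mul_pow, pow_mul, mul_assoc]

theorem sum {ι : Type*} (s : Finset ι) {b : ι → ℕ → ℕ} (h : ∀ i, PolyBound (b i)) :
    PolyBound fun B => ∑ i ∈ s, b i B := by
  classical
  induction s using Finset.induction_on with
  | empty => simpa using const 0
  | insert i s hi ih => simpa [Finset.sum_insert hi] using (h i).add ih

end PolyBound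

/-! ### Time bounds for basic stack programs -/

namespace Prog

variable {A : Type}

/-- `p` leads from the stacks `s` to the stacks `s'` in at most `T` steps. -/
def Does (p : Prog A) (s s' : ℕ → List A) (T : ℕ) : Prop := ∃ t ≤ T, Runs p s s' t

theorem Does.mono {p : Prog A} {s s' : ℕ → List A} {T T' : ℕ} (h : Does p s s' T) (hT : T ≤ T') :
    Does p s s' T' := h.imp fun _ ht => ⟨ht.1.trans hT, ht.2⟩

theorem Does.congr {p : Prog A} {s s' s'' : ℕ → List A} {T : ℕ} (h : Does p s s' T)
    (e : s' = s'') : Does p s s'' T := e ▸ h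

theorem Does.of_eq {p : Prog A} {s s' s₁ s₁' : ℕ → List A} {T T' : ℕ} (h : Does p s s' T)
    (e : s = s₁) (e' : s' = s₁') (hT : T ≤ T') : Does p s₁ s₁' T' := by
  subst e e'
  exact h.mono hT

theorem Does.seq {p q : Prog A} {s s' s'' : ℕ → List A} {T T' : ℕ} (h : Does p s s' T)
    (h' : Does q s' s'' T') : Does (.seq p q) s s'' (T + T') := by
  obtain ⟨t, ht, hp⟩ := h
  obtain ⟨t', ht', hq⟩ := h'
  exact ⟨t + t', add_le_add ht ht', hp.seq hq⟩

theorem Does.skip (s : ℕ → List A) : Does .skip s s 1 := ⟨1, le_rfl, .skip s⟩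

theorem Does.push (k : ℕ) (a : A) (s : ℕ → List A) :
    Does (.push k a) s (Function.update s k (a :: s k)) 1 := ⟨1, le_rfl, .push k a s⟩

theorem Does.pop {k : ℕ} {f : Option A → Prog A} {s s' : ℕ → List A} {T : ℕ}
    (h : Does (f (s k).head?) (Function.update s k (s k).tail) s' T) :
    Does (.pop k f) s s' (T + 1) := by
  obtain ⟨t, ht, hp⟩ := h
  exact ⟨t + 1, by omega, hp.pop⟩

/-- The rule for loops: `S pre l` are the stacks before the loop consumes `l`, having consumed
`pre`. -/
theorem Does.loop {k : ℕ} {f : A → Prog A} (S : List A → List A → ℕ → List A) (L : List A) (τ : ℕ)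
    (h0 : ∀ pre l, S pre l k = l)
    (hstep : ∀ pre a l, pre ++ a :: l = L →
      Does (f a) (Function.update (S pre (a :: l)) k l) (S (pre ++ [a]) l) τ) :
    Does (.loop k f) (S [] L) (S L []) (L.length * (τ + 1) + 1) := by
  have key : ∀ l pre, pre ++ l = L →
      Does (.loop k f) (S pre l) (S L []) (l.length * (τ + 1) + 1) := by
    intro l
    induction l with
    | nil =>
      intro pre h
      rw [List.append_nil] at h
      subst h
      exact ⟨1, by omega, .loop_nil (h0 _ _)⟩
    | cons a l ih =>
      intro pre h
      obtain ⟨t, ht, hp⟩ := hstep pre a l h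
      obtain ⟨t', ht', hq⟩ := ih (pre ++ [a]) (by simpa using h)
      refine ⟨t + t' + 1, ?_, .loop_cons (h0 _ _) hp hq⟩
      rw [List.length_cons]
      linarith
  exact key L [] rfl

/-- Pop everything from stack `k` and push it to stack `d`. -/
def move (k d : ℕ) : Prog A := .loop k fun a => .push d a

theorem does_move {k d : ℕ} (h : k ≠ d) (s : ℕ → List A) :
    Does (move k d) s (Function.update (Function.update s k []) d ((s k).reverse ++ s d))
      (2 * (s k).length + 1) := by
  have := Does.loop (k := k) (f := fun a => .push d a)
    (fun pre l => Function.update (Function.update s k l) d (pre.reverse ++ s d)) (s k) 1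
    (fun pre l => by simp [h]) (fun pre a l _ => by
      refine (Does.push d a _).congr ?_
      funext r
      simp only [Function.update_apply]
      split_ifs <;> simp_all)
  refine this.of_eq ?_ rfl (by omega)
  funext r
  simp only [Function.update_apply]
  split_ifs <;> simp_all

/-- Empty stack `k`. -/
def clear (k : ℕ) : Prog A := .loop k fun _ => .skip

theorem does_clear (k : ℕ) (s : ℕ → List A) :
    Does (clear k) s (Function.update s k []) (2 * (s k).length + 1) := by
  have := Does.loop (k := k) (f := fun _ => .skip)
    (fun _ l => Function.update s k l) (s k) 1
    (fun pre l => by simp) (fun pre a l _ => by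
      refine (Does.skip _).congr ?_
      simp)
  exact this.of_eq (by simp) rfl (by omega)

/-- Push the contents of stack `k` to stack `d`, in reverse, by means of the empty stack `e`. -/
def copyRev (k e d : ℕ) : Prog A :=
  .seq (.loop k fun a => .seq (.push e a) (.push d a)) (move e k)

theorem does_copyRev {k e d : ℕ} (h1 : k ≠ e) (h2 : k ≠ d) (h3 : e ≠ d) (s : ℕ → List A)
    (he : s e = []) :
    Does (copyRev k e d) s (Function.update s d ((s k).reverse ++ s d))
      (5 * (s k).length + 2) := by
  have := Does.loop (k := k) (f := fun a => .seq (.push e a) (.push d a))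
    (fun pre l => Function.update (Function.update (Function.update s k l) d (pre.reverse ++ s d))
      e pre.reverse) (s k) 2
    (fun pre l => by simp [h1, h2]) (fun pre a l _ => by
      refine ((Does.push e a _).seq (Does.push d a _)).congr ?_
      funext r
      simp only [Function.update_apply]
      split_ifs <;> simp_all)
  have h4 := does_move (Ne.symm h1) (Function.update (Function.update (Function.update s k []) d
    ((s k).reverse ++ s d)) e (s k).reverse)
  refine (this.seq h4).of_eq ?_ ?_ ?_
  · funext r
    simp only [Function.update_apply]
    split_ifs <;> simp_all
  · funext r
    simp only [Function.update_apply]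
    split_ifs <;> simp_all
  · simp
    omega

end Prog

/-! ### Polynomial time functions -/

/-- `f` can be computed in polynomial time from the registers `rs`: for every assignment of stacks
to the registers there is a program that outputs the value of `f` to a given stack and leaves all
other stacks as they are. The time is measured in terms of the maximal length of a register. -/
def PolyTime {ι X : Type} (rs : ι → X → List Γ') (f : X → List Γ') : Prop :=
  ∃ b : ℕ → ℕ, PolyBound b ∧
    (∀ x B, (∀ i, (rs i x).length ≤ B) → (f x).length ≤ b B) ∧
    ∀ (ρ : ι → ℕ) (o fr : ℕ), (∀ i, ρ i < fr) → o < fr → (∀ i, ρ i ≠ o) →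
      ∃ p : Prog Γ', ∀ x s B, (∀ i, s (ρ i) = rs i x) → (∀ r, fr ≤ r → s r = []) →
        (∀ i, (rs i x).length ≤ B) →
        p.Does s (Function.update s o ((f x).reverse ++ s o)) (b B)

namespace PolyTime

open Prog

variable {ι κ X Y : Type} {rs : ι → X → List Γ'} {rs' : κ → Y → List Γ'} {f g : X → List Γ'}
  {h : Y → List Γ'}

theorem congr (hf : PolyTime rs f) (e : ∀ x, f x = g x) : PolyTime rs g := by
  rwa [show g = f from funext fun x => (e x).symm]

theorem nil : PolyTime rs fun _ => [] :=
  ⟨fun _ => 1, .const 1, by simp, fun _ _ _ _ _ _ =>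
    ⟨.skip, fun _ s _ _ _ _ => (Does.skip s).congr (by simp)⟩⟩

theorem single (a : Γ') : PolyTime rs fun _ => [a] :=
  ⟨fun _ => 1, .const 1, by simp, fun _ o _ _ _ _ =>
    ⟨.push o a, fun _ s _ _ _ _ => (Does.push o a s).congr (by simp)⟩⟩

theorem append (hf : PolyTime rs f) (hg : PolyTime rs g) : PolyTime rs fun x => f x ++ g x := by
  obtain ⟨b, hb, hlen, hp⟩ := hf
  obtain ⟨b', hb', hlen', hp'⟩ := hg
  refine ⟨_, hb.add hb', fun x B hB => ?_, fun ρ o fr h1 h2 h3 => ?_⟩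
  · rw [List.length_append]
    exact add_le_add (hlen x B hB) (hlen' x B hB)
  · obtain ⟨p, hp⟩ := hp ρ o fr h1 h2 h3
    obtain ⟨p', hp'⟩ := hp' ρ o fr h1 h2 h3
    refine ⟨.seq p p', fun x s B hs hr hB => ?_⟩
    refine ((hp x s B hs hr hB).seq (hp' x _ B (fun i => ?_) (fun r hr' => ?_) hB)).congr ?_
    · rw [Function.update_of_ne (h3 i), hs]
    · rw [Function.update_of_ne (by omega), hr r hr']
    · simp

theorem const (l : List Γ') : PolyTime rs fun _ => l := by
  induction l with
  | nil => exact nil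
  | cons a l ih => exact (single a).append ih

theorem reg (i : ι) : PolyTime rs (rs i) := by
  refine ⟨fun B => 5 * B + 2, ((PolyBound.const 5).mul .id).add (.const 2), fun x B hB => ?_,
    fun ρ o fr h1 h2 h3 => ⟨copyRev (ρ i) fr o, fun x s B hs hr hB => ?_⟩⟩
  · have := hB i
    dsimp only
    omega
  · have := does_copyRev (h1 i).ne (h3 i) h2.ne' s (hr fr le_rfl)
    rw [hs] at this
    refine this.mono ?_
    have := hB i
    dsimp only
    omega

/-- The same program works after renaming registers, so unused registers may be added and registers
may be repeated. -/
theorem reindex (hh : PolyTime rs' h) (e : κ → ι) (φ : X → Y)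
    (he : ∀ j x, rs' j (φ x) = rs (e j) x) : PolyTime rs fun x => h (φ x) := by
  obtain ⟨b, hb, hlen, hp⟩ := hh
  refine ⟨b, hb, fun x B hB => hlen _ _ fun j => ?_, fun ρ o fr h1 h2 h3 => ?_⟩
  · rw [he]
    exact hB _
  · obtain ⟨p, hp⟩ := hp (fun j => ρ (e j)) o fr (fun j => h1 _) h2 (fun j => h3 _)
    refine ⟨p, fun x s B hs hr hB => hp (φ x) s B (fun j => ?_) hr fun j => ?_⟩
    · rw [he, hs]
    · rw [he]
      exact hB _

/-- Values are output in reverse. Writing to scratch stack `fr` and moving to `fr + 1` restores the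
order, so that the value can serve as a register, with `fr + 2` as the next free stack. -/
theorem load (hg : PolyTime rs g) : ∃ b : ℕ → ℕ, PolyBound b ∧
    (∀ x B, (∀ i, (rs i x).length ≤ B) → (g x).length ≤ b B) ∧
    ∀ (ρ : ι → ℕ) (fr : ℕ), (∀ i, ρ i < fr) →
      ∃ p : Prog Γ', ∀ x s B, (∀ i, s (ρ i) = rs i x) → (∀ r, fr ≤ r → s r = []) →
        (∀ i, (rs i x).length ≤ B) → p.Does s (Function.update s (fr + 1) (g x)) (b B) := by
  obtain ⟨b, hb, hlen, hp⟩ := hg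
  refine ⟨_, hb.add (((PolyBound.const 2).mul hb).add (.const 1)), fun x B hB => ?_,
    fun ρ fr h1 => ?_⟩
  · have := hlen x B hB
    omega
  · obtain ⟨p, hp⟩ := hp ρ fr (fr + 1) (fun i => (h1 i).trans (by omega)) (by omega)
      (fun i => (h1 i).ne)
    refine ⟨.seq p (move fr (fr + 1)), fun x s B hs hr hB => ?_⟩
    refine ((hp x s B hs (fun r hr' => hr r (by omega)) hB).seq
      (does_move (by omega) _)).of_eq rfl ?_ ?_
    · have h1 := hr fr le_rfl
      have h2 := hr (fr + 1) (by omega)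
      funext r
      simp only [Function.update_apply]
      split_ifs <;> simp_all
    · have h1 := hr fr le_rfl
      have := hlen x B hB
      simp [h1]
      omega

/-- The rest of the inspected word is cleared before branching, because each branch expects empty
scratch stacks. -/
theorem case (hg : PolyTime rs g) {f : Option Γ' → X → List Γ'} (hf : ∀ o, PolyTime rs (f o)) :
    PolyTime rs fun x => f (g x).head? x := by
  obtain ⟨b, hb, hlen, hp⟩ := hg.load
  choose b' hb' hlen' hp' using hf
  -- The alphabet is finite, so the sum over all branches is a polynomial bound that does not depend
  -- on the branch.
  have hle : ∀ o B, b' o B ≤ ∑ o, b' o B := fun o B =>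
    Finset.single_le_sum (f := fun o => b' o B) (fun _ _ => Nat.zero_le _) (Finset.mem_univ o)
  refine ⟨_, hb.add ((((PolyBound.const 2).mul hb).add (.const 1)).add
    ((PolyBound.sum Finset.univ hb').add (.const 1))), fun x B hB => ?_, fun ρ o fr h1 h2 h3 => ?_⟩
  · have h4 := hlen' (g x).head? x B hB
    have h5 := hle (g x).head? B
    dsimp only
    omega
  · obtain ⟨p, hp⟩ := hp ρ fr h1
    choose p' hp' using fun a => hp' a ρ o fr h1 h2 h3
    refine ⟨.seq p (.pop (fr + 1) fun a => .seq (clear (fr + 1)) (p' a)),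
      fun x s B hs hr hB => ?_⟩
    have hfr := hr (fr + 1) (by omega)
    have e : Function.update s (fr + 1) [] = s := by rw [← hfr, Function.update_eq_self]
    have key : (Prog.pop (fr + 1) fun a => .seq (clear (fr + 1)) (p' a)).Does
        (Function.update s (fr + 1) (g x))
        (Function.update s o ((f (g x).head? x).reverse ++ s o))
        (2 * b B + 1 + ((∑ o, b' o B) + 1)) := by
      refine Does.mono (Does.pop (T := 2 * b B + 1 + ∑ o, b' o B) ?_) (by omega)
      simp only [Function.update_self, Function.update_idem]
      refine Does.seq (((does_clear _ _).of_eq rfl ?_ ?_))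
        ((hp' (g x).head? x s B hs hr hB).mono (hle _ _))
      · simp [e]
      · simp
        have := hlen x B hB
        omega
    exact (hp x s B hs hr hB).seq key

/-- Substitution of a polynomial time function for a register. -/
theorem subst (hg : PolyTime rs g) (hh : PolyTime rs' h) (e : κ → Option ι) (φ : X → Y)
    (he : ∀ j x, rs' j (φ x) = (e j).elim (g x) fun i => rs i x) :
    PolyTime rs fun x => h (φ x) := by
  obtain ⟨b, hb, hlen, hp⟩ := hg.load
  obtain ⟨b', hb', hlen', hp'⟩ := hh
  have hlen2 : ∀ x B, (∀ i, (rs i x).length ≤ B) → ∀ j, (rs' j (φ x)).length ≤ B + b B := by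
    intro x B hB j
    rw [he]
    rcases e j with _ | i
    · exact (hlen x B hB).trans (by omega)
    · exact (hB i).trans (by omega)
  refine ⟨_, (hb.add (hb'.comp (PolyBound.id.add hb))).add
    (((PolyBound.const 2).mul hb).add (.const 1)), fun x B hB => ?_, fun ρ o fr h1 h2 h3 => ?_⟩
  · have := hlen' (φ x) _ (hlen2 x B hB)
    dsimp only
    omega
  · obtain ⟨p, hp⟩ := hp ρ fr h1
    obtain ⟨p', hp'⟩ := hp' (fun j => (e j).elim (fr + 1) ρ) o (fr + 2)
      (fun j => by
        rcases e j with _ | i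
        · simp
        · have := h1 i
          simp
          omega) (by omega)
      (fun j => by
        rcases e j with _ | i
        · simp
          omega
        · exact h3 i)
    refine ⟨.seq (.seq p p') (clear (fr + 1)), fun x s B hs hr hB => ?_⟩
    refine ((hp x s B hs hr hB).seq (hp' (φ x) _ _ (fun j => ?_) (fun r hr' => ?_)
      (hlen2 x B hB))).seq ((does_clear _ _).of_eq rfl ?_ ?_)
    · rw [he]
      rcases e j with _ | i
      · simp
      · have := h1 i
        simp [hs, (this.trans (Nat.lt_succ_self fr)).ne]
    · rw [Function.update_of_ne (by omega), hr r (by omega)]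
    · have h4 := hr (fr + 1) (by omega)
      funext r
      simp only [Function.update_apply]
      split_ifs <;> simp_all
    · have := hlen x B hB
      have h6 : fr + 1 ≠ o := by omega
      simp [h6]
      omega

/-- A loop over the positions of a word. The body has access to the part of the word before the
current position, in reverse, and to the rest of the word. -/
theorem flatMap (hg : PolyTime rs g) (hh : PolyTime rs' h) (e : κ → Option (Option ι))
    (φ : X → ℕ → Y)
    (he : ∀ x i, i < (g x).length → ∀ j, rs' j (φ x i) =
      (e j).elim ((g x).take i).reverse fun o => o.elim ((g x).drop i) fun i => rs i x) :
    PolyTime rs fun x => (List.range (g x).length).flatMap fun i => h (φ x i) := by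
  obtain ⟨b, hb, hlen, hp⟩ := hg.load
  obtain ⟨b', hb', hlen', hp'⟩ := hh
  have hlen2 : ∀ x B, (∀ i, (rs i x).length ≤ B) → ∀ i, i < (g x).length → ∀ j,
      (rs' j (φ x i)).length ≤ B + b B := by
    intro x B hB i hi j
    have := hlen x B hB
    rw [he x i hi]
    rcases e j with _ | _ | i
    · simp
      omega
    · simp
      omega
    · exact (hB i).trans (by omega)
  refine ⟨_, hb.add ((hb.mul ((hb'.comp (PolyBound.id.add hb)).add (.const 4))).add
    ((((PolyBound.const 2).mul hb).add (.const 2)))), fun x B hB => ?_, fun ρ o fr h1 h2 h3 => ?_⟩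
  · have h4 : ∀ i ∈ List.range (g x).length, (h (φ x i)).length ≤ b' (B + b B) := fun i hi =>
      hlen' _ _ (hlen2 x B hB i (List.mem_range.1 hi))
    rw [List.length_flatMap]
    have h5 := List.sum_le_card_nsmul ((List.range (g x).length).map fun i => (h (φ x i)).length)
      (b' (B + b B)) (by simpa using h4)
    simp only [List.length_map, List.length_range, smul_eq_mul] at h5
    have h6 := Nat.mul_le_mul (hlen x B hB) (Nat.le_add_right (b' (B + b B)) 4)
    omega
  · obtain ⟨p, hp⟩ := hp ρ fr h1
    obtain ⟨p', hp'⟩ := hp' (fun j => (e j).elim fr fun o => o.elim (fr + 1) ρ) o (fr + 2)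
      (fun j => by
        rcases e j with _ | _ | i
        · simp
        · simp
        · have := h1 i
          simp
          omega) (by omega)
      (fun j => by
        rcases e j with _ | _ | i
        · simp
          omega
        · simp
          omega
        · exact h3 i)
    -- The symbol consumed by the loop is pushed back, so that the body sees the suffix starting at
    -- the current position on `fr + 1`. Afterwards it is transferred to `fr`, which accumulates the
    -- reversed prefix.
    refine ⟨.seq p (.seq (.loop (fr + 1) fun a => .seq (.push (fr + 1) a) (.seq p'
      (.pop (fr + 1) fun _ => .push fr a))) (clear fr)), fun x s B hs hr hB => ?_⟩
    have hfr := hr fr le_rfl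
    have hfr1 := hr (fr + 1) (by omega)
    have hne : fr ≠ o := by omega
    have hne1 : fr + 1 ≠ o := by omega
    have hl := Does.loop (k := fr + 1) (f := fun a => .seq (.push (fr + 1) a) (.seq p'
        (.pop (fr + 1) fun _ => .push fr a)))
      (fun pre l => Function.update (Function.update (Function.update s fr pre.reverse) (fr + 1) l)
        o (((List.range pre.length).flatMap fun i => h (φ x i)).reverse ++ s o))
      (g x) (1 + (b' (B + b B) + (1 + 1)))
      (fun pre l => by simp [hne1]) (fun pre a l hL => by
        have hlt : pre.length < (g x).length := by simp [← hL]
        refine ((Does.push _ _ _).seq ((hp' (φ x pre.length) _ _ (fun j => ?_) (fun r hr' => ?_)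
          (hlen2 x B hB _ hlt)).seq (Does.pop (Does.push _ _ _)))).congr ?_
        · rw [he x _ hlt]
          rcases e j with _ | _ | i
          · simp [hne, ← hL]
          · simp [← hL]
          · have h4 := (h1 i)
            have h5 := h3 i
            simp [hs, h4.ne, (h4.trans (Nat.lt_succ_self fr)).ne, h5]
        · have h4 : r ≠ o := by omega
          have h5 : r ≠ fr := by omega
          have h6 : r ≠ fr + 1 := by omega
          simp [h4, h5, h6, hr r (by omega)]
        · clear hp hp' hlen hlen' he hlen2 hL hlt hs hr hB
          funext r
          rcases eq_or_ne r o with rfl | r1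
          · simp [hne.symm, hne1.symm, List.range_succ]
          · rcases eq_or_ne r fr with rfl | r2
            · simp [hne]
            · rcases eq_or_ne r (fr + 1) with rfl | r3
              · simp [hne1]
              · simp [r1, r2, r3])
    refine (hp x s B hs hr hB).seq (Does.mono ((hl.of_eq ?_ rfl le_rfl).seq
      ((does_clear _ _).of_eq rfl ?_ le_rfl)) ?_)
    · clear hp hp' hlen hlen' he hlen2 hl
      funext r
      simp only [Function.update_apply]
      split_ifs <;> simp_all
    · clear hp hp' hlen hlen' he hlen2 hl
      funext r
      simp only [Function.update_apply]
      split_ifs <;> simp_all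
    · have h4 := hlen x B hB
      have h5 := Nat.mul_le_mul h4 (le_refl (b' (B + b B) + 4))
      simp [hne]
      ring_nf at h5 ⊢
      omega

/-- Iteration of a polynomial time function, if all intermediate results are small. -/
theorem iterate {n : X → List Γ'} (hn : PolyTime rs n) (hg : PolyTime rs g) (hh : PolyTime rs' h)
    (e : κ → Option ι) (φ : X → List Γ' → Y)
    (he : ∀ x l j, rs' j (φ x l) = (e j).elim l fun i => rs i x) {c : ℕ → ℕ} (hc : PolyBound c)
    (hbound : ∀ x B, (∀ i, (rs i x).length ≤ B) → ∀ i ≤ (n x).length,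
      ((fun l => h (φ x l))^[i] (g x)).length ≤ c B) :
    PolyTime rs fun x => (fun l => h (φ x l))^[(n x).length] (g x) := by
  obtain ⟨b, hb, hlen, hp⟩ := hg.load
  obtain ⟨b₂, hb₂, hlen₂, hp₂⟩ := hn.load
  obtain ⟨b', hb', hlen', hp'⟩ := hh
  have hlen3 : ∀ x B, (∀ i, (rs i x).length ≤ B) → ∀ l : List Γ', l.length ≤ c B → ∀ j,
      (rs' j (φ x l)).length ≤ B + c B := by
    intro x B hB l hl j
    rw [he]
    rcases e j with _ | i
    · exact hl.trans (by omega)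
    · exact (hB i).trans (by omega)
  refine ⟨_, (hb.add hb₂).add ((hb₂.mul ((hb'.comp (PolyBound.id.add hc)).add
    (((PolyBound.const 4).mul hc).add (.const 3)))).add (((PolyBound.const 2).mul hc).add
      (.const 2))), fun x B hB => ?_, fun ρ o fr h1 h2 h3 => ?_⟩
  · have := hbound x B hB _ le_rfl
    dsimp only
    omega
  · obtain ⟨p, hp⟩ := hp ρ fr h1
    obtain ⟨p₂, hp₂⟩ := hp₂ ρ (fr + 2) (fun i => (h1 i).trans (by omega))
    obtain ⟨p', hp'⟩ := hp' (fun j => (e j).elim (fr + 1) ρ) fr (fr + 4)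
      (fun j => by
        rcases e j with _ | i
        · simp
        · have := h1 i
          simp
          omega) (by omega)
      (fun j => by
        rcases e j with _ | i
        · simp
        · exact (h1 i).ne)
    -- Stack `fr + 3` is the counter and `fr + 1` the current value. The body writes the next value
    -- in reverse to `fr`, and moving it back restores the order.
    refine ⟨.seq (.seq p p₂) (.seq (.loop (fr + 3) fun _ => .seq p' (.seq (clear (fr + 1))
      (move fr (fr + 1)))) (move (fr + 1) o)), fun x s B hs hr hB => ?_⟩
    have hfr := hr fr le_rfl
    have hfr1 := hr (fr + 1) (by omega)
    have hfr3 := hr (fr + 3) (by omega)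
    have hne : fr ≠ o := by omega
    have hne1 : fr + 1 ≠ o := by omega
    have hne3 : fr + 3 ≠ o := by omega
    set F := fun l => h (φ x l) with hF
    have hl := Does.loop (k := fr + 3) (f := fun _ => .seq p' (.seq (clear (fr + 1))
        (move fr (fr + 1))))
      (fun pre l => Function.update (Function.update s (fr + 1) (F^[pre.length] (g x))) (fr + 3) l)
      (n x) (b' (B + c B) + ((2 * c B + 1) + (2 * c B + 1)))
      (fun pre l => by simp) (fun pre a l hL => by
        have hlt : pre.length + 1 ≤ (n x).length := by simp [← hL]
        have hc1 := hbound x B hB _ (Nat.le_of_succ_le hlt)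
        have hc2 := hbound x B hB _ hlt
        rw [← hF] at hc1 hc2
        rw [Function.iterate_succ_apply'] at hc2
        refine ((hp' (φ x (F^[pre.length] (g x))) _ _ (fun j => ?_) (fun r hr' => ?_)
          (hlen3 x B hB _ hc1)).seq (((does_clear _ _).of_eq rfl rfl ?_).seq
            ((does_move (by omega) _).of_eq rfl rfl ?_))).congr ?_
        · rw [he]
          rcases e j with _ | i
          · simp
          · have h4 := (h1 i)
            have h5 : ρ i ≠ fr + 1 := by omega
            have h6 : ρ i ≠ fr + 3 := by omega
            simp [hs, h5, h6]
        · have h5 : r ≠ fr + 1 := by omega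
          have h6 : r ≠ fr + 3 := by omega
          simp [h5, h6, hr r (by omega)]
        · simp
          exact hc1
        · simp [hfr]
          exact hc2
        · rw [List.length_append, List.length_singleton, Function.iterate_succ_apply']
          generalize F^[pre.length] (g x) = l'
          clear hp hp' hp₂ hlen hlen' hlen₂ hlen3 he hbound hc1 hc2 hL hlt hs hr hB
          funext r
          rcases eq_or_ne r fr with rfl | r1
          · simp [hfr]
          · rcases eq_or_ne r (fr + 1) with rfl | r2
            · simp [hF, hfr]
            · rcases eq_or_ne r (fr + 3) with rfl | r3
              · simp
              · simp [r1, r2, r3])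
    have hcn := hbound x B hB _ le_rfl
    rw [← hF] at hcn
    refine ((hp x s B hs hr hB).seq ((hp₂ x _ B (fun i => ?_) (fun r hr' => ?_) hB))).seq
      (Does.mono ((hl.of_eq ?_ rfl le_rfl).seq ((does_move hne1 _).of_eq rfl ?_ le_rfl)) ?_)
    · have h4 := h1 i
      rw [Function.update_of_ne (by omega), hs]
    · rw [Function.update_of_ne (by omega), hr r (by omega)]
    · rfl
    · change _ = Function.update s o ((F^[(n x).length] (g x)).reverse ++ s o)
      generalize F^[(n x).length] (g x) = l'
      clear hp hp' hp₂ hlen hlen' hlen₂ hlen3 he hbound hl hcn hF F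
      funext r
      simp only [Function.update_apply]
      split_ifs <;> simp_all
    · have h4 := hlen₂ x B hB
      have h5 := Nat.mul_le_mul h4 (le_refl (b' (B + c B) + (4 * c B + 3)))
      have e1 : (b' (B + c B) + (2 * c B + 1 + (2 * c B + 1)) + 1) =
        (b' (B + c B) + (4 * c B + 3)) := by ring
      rw [e1]
      simp only [Function.update_self, ne_eq, Nat.add_left_cancel_iff, OfNat.one_ne_ofNat,
        not_false_eq_true, Function.update_of_ne]
      omega

end PolyTime

/-! ### Arithmetic and decisions on unary numbers -/

/-- The number `n` in unary. -/
def unary (n : ℕ) : List Γ' := List.replicate n (Γ'.bit true)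

@[simp] theorem length_unary (n : ℕ) : (unary n).length = n := List.length_replicate

theorem unary_eq_nil {n : ℕ} : unary n = [] ↔ n = 0 := List.replicate_eq_nil_iff ..

theorem unary_add (m n : ℕ) : unary (m + n) = unary m ++ unary n := by simp [unary]

/-- Registers together with one more register. -/
def extend {ι X Y : Type} (rs : ι → X → List Γ') (r : Y → List Γ') :
    Option ι → X × Y → List Γ' :=
  fun j y => j.elim (r y.2) fun i => rs i y.1

/-- A polynomial time function with unary values. -/
def UnaryTime {ι X : Type} (rs : ι → X → List Γ') (n : X → ℕ) : Prop :=
  PolyTime rs fun x => unary (n x)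

/-- A predicate that can be decided in polynomial time. -/
def DecTime {ι X : Type} (rs : ι → X → List Γ') (P : X → Prop) : Prop :=
  ∃ f, PolyTime rs f ∧ ∀ x, f x = [] ↔ ¬ P x

section

variable {ι X Y : Type} {rs : ι → X → List Γ'} {r : Y → List Γ'}

theorem PolyTime.weaken {f : X → List Γ'} (hf : PolyTime rs f) :
    PolyTime (extend rs r) fun y => f y.1 :=
  hf.reindex some Prod.fst fun _ _ => rfl

theorem PolyTime.var : PolyTime (extend rs r) fun y => r y.2 :=
  PolyTime.reg (rs := extend rs r) none

theorem UnaryTime.weaken {n : X → ℕ} (hn : UnaryTime rs n) :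
    UnaryTime (extend rs r) fun y => n y.1 :=
  PolyTime.weaken hn

theorem DecTime.weaken {P : X → Prop} (h : DecTime rs P) :
    DecTime (extend rs r) fun y => P y.1 :=
  let ⟨_, hf, hP⟩ := h
  ⟨_, hf.weaken, fun y => hP y.1⟩

theorem UnaryTime.var : UnaryTime (extend rs unary) fun y => y.2 := PolyTime.var

theorem UnaryTime.const (n : ℕ) : UnaryTime rs fun _ => n := PolyTime.const _

theorem UnaryTime.congr {m n : X → ℕ} (hm : UnaryTime rs m) (e : ∀ x, m x = n x) :
    UnaryTime rs n := by
  rwa [show n = m from funext fun x => (e x).symm]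

theorem DecTime.congr {P Q : X → Prop} (hP : DecTime rs P) (e : ∀ x, P x ↔ Q x) :
    DecTime rs Q := by
  rwa [show Q = P from funext fun x => propext (e x).symm]

/-- Looping over the positions of `unary (n x)`, the prefix before position `i` is `unary i`, which
serves as the loop variable. -/
theorem PolyTime.flatMap_range {n : X → ℕ} (hn : UnaryTime rs n) {h : X × ℕ → List Γ'}
    (hh : PolyTime (extend rs unary) h) :
    PolyTime rs fun x => (List.range (n x)).flatMap fun i => h (x, i) := by
  refine (PolyTime.flatMap hn hh (fun j => j.elim none fun i => some (some i))
    (fun x i => (x, i)) fun x i hi j => ?_).congr fun x => by simp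
  rcases j with _ | j
  · simp only [length_unary] at hi
    simp [extend, unary, List.take_replicate, hi.le]
  · rfl

theorem PolyTime.length {f : X → List Γ'} (hf : PolyTime rs f) :
    UnaryTime rs fun x => (f x).length := by
  refine (hf.flatMap (PolyTime.const (rs := rs) [Γ'.bit true]) (fun i => some (some i))
    (fun x _ => x) fun _ _ _ _ => rfl).congr fun x => ?_
  simp [unary, List.eq_replicate_iff]

theorem DecTime.ite_polyTime {P : X → Prop} [DecidablePred P] (hP : DecTime rs P)
    {f g : X → List Γ'} (hf : PolyTime rs f) (hg : PolyTime rs g) :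
    PolyTime rs fun x => if P x then f x else g x := by
  obtain ⟨u, hu, hP⟩ := hP
  refine (hu.case (f := fun o => o.elim g fun _ => f) fun o => ?_).congr fun x => ?_
  · rcases o with _ | o
    · exact hg
    · exact hf
  · have := hP x
    rcases h : u x with _ | ⟨a, l⟩
    · simp [this.1 h]
    · have : P x := by
        by_contra hx
        simp [this.2 hx] at h
      simp [this]

theorem DecTime.ite_unaryTime {P : X → Prop} [DecidablePred P] (hP : DecTime rs P)
    {m n : X → ℕ} (hm : UnaryTime rs m) (hn : UnaryTime rs n) :
    UnaryTime rs fun x => if P x then m x else n x :=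
  (hP.ite_polyTime hm hn).congr fun _ => (apply_ite unary _ _ _).symm

theorem DecTime.not {P : X → Prop} (hP : DecTime rs P) : DecTime rs fun x => ¬ P x := by
  classical
  exact ⟨_, hP.ite_polyTime .nil (.single Γ'.blank), fun x => by by_cases h : P x <;> simp [h]⟩

theorem DecTime.and {P Q : X → Prop} (hP : DecTime rs P) (hQ : DecTime rs Q) :
    DecTime rs fun x => P x ∧ Q x := by
  classical
  obtain ⟨u, hu, hQ⟩ := hQ
  exact ⟨_, hP.ite_polyTime hu .nil, fun x => by by_cases h : P x <;> simp [h, hQ]⟩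

theorem DecTime.iff {P Q : X → Prop} (hP : DecTime rs P) (hQ : DecTime rs Q) :
    DecTime rs fun x => P x ↔ Q x := by
  classical
  obtain ⟨u, hu, hQ'⟩ := hQ.not
  obtain ⟨v, hv, hQ⟩ := hQ
  exact ⟨_, hP.ite_polyTime hv hu, fun x => by by_cases h : P x <;> simp [h, hQ, hQ']⟩

theorem UnaryTime.ne_zero {n : X → ℕ} (hn : UnaryTime rs n) : DecTime rs fun x => n x ≠ 0 :=
  ⟨_, hn, fun x => by simp [unary_eq_nil]⟩

theorem UnaryTime.add {m n : X → ℕ} (hm : UnaryTime rs m) (hn : UnaryTime rs n) :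
    UnaryTime rs fun x => m x + n x :=
  (PolyTime.append hm hn).congr fun _ => (unary_add _ _).symm

theorem flatMap_range_unary (n : ℕ) (f : ℕ → ℕ) :
    ((List.range n).flatMap fun i => unary (f i)) = unary (∑ i ∈ Finset.range n, f i) := by
  induction n with
  | zero => rfl
  | succ n ih => simp [List.range_succ, ih, Finset.sum_range_succ, unary_add]

theorem UnaryTime.sum {n : X → ℕ} (hn : UnaryTime rs n) {f : X × ℕ → ℕ}
    (hf : UnaryTime (extend rs unary) f) :
    UnaryTime rs fun x => ∑ i ∈ Finset.range (n x), f (x, i) :=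
  (PolyTime.flatMap_range hn hf).congr fun _ => flatMap_range_unary _ _

theorem UnaryTime.mul {m n : X → ℕ} (hm : UnaryTime rs m) (hn : UnaryTime rs n) :
    UnaryTime rs fun x => m x * n x :=
  (hm.sum hn.weaken).congr fun x => by simp

/-- Without the bound `c`, iteration could produce superpolynomial values; a function with a
polynomial time unary output is polynomially bounded. -/
theorem UnaryTime.iterate {n m : X → ℕ} (hn : UnaryTime rs n) (hm : UnaryTime rs m)
    {f : X × ℕ → ℕ} (hf : UnaryTime (extend rs unary) f) {c : X → ℕ} (hc : UnaryTime rs c)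
    (hbound : ∀ x, ∀ i ≤ n x, (fun a => f (x, a))^[i] (m x) ≤ c x) :
    UnaryTime rs fun x => (fun a => f (x, a))^[n x] (m x) := by
  have hstep : PolyTime (extend rs fun l : List Γ' => l)
      fun y => unary (f (y.1, y.2.length)) :=
    PolyTime.subst (g := fun y : X × List Γ' => unary y.2.length)
      (PolyTime.length (f := fun y : X × List Γ' => y.2) PolyTime.var) hf
      (fun j => j.elim none fun i => some (some i)) (fun y => (y.1, y.2.length)) fun j y => by
        rcases j with _ | j <;> rfl
  have key : ∀ x i, (fun l : List Γ' => unary (f (x, l.length)))^[i] (unary (m x)) =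
      unary ((fun a => f (x, a))^[i] (m x)) := by
    intro x i
    induction i with
    | zero => rfl
    | succ i ih => rw [Function.iterate_succ_apply', ih, Function.iterate_succ_apply',
        length_unary]
  obtain ⟨b, hb, hlen, -⟩ := hc
  refine (PolyTime.iterate (c := b) hn hm hstep (fun j => j) (fun x l => (x, l))
    (fun x l j => by rcases j with _ | j <;> rfl) hb fun x B hB i hi => ?_).congr fun x => ?_
  · rw [key, length_unary]
    rw [length_unary] at hi
    exact (hbound x i hi).trans (by simpa using hlen x B hB)
  · rw [key, length_unary]

theorem UnaryTime.pred {n : X → ℕ} (hn : UnaryTime rs n) : UnaryTime rs fun x => n x - 1 := by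
  -- The predecessor counts the nonzero numbers below `n x`.
  refine (hn.sum (f := fun y => if y.2 ≠ 0 then 1 else 0)
    (UnaryTime.var.ne_zero.ite_unaryTime (.const 1) (.const 0))).congr fun x => ?_
  rcases n x with _ | k
  · simp
  · simp [Finset.sum_range_succ']

theorem UnaryTime.sub {m n : X → ℕ} (hm : UnaryTime rs m) (hn : UnaryTime rs n) :
    UnaryTime rs fun x => m x - n x := by
  have key : ∀ a i : ℕ, (fun a => a - 1)^[i] a = a - i := by
    intro a i
    induction i with
    | zero => rfl
    | succ i ih =>
      rw [Function.iterate_succ_apply', ih]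
      omega
  refine (hn.iterate hm (f := fun y => y.2 - 1) UnaryTime.var.pred hm fun x i _ => ?_).congr
    fun x => key _ _
  rw [key]
  omega

theorem UnaryTime.lt {m n : X → ℕ} (hm : UnaryTime rs m) (hn : UnaryTime rs n) :
    DecTime rs fun x => m x < n x :=
  (hn.sub hm).ne_zero.congr fun x => by omega

theorem UnaryTime.le {m n : X → ℕ} (hm : UnaryTime rs m) (hn : UnaryTime rs n) :
    DecTime rs fun x => m x ≤ n x :=
  (hn.lt hm).not.congr fun x => by omega

theorem UnaryTime.eq {m n : X → ℕ} (hm : UnaryTime rs m) (hn : UnaryTime rs n) :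
    DecTime rs fun x => m x = n x :=
  ((hm.le hn).and (hn.le hm)).congr fun x => by omega

theorem UnaryTime.min {m n : X → ℕ} (hm : UnaryTime rs m) (hn : UnaryTime rs n) :
    UnaryTime rs fun x => min (m x) (n x) :=
  (hm.sub (hm.sub hn)).congr fun x => by omega

/-- The quotient is the number of positive multiples of `n x` that do not exceed `m x`. -/
theorem UnaryTime.div {m n : X → ℕ} (hm : UnaryTime rs m) (hn : UnaryTime rs n)
    (h0 : ∀ x, 0 < n x) : UnaryTime rs fun x => m x / n x := by
  refine (hm.sum (f := fun y => if (y.2 + 1) * n y.1 ≤ m y.1 then 1 else 0)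
    ((((UnaryTime.var.add (.const 1)).mul hn.weaken).le hm.weaken).ite_unaryTime (.const 1)
      (.const 0))).congr fun x => ?_
  rw [Finset.sum_boole]
  have : (Finset.range (m x)).filter (fun i => (i + 1) * n x ≤ m x) =
      Finset.range (m x / n x) := by
    ext i
    simp only [Finset.mem_filter, Finset.mem_range]
    rw [← Nat.le_div_iff_mul_le (h0 x)]
    have := Nat.div_le_self (m x) (n x)
    omega
  simp [this]

theorem UnaryTime.mod {m n : X → ℕ} (hm : UnaryTime rs m) (hn : UnaryTime rs n)
    (h0 : ∀ x, 0 < n x) : UnaryTime rs fun x => m x % n x :=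
  (hm.sub (hn.mul (hm.div hn h0))).congr fun x => by
    have := Nat.div_add_mod (m x) (n x)
    omega

/-- A power of two may be too long in unary, so repeated doubling is truncated at a computable cap.
Truncating at every step gives the same result as truncating at the end. -/
theorem UnaryTime.two_pow {m c : X → ℕ} (hm : UnaryTime rs m) (hc : UnaryTime rs c) :
    UnaryTime rs fun x => Min.min (2 ^ m x) (c x) := by
  have key : ∀ c i : ℕ, (fun a => Min.min (a + a) c)^[i] (Min.min 1 c) = Min.min (2 ^ i) c := by
    intro c i
    induction i with
    | zero => rfl
    | succ i ih =>
      rw [Function.iterate_succ_apply', ih, pow_succ]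
      omega
  refine (hm.iterate ((UnaryTime.const 1).min hc) (f := fun y => Min.min (y.2 + y.2) (c y.1))
    ((UnaryTime.var.add UnaryTime.var).min hc.weaken) hc fun x i _ => ?_).congr
    fun x => key (c x) (m x)
  exact (key (c x) i).trans_le (Nat.min_le_right _ _)

/-- The logarithm counts the positive exponents whose power of two is at most `m x`. Truncation at
`m x + 1` does not affect this comparison. -/
theorem UnaryTime.log_two {m : X → ℕ} (hm : UnaryTime rs m) :
    UnaryTime rs fun x => Nat.log 2 (m x) := by
  refine (hm.sum (f := fun y => if Min.min (2 ^ (y.2 + 1)) (m y.1 + 1) ≤ m y.1 then 1 else 0)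
    ((((UnaryTime.var.add (.const 1)).two_pow (hm.weaken.add (.const 1))).le
      hm.weaken).ite_unaryTime (.const 1) (.const 0))).congr fun x => ?_
  simp only [Finset.sum_boole]
  have : (Finset.range (m x)).filter (fun i => Min.min (2 ^ (i + 1)) (m x + 1) ≤ m x) =
      Finset.range (Nat.log 2 (m x)) := by
    ext i
    simp only [Finset.mem_filter, Finset.mem_range]
    rcases Nat.eq_zero_or_pos (m x) with h | h
    · simp [h]
    · have h1 := Nat.le_log_iff_pow_le (x := i + 1) Nat.one_lt_two h.ne'
      have h2 := Nat.lt_two_pow_self (n := i + 1)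
      omega
  rw [this]
  simp

theorem UnaryTime.testBit {m k c : X → ℕ} (hm : UnaryTime rs m) (hk : UnaryTime rs k)
    (hc : UnaryTime rs c) (hle : ∀ x, 2 ^ k x ≤ c x) :
    DecTime rs fun x => (m x).testBit (k x) = true := by
  have h1 : UnaryTime rs fun x => 2 ^ k x :=
    (hk.two_pow hc).congr fun x => Nat.min_eq_left (hle x)
  refine (((hm.div h1 fun x => Nat.two_pow_pos _).mod (.const 2) fun _ => two_pos).eq
    (.const 1)).congr fun x => ?_
  rw [Nat.testBit_eq_decide_div_mod_eq, decide_eq_true_eq]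

end

/-! ### Games given by a list of arcs -/

namespace ArcGame

variable {α : Type}

/-- The vertices that occur in a list of weighted arcs. -/
def verts (l : List (α × α × ℤ)) : Set α := {x | ∃ a ∈ l, a.1 = x ∨ a.2.1 = x}

/-- `num` numbers the vertices of the arcs `l` by distinct numbers below `N`, and `l` has neither
loops nor parallel arcs. -/
structure IsNumbering (N : ℕ) (num : α → ℕ) (l : List (α × α × ℤ)) : Prop where
  lt : ∀ x ∈ verts l, num x < N
  injOn : Set.InjOn num (verts l)
  ne : ∀ a ∈ l, a.1 ≠ a.2.1
  nodup : (l.map fun a => (a.1, a.2.1)).Nodup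

variable {N : ℕ} {num : α → ℕ} {l : List (α × α × ℤ)}

theorem fst_mem {a : α × α × ℤ} (ha : a ∈ l) : a.1 ∈ verts l := ⟨a, ha, Or.inl rfl⟩

theorem snd_mem {a : α × α × ℤ} (ha : a ∈ l) : a.2.1 ∈ verts l := ⟨a, ha, Or.inr rfl⟩

/-- The game with `N` agents that is given by a list of arcs. -/
def game (h : IsNumbering N num l) : ASHG where
  n := N
  graph := ⟨fun u v => ∃ a ∈ l, num a.1 = u ∧ num a.2.1 = v⟩
  loopless := by
    rintro v ⟨a, ha, h1, h2⟩
    exact h.ne a ha (h.injOn (fst_mem ha) (snd_mem ha) (h1.trans h2.symm))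
  w u v := (l.map fun a => if num a.1 = u ∧ num a.2.1 = v then a.2.2 else 0).sum
  w_eq_zero := by
    intro u v huv
    refine List.sum_eq_zero fun z hz => ?_
    obtain ⟨a, ha, rfl⟩ := List.mem_map.1 hz
    exact if_neg fun e => huv ⟨a, ha, e⟩

theorem sum_map_ite_eq {β γ : Type} [DecidableEq β] (f : γ → β) (z : γ → ℤ) {l : List γ}
    (hl : (l.map f).Nodup) {a : γ} (ha : a ∈ l) :
    (l.map fun b => if f b = f a then z b else 0).sum = z a := by
  induction l with
  | nil => simp at ha
  | cons b l ih =>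
    rw [List.map_cons, List.nodup_cons] at hl
    rw [List.map_cons, List.sum_cons]
    rcases List.mem_cons.1 ha with rfl | ha
    · have : (l.map fun b => if f b = f a then z b else 0).sum = 0 := by
        refine List.sum_eq_zero fun y hy => ?_
        obtain ⟨c, hc, rfl⟩ := List.mem_map.1 hy
        exact if_neg fun e : f c = f a => hl.1 (e ▸ List.mem_map_of_mem hc)
      simp [this]
    · have : f b ≠ f a := fun e => hl.1 (e ▸ List.mem_map_of_mem ha)
      simp [this, ih hl.2 ha]

/-- Weights are sums over the list, and the absence of parallel arcs leaves a single term. -/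
theorem w_game (h : IsNumbering N num l) {a : α × α × ℤ} (ha : a ∈ l) (u v : Fin N)
    (hu : num a.1 = u) (hv : num a.2.1 = v) : (game h).w u v = a.2.2 := by
  classical
  rw [← sum_map_ite_eq (fun a : α × α × ℤ => (a.1, a.2.1)) (fun a => a.2.2) h.nodup ha]
  change (l.map fun a => if num a.1 = u ∧ num a.2.1 = v then a.2.2 else 0).sum = _
  congr 1
  refine List.map_congr_left fun b hb => ?_
  congr 1
  rw [← hu, ← hv, Prod.mk.injEq]
  exact propext (and_congr (h.injOn.eq_iff (fst_mem hb) (fst_mem ha))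
    (h.injOn.eq_iff (snd_mem hb) (snd_mem ha)))

theorem isEncoding_game (h : IsNumbering N num l) :
    (game h).IsEncoding (unaryField N ++ l.flatMap fun a =>
      unaryField (num a.1) ++ unaryField (num a.2.1) ++ intField a.2.2) := by
  let f : {a // a ∈ l} → Fin (game h).n × Fin (game h).n := fun a =>
    (⟨num a.1.1, h.lt _ (fst_mem a.2)⟩, ⟨num a.1.2.1, h.lt _ (snd_mem a.2)⟩)
  refine ⟨l.attach.map f, ?_, fun a => ?_, ?_⟩
  · have h1 := h.nodup
    rw [← List.attach_map_subtype_val l, List.map_map] at h1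
    refine List.Nodup.of_map (fun p => (p.1.1, p.2.1)) ?_
    rw [List.map_map]
    rw [List.nodup_map_iff_inj_on (List.nodup_attach.2 (List.Nodup.of_map _ h.nodup))] at h1 ⊢
    intro a ha b hb hab
    refine h1 a ha b hb ?_
    simp only [Function.comp_apply, Prod.mk.injEq] at hab ⊢
    exact ⟨h.injOn (fst_mem a.2) (fst_mem b.2) hab.1, h.injOn (snd_mem a.2) (snd_mem b.2) hab.2⟩
  · change _ ↔ ∃ b ∈ l, num b.1 = a.1 ∧ num b.2.1 = a.2
    constructor
    · intro ha
      obtain ⟨b, -, rfl⟩ := List.mem_map.1 ha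
      exact ⟨b.1, b.2, rfl, rfl⟩
    · rintro ⟨b, hb, h1, h2⟩
      exact List.mem_map.2 ⟨⟨b, hb⟩, List.mem_attach _ _, by
        ext
        · exact h1
        · exact h2⟩
  · congr 1
    conv_lhs => rw [← List.attach_map_subtype_val l]
    rw [List.flatMap_map, List.flatMap_map]
    refine List.flatMap_congr fun a _ => ?_
    rw [w_game h a.2 (f a).1 (f a).2 rfl rfl]

/-! ### Nash stability in terms of colourings of the agents -/

section Stable

variable [DecidableEq α] {κ : Type} [DecidableEq κ]

/-- The utility that `v` gains from the agents of colour `C`. -/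
def util (l : List (α × α × ℤ)) (c : α → κ) (v : α) (C : κ) : ℤ :=
  (l.map fun a => if a.1 = v ∧ c a.2.1 = C then a.2.2 else 0).sum

/-- The colour classes of `c` form a Nash stable partition. -/
def Stable (l : List (α × α × ℤ)) (c : α → κ) : Prop :=
  ∀ v C, 0 ≤ util l c v (c v) ∧ util l c v C ≤ util l c v (c v)

/-- Exchanging the two sums leaves at most one term per arc. Erasing `v` from its coalition changes
nothing because there are no loops. -/
theorem utility_game (h : IsNumbering N num l) {c : α → κ} {c' : Fin N → κ}
    (hc : ∀ (k : Fin N), ∀ x ∈ verts l, num x = k → c' k = c x) {x : α} (hx : x ∈ verts l)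
    {v : Fin N} (hv : num x = v) {S : Finset (Fin N)} {C : κ} (hS : ∀ k, k ∈ S ↔ c' k = C) :
    (game h).utility v S = util l c x C := by
  -- The induction runs over lists contained in `l`, since injectivity of the numbering refers to
  -- the fixed list `l`.
  have key : ∀ l' : List (α × α × ℤ), (∀ a ∈ l', a ∈ l) →
      ∑ u ∈ S.erase v, (l'.map fun a => if num a.1 = v ∧ num a.2.1 = u then a.2.2 else 0).sum =
      util l' c x C := by
    intro l' hl'
    induction l' with
    | nil => simp [util]
    | cons a l' ih =>
      have ha : a ∈ l := hl' a (by simp)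
      have ih := ih fun b hb => hl' b (by simp [hb])
      rw [util, List.map_cons, List.sum_cons]
      rw [util] at ih
      simp only [List.map_cons, List.sum_cons, Finset.sum_add_distrib, ih]
      congr 1
      have e1 : num a.1 = v ↔ a.1 = x := by
        rw [← hv]
        exact h.injOn.eq_iff (fst_mem ha) hx
      simp only [e1]
      by_cases h1 : a.1 = x
      · have hu := h.lt _ (snd_mem ha)
        have e2 : ∀ u : Fin N, num a.2.1 = u ↔ u = ⟨num a.2.1, hu⟩ := fun u => by
          rw [Fin.ext_iff]
          exact eq_comm
        simp only [h1, true_and, e2, Finset.sum_ite_eq']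
        congr 1
        rw [Finset.mem_erase, hS, hc _ _ (snd_mem ha) rfl]
        refine propext (and_iff_right fun e => ?_)
        have : num a.2.1 = v := by rw [← e]
        exact h.ne a ha (h.injOn (fst_mem ha) (snd_mem ha) ((e1.2 h1).trans this.symm))
      · simp [h1]
  exact key l fun _ ha => ha

theorem util_eq_zero {c : α → κ} {v : α} (hv : v ∉ verts l) (C : κ) : util l c v C = 0 := by
  refine List.sum_eq_zero fun z hz => ?_
  obtain ⟨a, ha, rfl⟩ := List.mem_map.1 hz
  refine if_neg fun e => hv ?_
  rw [← e.1]
  exact fst_mem ha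

/-- Each agent is coloured by its coalition. A colour that is not a coalition is attained by no
target of an arc and offers utility 0. -/
theorem exists_stable_of_hasNash (h : IsNumbering N num l) (hG : (game h).HasNashStablePartition) :
    ∃ c : α → Finset (Fin N), Stable l c := by
  classical
  obtain ⟨π, hπ⟩ := hG
  let c' : Fin N → Finset (Fin N) := fun k => π.part k
  let c : α → Finset (Fin N) := fun x => if hx : x ∈ verts l then c' ⟨num x, h.lt x hx⟩ else ∅
  have hc : ∀ (k : Fin N), ∀ x ∈ verts l, num x = k → c' k = c x := by
    intro k x hx e
    simp only [c, dif_pos hx]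
    congr 1
    ext
    exact e.symm
  refine ⟨c, fun v C => ?_⟩
  by_cases hv : v ∈ verts l
  · obtain ⟨k, hk⟩ : ∃ k : Fin N, num v = k := ⟨⟨num v, h.lt v hv⟩, rfl⟩
    have hS : ∀ S ∈ π.parts, ∀ k, k ∈ S ↔ c' k = S := fun S hS k =>
      ⟨fun hk => π.part_eq_of_mem hS hk, fun e => by
        rw [← e]
        exact π.mem_part (Finset.mem_univ k)⟩
    have hck : c' k ∈ π.parts := π.part_mem.2 (Finset.mem_univ k)
    have hst := hπ (c' k) hck k ((hS _ hck k).2 rfl)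
    rw [utility_game h hc hv hk (hS _ hck)] at hst
    rw [← hc k v hv hk]
    refine ⟨hst.1, ?_⟩
    by_cases hC : C ∈ π.parts
    · have := hst.2 C hC
      rwa [utility_game h hc hv hk (hS _ hC)] at this
    · refine le_trans (le_of_eq ?_) hst.1
      refine List.sum_eq_zero fun z hz => ?_
      obtain ⟨a, ha, rfl⟩ := List.mem_map.1 hz
      refine if_neg fun e => hC ?_
      rw [← e.2]
      simp only [c, dif_pos (snd_mem ha)]
      exact π.part_mem.2 (Finset.mem_univ _)
  · simp [util_eq_zero hv]

theorem hasNash_of_stable (h : IsNumbering N num l) {c : α → ℕ} (hs : Stable l c) :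
    (game h).HasNashStablePartition := by
  classical
  -- Numbers of no agent on an arc get the default colour 0. They carry no arcs, so their coalition
  -- is immaterial.
  let c' : Fin N → ℕ := fun k => if hk : ∃ x ∈ verts l, num x = k then c hk.choose else 0
  have hc : ∀ (k : Fin N), ∀ x ∈ verts l, num x = k → c' k = c x := by
    intro k x hx e
    have hk : ∃ x ∈ verts l, num x = k := ⟨x, hx, e⟩
    simp only [c', dif_pos hk]
    rw [h.injOn hk.choose_spec.1 hx (hk.choose_spec.2.trans e.symm)]
  let π := Finpartition.ofSetoid (Setoid.ker c')
  have hpart : ∀ S ∈ π.parts, ∃ C, ∀ k, k ∈ S ↔ c' k = C := by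
    intro S hS
    obtain ⟨k, hk⟩ := π.nonempty_of_mem_parts hS
    refine ⟨c' k, fun k' => ?_⟩
    rw [← π.part_eq_of_mem hS hk, Finpartition.mem_part_ofSetoid_iff_rel]
    exact eq_comm
  refine ⟨π, fun S hS v hv => ?_⟩
  obtain ⟨C, hC⟩ := hpart S hS
  by_cases hx : ∃ x ∈ verts l, num x = v
  · obtain ⟨x, hx, e⟩ := hx
    have hCx : C = c x := by
      rw [← (hC v).1 hv]
      exact hc v x hx e
    rw [utility_game h hc hx e hC, hCx]
    refine ⟨(hs x 0).1, fun S' hS' => ?_⟩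
    obtain ⟨C', hC'⟩ := hpart S' hS'
    rw [utility_game h hc hx e hC']
    exact (hs x C').2
  · have h0 : ∀ S', (game h).utility v S' = 0 := by
      intro S'
      refine Finset.sum_eq_zero fun u _ => (game h).w_eq_zero _ _ ?_
      rintro ⟨a, ha, e, -⟩
      exact hx ⟨_, fst_mem ha, e⟩
    simp [h0]

end Stable

end ArcGame

/-! ### The game of a formula -/

/-- The agents of the game of a formula. There are two families of items: the items `false` stand
for blocks of variables, and the items `true` for the assignments to the variables of a block. -/
inductive Agent
  | hub (β : Bool) (t : ℕ)
  | chk (t : ℕ)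
  | grb (t : ℕ)
  | lit (t i : ℕ)
  | itm (β : Bool) (t i : ℕ)
  deriving DecidableEq

/-- The literals of a formula with `M` clauses, whose variables are arranged in `g` blocks of
`b` variables. -/
structure BlockedFormula where
  /-- the number of blocks -/
  g : ℕ
  /-- the size of a block -/
  b : ℕ
  /-- the number of clauses -/
  M : ℕ
  /-- the variables of the literals of a clause -/
  var : ℕ → ℕ → ℕ
  /-- the signs of the literals of a clause -/
  sgn : ℕ → ℕ → Bool

namespace BlockedFormula

open Agent ArcGame

/-- An arc, together with an arc of weight `-2` in the other direction. -/
def pair (x y : Agent) (w : ℤ) : List (Agent × Agent × ℤ) := [(x, y, w), (y, x, -2)]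

variable (F : BlockedFormula)

/-- The number of items of a family. -/
def size (β : Bool) : ℕ := cond β (2 ^ F.b) F.g

/-- The arcs that make the items of two consecutive layers form the same coalitions. -/
def hubArcs (β : Bool) (t : ℕ) : List (Agent × Agent × ℤ) :=
  (List.range (F.size β)).flatMap fun i =>
    pair (hub β t) (itm β t i) (2 ^ i) ++ pair (hub β t) (itm β (t + 1) i) (-2 ^ i)

/-- The arcs that make one of the literals of a clause join an assignment. -/
def chkArcs (t : ℕ) : List (Agent × Agent × ℤ) :=
  pair (chk t) (grb t) (-2) ++
    (List.range (2 ^ F.b)).flatMap fun j => pair (chk t) (itm true t j) (-3)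

/-- The arcs that prevent a literal from joining an assignment that does not satisfy it. -/
def litArcs (t i : ℕ) : List (Agent × Agent × ℤ) :=
  pair (chk t) (lit t i) 1 ++ ([(lit t i, itm false t (F.var t i / F.b), 1)] ++
    (List.range (2 ^ F.b)).flatMap fun j => [(lit t i, itm true t j,
      if j.testBit (F.var t i % F.b) = true ↔ F.sgn t i = true then -1 else -2)])

/-- The arcs of a clause. -/
def layer (t : ℕ) : List (Agent × Agent × ℤ) :=
  (F.hubArcs false t ++ F.hubArcs true t) ++ (F.chkArcs t ++ (List.range 3).flatMap (F.litArcs t))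

/-- The arcs of the game of a formula. -/
def arcs : List (Agent × Agent × ℤ) := (List.range F.M).flatMap F.layer

/-! ### Utilities in the game of a formula -/

section Util

variable {κ : Type} [DecidableEq κ] (c : Agent → κ) (C : κ)

theorem util_append (l l' : List (Agent × Agent × ℤ)) (v : Agent) :
    util (l ++ l') c v C = util l c v C + util l' c v C := by
  simp [util]

theorem util_flatMap_range (n : ℕ) (f : ℕ → List (Agent × Agent × ℤ)) (v : Agent) :
    util ((List.range n).flatMap f) c v C = ∑ i ∈ Finset.range n, util (f i) c v C := by
  induction n with
  | zero => rfl
  | succ n ih => simp [List.range_succ, util_append, ih, Finset.sum_range_succ]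

theorem util_pair (x y v : Agent) (w : ℤ) :
    util (pair x y w) c v C =
      (if x = v ∧ c y = C then w else 0) + if y = v ∧ c x = C then -2 else 0 := by
  simp [util, pair]

theorem util_single (x y v : Agent) (w : ℤ) :
    util [(x, y, w)] c v C = if x = v ∧ c y = C then w else 0 := by
  simp [util]

/-- All arcs leaving a hub belong to the layer of its index; the same holds for checks and literals.
Hence the later sums over layers collapse to one term. -/
theorem util_layer_hub (β : Bool) (t t' : ℕ) :
    util (F.layer t') c (hub β t) C = if t' = t then ∑ i ∈ Finset.range (F.size β),
      ((if c (itm β t i) = C then 2 ^ i else 0) - if c (itm β (t + 1) i) = C then 2 ^ i else 0)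
      else 0 := by
  simp only [layer, hubArcs, chkArcs, litArcs, util_append, util_flatMap_range, util_pair,
    util_single]
  by_cases ht : t' = t
  · subst ht
    have h : ∀ f : ℕ → ℤ, ∑ i ∈ Finset.range (F.size β),
        ((if c (itm β t' i) = C then f i else 0) + if c (itm β (t' + 1) i) = C then -f i else 0) =
        ∑ i ∈ Finset.range (F.size β),
        ((if c (itm β t' i) = C then f i else 0) - if c (itm β (t' + 1) i) = C then f i else 0) :=
      fun f => Finset.sum_congr rfl fun i _ => by split_ifs <;> ring
    rw [← h]
    cases β <;> simp
  · simp [ht]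

theorem util_layer_chk (t t' : ℕ) :
    util (F.layer t') c (chk t) C = if t' = t then (if c (grb t) = C then -2 else 0) +
      (∑ j ∈ Finset.range (2 ^ F.b), if c (itm true t j) = C then -3 else 0) +
      ∑ i ∈ Finset.range 3, if c (lit t i) = C then 1 else 0
      else 0 := by
  simp only [layer, hubArcs, chkArcs, litArcs, util_append, util_flatMap_range, util_pair,
    util_single]
  by_cases ht : t' = t
  · subst ht
    simp
  · simp [ht]

theorem util_layer_lit (t t' : ℕ) {i : ℕ} (hi : i < 3) :
    util (F.layer t') c (lit t i) C = if t' = t then (if c (chk t) = C then -2 else 0) +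
      ((if c (itm false t (F.var t i / F.b)) = C then 1 else 0) +
      ∑ j ∈ Finset.range (2 ^ F.b), if c (itm true t j) = C then
        (if j.testBit (F.var t i % F.b) = true ↔ F.sgn t i = true then -1 else -2) else 0)
      else 0 := by
  simp only [layer, hubArcs, chkArcs, litArcs, util_append, util_flatMap_range, util_pair,
    util_single]
  by_cases ht : t' = t
  · subst ht
    simp
    rw [Finset.sum_eq_single i]
    · simp
    · intro k _ hk
      simp [hk]
    · simp [hi]
  · simp [ht]

theorem util_arcs (v : Agent) :
    util F.arcs c v C = ∑ t ∈ Finset.range F.M, util (F.layer t) c v C := util_flatMap_range _ _ _ _ _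

theorem util_hub (β : Bool) (t : ℕ) :
    util F.arcs c (hub β t) C = if t < F.M then ∑ i ∈ Finset.range (F.size β),
      ((if c (itm β t i) = C then 2 ^ i else 0) - if c (itm β (t + 1) i) = C then 2 ^ i else 0)
      else 0 := by
  simp only [util_arcs, util_layer_hub, Finset.sum_ite_eq', Finset.mem_range]

theorem util_chk (t : ℕ) :
    util F.arcs c (chk t) C = if t < F.M then (if c (grb t) = C then -2 else 0) +
      (∑ j ∈ Finset.range (2 ^ F.b), if c (itm true t j) = C then -3 else 0) +
      ∑ i ∈ Finset.range 3, if c (lit t i) = C then 1 else 0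
      else 0 := by
  simp only [util_arcs, util_layer_chk, Finset.sum_ite_eq', Finset.mem_range]

theorem util_lit (t : ℕ) {i : ℕ} (hi : i < 3) :
    util F.arcs c (lit t i) C = if t < F.M then (if c (chk t) = C then -2 else 0) +
      ((if c (itm false t (F.var t i / F.b)) = C then 1 else 0) +
      ∑ j ∈ Finset.range (2 ^ F.b), if c (itm true t j) = C then
        (if j.testBit (F.var t i % F.b) = true ↔ F.sgn t i = true then -1 else -2) else 0)
      else 0 := by
  simp only [util_arcs, util_layer_lit F c C _ _ hi, Finset.sum_ite_eq', Finset.mem_range]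

theorem util_nonpos {l : List (Agent × Agent × ℤ)} {v : Agent}
    (h : ∀ a ∈ l, a.1 = v → c a.2.1 = C → a.2.2 ≤ 0) : util l c v C ≤ 0 := by
  refine (List.sum_le_card_nsmul _ 0 fun z hz => ?_).trans_eq (nsmul_zero _)
  obtain ⟨a, ha, rfl⟩ := List.mem_map.1 hz
  split_ifs with h'
  · exact h a ha h'.1 h'.2
  · exact le_rfl

theorem util_eq_zero_of_forall {l : List (Agent × Agent × ℤ)} {v : Agent}
    (h : ∀ a ∈ l, a.1 = v → c a.2.1 ≠ C) : util l c v C = 0 := by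
  refine List.sum_eq_zero fun z hz => ?_
  obtain ⟨a, ha, rfl⟩ := List.mem_map.1 hz
  exact if_neg fun e => h a ha e.1 e.2

theorem util_neg {l : List (Agent × Agent × ℤ)} {v : Agent}
    (h : ∀ a ∈ l, a.1 = v → c a.2.1 = C → a.2.2 ≤ 0) {a : Agent × Agent × ℤ} (ha : a ∈ l)
    (hv : a.1 = v) (hC : c a.2.1 = C) (hw : a.2.2 < 0) : util l c v C < 0 := by
  obtain ⟨l₁, l₂, rfl⟩ := List.append_of_mem ha
  have h1 := util_nonpos c C (l := l₁) (v := v) fun a ha => h a (by simp [ha])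
  have h2 := util_nonpos c C (l := l₂) (v := v) fun a ha => h a (by simp [ha])
  have : util (l₁ ++ a :: l₂) c v C = util l₁ c v C + (a.2.2 + util l₂ c v C) := by
    simp [util, hv, hC]
  omega

end Util

theorem mem_pair {x y : Agent} {w : ℤ} {a : Agent × Agent × ℤ} :
    a ∈ pair x y w ↔ a = (x, y, w) ∨ a = (y, x, -2) := by
  simp [pair]

theorem mem_arcs {a : Agent × Agent × ℤ} : a ∈ F.arcs ↔ ∃ t < F.M,
    (∃ β, ∃ i < F.size β, (a ∈ pair (hub β t) (itm β t i) (2 ^ i) ∨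
      a ∈ pair (hub β t) (itm β (t + 1) i) (-2 ^ i))) ∨
    a ∈ pair (chk t) (grb t) (-2) ∨ (∃ j < 2 ^ F.b, a ∈ pair (chk t) (itm true t j) (-3)) ∨
    ∃ i < 3, a ∈ pair (chk t) (lit t i) 1 ∨ a = (lit t i, itm false t (F.var t i / F.b), 1) ∨
      ∃ j < 2 ^ F.b, a = (lit t i, itm true t j,
        if j.testBit (F.var t i % F.b) = true ↔ F.sgn t i = true then -1 else -2) := by
  simp only [arcs, layer, hubArcs, chkArcs, litArcs, List.mem_flatMap, List.mem_range,
    List.mem_append, List.mem_singleton, Bool.exists_bool, or_assoc]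

/-- Items have no outgoing arcs but the negative ones to hubs and checks; this keeps the latter
apart from the items they are joined to. -/
theorem arc_itm {a : Agent × Agent × ℤ} (ha : a ∈ F.arcs) {β : Bool} {t i : ℕ}
    (h : a.1 = itm β t i) :
    a.2.2 = -2 ∧ ((∃ β t, a.2.1 = hub β t) ∨ ∃ t, a.2.1 = chk t) := by
  rw [mem_arcs] at ha
  simp only [mem_pair] at ha
  aesop

theorem arc_grb {a : Agent × Agent × ℤ} (ha : a ∈ F.arcs) {t : ℕ}
    (h : a.1 = grb t) : a.2.2 = -2 ∧ ∃ t, a.2.1 = chk t := by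
  rw [mem_arcs] at ha
  simp only [mem_pair] at ha
  aesop

theorem arc_lit {a : Agent × Agent × ℤ} (ha : a ∈ F.arcs) {t i : ℕ}
    (h : a.1 = lit t i) : i < 3 := by
  rw [mem_arcs] at ha
  simp only [mem_pair] at ha
  aesop

/-! ### Satisfiability of the formula and stability of the game -/

section Satisfiable

/-- Some assignment satisfies all clauses. -/
def Satisfiable : Prop := ∃ a : ℕ → Bool, ∀ t < F.M, ∃ i < 3, a (F.var t i) = F.sgn t i

variable {F} {κ : Type} [DecidableEq κ]

/-- Agents who are weighted by distinct powers of two are in the same coalitions if the weights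
balance. -/
theorem eq_of_binary_balance (A B : ℕ → κ) (n : ℕ)
    (h : ∀ C, ∑ i ∈ Finset.range n,
      ((if A i = C then (2 : ℤ) ^ i else 0) - if B i = C then 2 ^ i else 0) ≤ 0) :
    ∀ i < n, A i = B i := by
  set S := (Finset.range n).image A ∪ (Finset.range n).image B with hS
  -- Over all colours, every `i` contributes `2 ^ i` once with each sign. A vanishing sum of
  -- nonpositive terms forces every term to vanish.
  have hsum : ∑ C ∈ S, ∑ i ∈ Finset.range n,
      ((if A i = C then (2 : ℤ) ^ i else 0) - if B i = C then 2 ^ i else 0) = 0 := by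
    rw [Finset.sum_comm]
    refine Finset.sum_eq_zero fun i hi => ?_
    have h1 : A i ∈ S := Finset.mem_union_left _ (Finset.mem_image_of_mem A hi)
    have h2 : B i ∈ S := Finset.mem_union_right _ (Finset.mem_image_of_mem B hi)
    rw [Finset.sum_sub_distrib, Finset.sum_ite_eq, Finset.sum_ite_eq, if_pos h1, if_pos h2,
      sub_self]
  have hz := (Finset.sum_eq_zero_iff_of_nonpos fun C _ => h C).1 hsum
  intro i hi
  have hi' := Finset.mem_range.2 hi
  have h1 := hz (A i) (Finset.mem_union_left _ (Finset.mem_image_of_mem A hi'))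
  rw [Finset.sum_sub_distrib, ← Finset.sum_filter, ← Finset.sum_filter, sub_eq_zero] at h1
  -- Equal sums of distinct powers of two come from equal index sets.
  have h2 := Finset.geomSum_injective (n := 2) le_rfl (a₁ := (Finset.range n).filter (A · = A i))
    (a₂ := (Finset.range n).filter (B · = A i)) (by exact_mod_cast h1)
  have h3 : i ∈ (Finset.range n).filter (A · = A i) := by simp [hi]
  rw [h2] at h3
  exact (Finset.mem_filter.1 h3).2.symm

/-- No positive arc could compensate the item for the `-2`, and a stable agent has nonnegative
utility. -/
theorem ne_of_stable {c : Agent → κ} (hs : Stable F.arcs c) {β : Bool} {t i : ℕ} {x : Agent}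
    (hx : (itm β t i, x, -2) ∈ F.arcs) : c x ≠ c (itm β t i) := fun e => by
  have := util_neg c (c (itm β t i)) (v := itm β t i)
    (fun a ha h _ => by rw [(F.arc_itm ha h).1]; omega) hx rfl e (by simp)
  have := (hs (itm β t i) (c (itm β t i))).1
  omega

/-- A hub avoids the items it is joined to, so its own utility is 0 and no colour may offer more.
This is the hypothesis of `eq_of_binary_balance`. -/
theorem color_itm {c : Agent → κ} (hs : Stable F.arcs c) (β : Bool) {t i : ℕ} (ht : t ≤ F.M)
    (hi : i < F.size β) : c (itm β t i) = c (itm β 0 i) := by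
  induction t with
  | zero => rfl
  | succ t ih =>
    rw [← ih (by omega)]
    refine (eq_of_binary_balance (fun i => c (itm β t i)) (fun i => c (itm β (t + 1) i))
      (F.size β) (fun C => ?_) i hi).symm
    have h1 := (hs (hub β t) C).2
    rw [util_hub, util_hub, if_pos (by omega), if_pos (by omega)] at h1
    refine h1.trans (le_of_eq (Finset.sum_eq_zero fun j hj => ?_))
    rw [Finset.mem_range] at hj
    have h2 : c (hub β t) ≠ c (itm β t j) := ne_of_stable hs (by
      rw [mem_arcs]
      exact ⟨t, by omega, Or.inl ⟨β, j, hj, Or.inl (by simp [pair])⟩⟩)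
    have h3 : c (hub β t) ≠ c (itm β (t + 1) j) := ne_of_stable hs (by
      rw [mem_arcs]
      exact ⟨t, by omega, Or.inl ⟨β, j, hj, Or.inr (by simp [pair])⟩⟩)
    simp [h2.symm, h3.symm]

/-- The check agent has utility at most 0 because the literals do not tolerate it. If no literal
shared a coalition with an assignment item, only the garbage agent could deter the check agent from
joining literals, and it cannot outweigh three of them. -/
theorem exists_lit_of_stable {c : Agent → κ} (hs : Stable F.arcs c) {t : ℕ} (ht : t < F.M) :
    ∃ i < 3, ∃ j < 2 ^ F.b, c (itm true t j) = c (lit t i) := by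
  by_contra! hno
  -- The check agent costs a literal 2, and its only positive arc, to its block, repays 1.
  have hlit : ∀ i < 3, c (chk t) ≠ c (lit t i) := by
    intro i hi e
    have h1 := (hs (lit t i) (c (lit t i))).1
    rw [util_lit F c _ t hi, if_pos ht, if_pos e] at h1
    have h2 : ∑ j ∈ Finset.range (2 ^ F.b), (if c (itm true t j) = c (lit t i) then
        (if j.testBit (F.var t i % F.b) = true ↔ F.sgn t i = true then (-1 : ℤ) else -2) else 0)
        ≤ 0 := Finset.sum_nonpos fun j _ => by split_ifs <;> omega
    have h3 : (if c (itm false t (F.var t i / F.b)) = c (lit t i) then (1 : ℤ) else 0) ≤ 1 := by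
      split_ifs <;> omega
    omega
  have hown : util F.arcs c (chk t) (c (chk t)) ≤ 0 := by
    rw [util_chk, if_pos ht]
    have h1 : (if c (grb t) = c (chk t) then (-2 : ℤ) else 0) ≤ 0 := by split_ifs <;> omega
    have h2 : ∑ j ∈ Finset.range (2 ^ F.b), (if c (itm true t j) = c (chk t) then (-3 : ℤ) else 0)
        ≤ 0 := Finset.sum_nonpos fun j _ => by split_ifs <;> omega
    have h3 : ∑ i ∈ Finset.range 3, (if c (lit t i) = c (chk t) then (1 : ℤ) else 0) = 0 :=
      Finset.sum_eq_zero fun i hi => if_neg (hlit i (Finset.mem_range.1 hi)).symm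
    omega
  have hlits : ∀ k < 3, (if c (grb t) = c (lit t k) then (-2 : ℤ) else 0) +
      ∑ i ∈ Finset.range 3, (if c (lit t i) = c (lit t k) then 1 else 0) ≤ 0 := by
    intro k hk
    have h1 := ((hs (chk t) (c (lit t k))).2).trans hown
    rw [util_chk, if_pos ht, Finset.sum_eq_zero (s := Finset.range (2 ^ F.b)), add_zero] at h1
    · exact h1
    · intro j hj
      exact if_neg (hno k hk j (Finset.mem_range.1 hj))
  -- A coalition with a literal and neither the garbage agent nor an assignment item would offer the
  -- check agent at least 1.
  have hg : ∀ k < 3, c (lit t k) = c (grb t) := by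
    intro k hk
    by_contra hne
    have h1 := hlits k hk
    rw [if_neg (Ne.symm hne)] at h1
    have h2 := Finset.single_le_sum (f := fun i => if c (lit t i) = c (lit t k) then (1 : ℤ) else 0)
      (fun i _ => by split_ifs <;> omega) (Finset.mem_range.2 hk)
    rw [if_pos rfl] at h2
    omega
  -- All three literals are with the garbage agent, so their coalition offers `3 - 2 = 1`.
  have h1 := hlits 0 (by omega)
  rw [Finset.sum_range_succ, Finset.sum_range_succ, Finset.sum_range_succ, hg 0 (by omega),
    hg 1 (by omega), hg 2 (by omega)] at h1
  simp at h1

/-- The literal found by `exists_lit_of_stable` must break even: its block's `+1` can pay for just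
one assignment item, and only at the price 1 of a satisfying one. Layer `0` records the same
coalitions as layer `t`. -/
theorem satisfiable_of_stable (hg : ∀ t < F.M, ∀ i < 3, F.var t i / F.b < F.g) {c : Agent → κ}
    (hs : Stable F.arcs c) : F.Satisfiable := by
  -- A variable reads its bit from an assignment item that shares the coalition of its block. The
  -- default `false` never matters for the literals used below.
  refine ⟨fun x => if h : ∃ j < 2 ^ F.b, c (itm true 0 j) = c (itm false 0 (x / F.b)) then
    h.choose.testBit (x % F.b) else false, fun t ht => ?_⟩
  obtain ⟨i, hi, j, hj, e⟩ := exists_lit_of_stable hs ht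
  refine ⟨i, hi, ?_⟩
  have h1 := (hs (lit t i) (c (lit t i))).1
  rw [util_lit F c _ t hi, if_pos ht] at h1
  set x := F.var t i with hx
  set f : ℕ → ℤ := fun j => if c (itm true t j) = c (lit t i) then
    (if j.testBit (x % F.b) = true ↔ F.sgn t i = true then -1 else -2) else 0 with hf
  change 0 ≤ _ + (_ + ∑ j ∈ Finset.range (2 ^ F.b), f j) at h1
  have h2 : ∀ j, f j ≤ 0 := fun j => by
    simp only [hf]
    split_ifs <;> omega
  have h3 : (if c (chk t) = c (lit t i) then (-2 : ℤ) else 0) ≤ 0 := by split_ifs <;> omega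
  have h4 := Finset.add_sum_erase (Finset.range (2 ^ F.b)) f (Finset.mem_range.2 hj)
  have h5 : ∑ k ∈ (Finset.range (2 ^ F.b)).erase j, f k ≤ 0 := Finset.sum_nonpos fun k _ => h2 k
  have h6 : f j = if j.testBit (x % F.b) = true ↔ F.sgn t i = true then -1 else -2 := by
    simp only [hf, if_pos e]
  have htok : c (itm false t (x / F.b)) = c (lit t i) := by
    by_contra hne
    rw [if_neg hne] at h1
    have : f j ≤ -1 := by
      rw [h6]
      split_ifs <;> omega
    omega
  rw [if_pos htok] at h1
  have hbit : j.testBit (x % F.b) = F.sgn t i := by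
    rw [Bool.eq_iff_iff]
    by_contra hne
    rw [if_neg hne] at h6
    omega
  -- A second assignment item would push the literal's utility below 0; thus the choice made in the
  -- witness is forced.
  have huniq : ∀ k < 2 ^ F.b, c (itm true t k) = c (lit t i) → k = j := by
    intro k hk hk'
    by_contra hne
    have h7 := Finset.sum_le_sum_of_subset_of_nonneg (f := fun k => - f k)
      (s := {k}) (t := (Finset.range (2 ^ F.b)).erase j) (by simp [hk, hne])
      (fun k _ _ => by have := h2 k; omega)
    rw [Finset.sum_singleton, Finset.sum_neg_distrib] at h7
    have h8 : f k ≤ -1 := by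
      simp only [hf, if_pos hk']
      split_ifs <;> omega
    have h9 : f j ≤ -1 := by
      rw [h6]
      split_ifs <;> omega
    omega
  have hM := ht.le
  have hgt : x / F.b < F.size false := hg t ht i hi
  have hex : ∃ j < 2 ^ F.b, c (itm true 0 j) = c (itm false 0 (x / F.b)) :=
    ⟨j, hj, by rw [← color_itm hs true hM hj, ← color_itm hs false hM hgt, e, htok]⟩
  refine (dif_pos hex).trans ?_
  have hch := hex.choose_spec
  rw [huniq _ hch.1 (by rw [color_itm hs true hM hch.1, hch.2, ← color_itm hs false hM hgt, htok])]
  exact hbit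

/-- Coalition `0` holds hubs and checks, `1` holds the garbage agents and the false literals, and `j
+ 2` holds assignment `j` with the blocks that receive it and their true literals. Every agent has
utility 0 and is offered nothing better. -/
theorem exists_stable_of_satisfiable (hb : 0 < F.b)
    (h : F.Satisfiable) : ∃ c : Agent → ℕ, Stable F.arcs c := by
  obtain ⟨a, ha⟩ := h
  let val : ℕ → ℕ := fun i => Nat.ofBits fun k : Fin F.b => a (i * F.b + k)
  have hval : ∀ i, val i < 2 ^ F.b := fun i => Nat.ofBits_lt_two_pow _
  have hbit : ∀ x, (val (x / F.b)).testBit (x % F.b) = a x := by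
    intro x
    rw [Nat.testBit_ofBits_lt _ _ (Nat.mod_lt _ hb)]
    congr 1
    exact Nat.div_add_mod' x F.b
  let c : Agent → ℕ := fun
    | hub _ _ => 0
    | chk _ => 0
    | grb _ => 1
    | lit t i => if a (F.var t i) = F.sgn t i then val (F.var t i / F.b) + 2 else 1
    | itm true _ j => j + 2
    | itm false _ i => val i + 2
  have hlit_ne : ∀ t i, c (lit t i) ≠ 0 := fun t i => by
    simp only [c]
    split_ifs <;> omega
  have hhub : ∀ β t C, util F.arcs c (hub β t) C = 0 := by
    intro β t C
    rw [util_hub]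
    split_ifs
    · refine Finset.sum_eq_zero fun i _ => ?_
      cases β <;> simp [c]
    · rfl
  have hchk0 : ∀ t, util F.arcs c (chk t) 0 = 0 := by
    intro t
    rw [util_chk]
    simp only [hlit_ne]
    simp [c]
  have hchk : ∀ t C, util F.arcs c (chk t) C ≤ 0 := by
    intro t C
    rcases C with _ | _ | C
    · exact (hchk0 t).le
    · rw [util_chk]
      split_ifs with ht hg
      · obtain ⟨i, hi, e⟩ := ha t ht
        -- A satisfied clause has at most two false literals, which the garbage agent's `-2`
        -- balances.
        have h1 : ∑ i ∈ Finset.range 3, (if c (lit t i) = 1 then (1 : ℤ) else 0) ≤ 2 := by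
          rw [← Finset.add_sum_erase _ _ (Finset.mem_range.2 hi)]
          have h2 := Finset.sum_le_card_nsmul ((Finset.range 3).erase i)
            (fun i => if c (lit t i) = 1 then (1 : ℤ) else 0) 1
            (fun i _ => by split_ifs <;> omega)
          rw [Finset.card_erase_of_mem (Finset.mem_range.2 hi), Finset.card_range] at h2
          have h3 : c (lit t i) ≠ 1 := by simp [c, e]
          rw [if_neg h3, zero_add]
          exact h2
        have h5 : ∑ j ∈ Finset.range (2 ^ F.b), (if c (itm true t j) = 1 then (-3 : ℤ) else 0)
            = 0 := Finset.sum_eq_zero fun j _ => by simp [c]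
        rw [zero_add, h5]
        omega
      · exact absurd rfl hg
      · exact le_rfl
    · rw [util_chk]
      split_ifs with ht hg
      · simp [c] at hg
      · by_cases hC : C < 2 ^ F.b
        · have h1 : ∑ j ∈ Finset.range (2 ^ F.b),
              (if c (itm true t j) = C + 1 + 1 then (-3 : ℤ) else 0) = -3 := by
            simp [c, hC]
          have h2 := Finset.sum_le_card_nsmul (Finset.range 3)
            (fun i => if c (lit t i) = C + 1 + 1 then (1 : ℤ) else 0) 1
            (fun i _ => by split_ifs <;> omega)
          rw [Finset.card_range] at h2
          rw [h1]
          simp only [nsmul_eq_mul] at h2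
          push_cast at h2
          omega
        -- Colours beyond the assignments contain no literals, as every block value is below `2 ^
        -- F.b`.
        · have h1 : ∑ i ∈ Finset.range 3, (if c (lit t i) = C + 1 + 1 then (1 : ℤ) else 0) = 0 := by
            refine Finset.sum_eq_zero fun i _ => if_neg ?_
            have := hval (F.var t i / F.b)
            simp only [c]
            split_ifs <;> omega
          have h2 : ∑ j ∈ Finset.range (2 ^ F.b),
              (if c (itm true t j) = C + 1 + 1 then (-3 : ℤ) else 0) ≤ 0 :=
            Finset.sum_nonpos fun j _ => by split_ifs <;> omega
          rw [h1]
          omega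
      · exact le_rfl
  have hsum : ∀ t i C, ∑ j ∈ Finset.range (2 ^ F.b), (if c (itm true t j) = C + 2 then
      (if j.testBit (F.var t i % F.b) = true ↔ F.sgn t i = true then (-1 : ℤ) else -2) else 0) =
      if C < 2 ^ F.b then
        (if C.testBit (F.var t i % F.b) = true ↔ F.sgn t i = true then -1 else -2) else 0 := by
    intro t i C
    simp [c]
  have hchkC : ∀ t C, (if c (chk t) = C then (-2 : ℤ) else 0) ≤ 0 := fun t C => by
    split_ifs <;> omega
  have hlit : ∀ t, ∀ i < 3, ∀ C, util F.arcs c (lit t i) C ≤ 0 := by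
    intro t i hi C
    rw [util_lit F c C t hi]
    have h1 := hchkC t C
    split_ifs with ht h2 h3 h3
    · simp [c] at h2 h3
      omega
    · have h4 : ∑ j ∈ Finset.range (2 ^ F.b), (if c (itm true t j) = C then
          (if j.testBit (F.var t i % F.b) = true ↔ F.sgn t i = true then (-1 : ℤ) else -2) else 0)
          ≤ 0 := Finset.sum_nonpos fun j _ => by split_ifs <;> omega
      omega
    · have h5 : C = val (F.var t i / F.b) + 2 := h3.symm
      rw [h5, hsum, if_pos (hval _)]
      split_ifs <;> omega
    · have h4 : ∑ j ∈ Finset.range (2 ^ F.b), (if c (itm true t j) = C then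
          (if j.testBit (F.var t i % F.b) = true ↔ F.sgn t i = true then (-1 : ℤ) else -2) else 0)
          ≤ 0 := Finset.sum_nonpos fun j _ => by split_ifs <;> omega
      omega
    · exact le_rfl
  have hlit0 : ∀ t, ∀ i < 3, util F.arcs c (lit t i) (c (lit t i)) = 0 := by
    intro t i hi
    rw [util_lit F c _ t hi]
    have h0 : c (chk t) ≠ c (lit t i) := (hlit_ne t i).symm
    rw [if_neg h0]
    by_cases h1 : a (F.var t i) = F.sgn t i
    · have h2 : c (lit t i) = val (F.var t i / F.b) + 2 := if_pos h1
      have h3 : c (itm false t (F.var t i / F.b)) = val (F.var t i / F.b) + 2 := rfl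
      -- For a true literal, the `+1` of its block cancels the `-1` of a satisfying assignment.
      rw [h2, h3, hsum, if_pos (hval _), hbit, h1]
      simp
    · have h2 : c (lit t i) = 1 := if_neg h1
      rw [h2]
      simp [c]
  refine ⟨c, fun v C => ?_⟩
  rcases v with ⟨β, t⟩ | t | t | ⟨t, i⟩ | ⟨β, t, i⟩
  · simp [hhub]
  · have h0 : c (chk t) = 0 := rfl
    rw [h0, hchk0]
    exact ⟨le_rfl, hchk t C⟩
  · have h0 : util F.arcs c (grb t) (c (grb t)) = 0 := util_eq_zero_of_forall _ _ fun x hx h => by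
      obtain ⟨t', e⟩ := (F.arc_grb hx h).2
      rw [e]
      exact Nat.zero_ne_one
    rw [h0]
    exact ⟨le_rfl, util_nonpos c C fun a ha h _ => by rw [(F.arc_grb ha h).1]; omega⟩
  · by_cases hi : i < 3
    · rw [hlit0 t i hi]
      exact ⟨le_rfl, hlit t i hi C⟩
    · have h0 : ∀ C, util F.arcs c (lit t i) C = 0 := fun C =>
        util_eq_zero_of_forall _ _ fun x hx h => absurd (F.arc_lit hx h) hi
      simp [h0]
  · have h0 : util F.arcs c (itm β t i) (c (itm β t i)) = 0 :=
      util_eq_zero_of_forall _ _ fun x hx h => by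
        rcases (F.arc_itm hx h).2 with ⟨β', t', e⟩ | ⟨t', e⟩ <;> rw [e] <;> cases β <;> simp [c]
    rw [h0]
    exact ⟨le_rfl, util_nonpos c C fun a ha h _ => by rw [(F.arc_itm ha h).1]; omega⟩

end Satisfiable

end BlockedFormula

/-! ### Parameters of the game of a formula -/

/-- A graph whose vertices are arranged in blocks of size `K`, the first seven vertices of a block
being special, has pathwidth at most `9` if every edge joins a vertex to a special vertex of its
block or to one of the first two vertices of the preceding block. -/
theorem pathwidth_le_nine {N K : ℕ} (G : SimpleGraph (Fin N))
    (h : ∀ u v, G.Adj u v → ∃ s ∈ ({u, v} : Set (Fin N)), ∀ w ∈ ({u, v} : Set (Fin N)),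
      w = s ∨ (w : ℕ) % K < 7 ∧
        ((w : ℕ) / K = s / K ∨ (w : ℕ) % K < 2 ∧ (w : ℕ) / K + 1 = s / K)) :
    pathwidth G ≤ 9 := by
  classical
  rw [pathwidth_le_iff]
  refine ⟨{
    length := N
    -- One bag per vertex `s`: the vertex itself, the seven special vertices of its block and two of
    -- the preceding one, `1 + 7 + 2 = 10` in all.
    bag := fun s => Finset.univ.filter fun w : Fin N => w = s ∨ (w : ℕ) % K < 7 ∧
        ((w : ℕ) / K = s / K ∨ (w : ℕ) % K < 2 ∧ (w : ℕ) / K + 1 = s / K)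
    vertex_mem := fun v => ⟨v, by simp⟩
    edge_mem := ?_
    consecutive := ?_ }, fun s => ?_⟩
  · intro u v huv
    obtain ⟨s, -, hs⟩ := h u v huv
    exact ⟨s, by simpa using hs u (by simp), by simpa using hs v (by simp)⟩
  -- Block indices increase along the path, so the bags of one block, or of two consecutive blocks,
  -- form an interval.
  · intro i j k hij hjk v hi hk
    simp only [Finset.mem_filter, Finset.mem_univ, true_and] at hi hk ⊢
    have h1 : (i : ℕ) / K ≤ j / K := Nat.div_le_div_right hij
    have h2 : (j : ℕ) / K ≤ k / K := Nat.div_le_div_right hjk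
    rcases hi with rfl | hi <;> rcases hk with rfl | hk
    · exact Or.inl (le_antisymm hij hjk)
    · refine Or.inr ⟨hk.1, ?_⟩
      omega
    · refine Or.inr ⟨hi.1, ?_⟩
      omega
    · refine Or.inr ⟨hi.1, ?_⟩
      omega
  · have hsub : (Finset.univ.filter fun w : Fin N => w = s ∨ (w : ℕ) % K < 7 ∧
        ((w : ℕ) / K = s / K ∨ (w : ℕ) % K < 2 ∧ (w : ℕ) / K + 1 = s / K)).image Fin.val ⊆
        {(s : ℕ)} ∪ ((Finset.range 7).image fun r => K * (s / K) + r) ∪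
          (Finset.range 2).image fun r => K * (s / K - 1) + r := by
      intro m hm
      obtain ⟨w, hw, rfl⟩ := Finset.mem_image.1 hm
      replace hw := (Finset.mem_filter.1 hw).2
      have hdm := Nat.div_add_mod (w : ℕ) K
      simp only [Finset.mem_union, Finset.mem_singleton, Finset.mem_image, Finset.mem_range]
      rcases hw with rfl | ⟨h1, h2 | ⟨h2, h3⟩⟩
      · exact Or.inl (Or.inl rfl)
      · exact Or.inl (Or.inr ⟨_, h1, by rw [← h2, hdm]⟩)
      · exact Or.inr ⟨_, h2, by rw [← h3, Nat.add_sub_cancel, hdm]⟩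
    change (Finset.univ.filter fun w : Fin N => w = s ∨ (w : ℕ) % K < 7 ∧
        ((w : ℕ) / K = s / K ∨ (w : ℕ) % K < 2 ∧ (w : ℕ) / K + 1 = s / K)).card ≤ _
    rw [← Finset.card_image_of_injective _ Fin.val_injective]
    have h1 := Finset.card_union_le ({(s : ℕ)} ∪ (Finset.range 7).image fun r => K * (s / K) + r)
      ((Finset.range 2).image fun r => K * (s / K - 1) + r)
    have h2 := Finset.card_union_le {(s : ℕ)} ((Finset.range 7).image fun r => K * (s / K) + r)
    have h3 := Finset.card_image_le (s := Finset.range 7) (f := fun r => K * (s / K) + r)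
    have h4 := Finset.card_image_le (s := Finset.range 2) (f := fun r => K * (s / K - 1) + r)
    rw [Finset.card_range] at h3 h4
    rw [Finset.card_singleton] at h2
    have h5 := Finset.card_le_card hsub
    omega

namespace ArcGame

variable {α : Type} {N : ℕ} {num : α → ℕ} {l : List (α × α × ℤ)}

theorem adj_underlying (h : IsNumbering N num l) {u v : Fin N}
    (huv : (game h).underlying.Adj u v) : ∃ a ∈ l, (num a.1 = u ∧ num a.2.1 = v) ∨
      (num a.1 = v ∧ num a.2.1 = u) := by
  rcases huv with ⟨-, ⟨a, ha, e⟩ | ⟨a, ha, e⟩⟩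
  · exact ⟨a, ha, Or.inl e⟩
  · exact ⟨a, ha, Or.inr e⟩

theorem maxDeg_game_le (h : IsNumbering N num l) (nbr : α → Finset α) {D : ℕ}
    (hD : ∀ x, (nbr x).card ≤ D) (hnbr : ∀ a ∈ l, a.2.1 ∈ nbr a.1 ∧ a.1 ∈ nbr a.2.1) :
    (game h).maxDeg ≤ D := by
  classical
  refine SimpleGraph.maxDegree_le_of_forall_degree_le _ _ fun k => ?_
  by_cases hk : ∃ x ∈ verts l, num x = k
  · obtain ⟨x, hx, e⟩ := hk
    refine le_trans ?_ (hD x)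
    refine le_trans ?_ (Finset.card_image_le (s := nbr x) (f := num))
    rw [← SimpleGraph.card_neighborFinset_eq_degree,
      ← Finset.card_image_of_injective _ Fin.val_injective]
    refine Finset.card_le_card fun m hm => ?_
    obtain ⟨v, hv, rfl⟩ := Finset.mem_image.1 hm
    rw [SimpleGraph.mem_neighborFinset] at hv
    obtain ⟨a, ha, ⟨e1, e2⟩ | ⟨e1, e2⟩⟩ := adj_underlying h hv
    · have := h.injOn (fst_mem ha) hx (e1.trans e.symm)
      exact Finset.mem_image.2 ⟨_, this ▸ (hnbr a ha).1, e2⟩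
    · have := h.injOn (snd_mem ha) hx (e2.trans e.symm)
      exact Finset.mem_image.2 ⟨_, this ▸ (hnbr a ha).2, e1⟩
  · rw [← SimpleGraph.card_neighborFinset_eq_degree]
    refine le_trans (le_of_eq ?_) (Nat.zero_le _)
    rw [Finset.card_eq_zero, Finset.eq_empty_iff_forall_notMem]
    intro v hv
    rw [SimpleGraph.mem_neighborFinset] at hv
    obtain ⟨a, ha, ⟨e1, e2⟩ | ⟨e1, e2⟩⟩ := adj_underlying h hv
    · exact hk ⟨_, fst_mem ha, e1⟩
    · exact hk ⟨_, snd_mem ha, e2⟩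

theorem maxWeight_game_le (h : IsNumbering N num l) {W : ℕ} (hW : ∀ a ∈ l, a.2.2.natAbs ≤ W) :
    (game h).maxWeight ≤ W := by
  refine Finset.sup_le fun p _ => ?_
  by_cases hp : ∃ a ∈ l, num a.1 = p.1 ∧ num a.2.1 = p.2
  · obtain ⟨a, ha, e1, e2⟩ := hp
    rw [w_game h ha _ _ e1 e2]
    exact hW a ha
  · rw [(game h).w_eq_zero _ _ hp]
    exact Nat.zero_le _

end ArcGame

/-! ### Numbering the agents and bounding pathwidth, degree and weights -/

namespace BlockedFormula

open Agent ArcGame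

variable (F : BlockedFormula)

/-- The number of agents per layer. -/
def blockSize : ℕ := 7 + F.g + 2 ^ F.b

/-- The layer of an agent. -/
def lay : Agent → ℕ
  | hub _ t => t
  | chk t => t
  | grb t => t
  | lit t _ => t
  | itm _ t _ => t

/-- The number of an agent within its layer. -/
def offset : Agent → ℕ
  | hub β _ => β.toNat
  | chk _ => 2
  | grb _ => 3
  | lit _ i => 4 + i
  | itm β _ i => 7 + (β.toNat * F.g + i)

/-- The number of an agent. -/
def num (x : Agent) : ℕ := lay x * F.blockSize + F.offset x

/-- The range of the index of an agent. -/
def InRange : Agent → Prop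
  | lit _ i => i < 3
  | itm β _ i => i < F.size β
  | _ => True

theorem inRange_of_mem {a : Agent × Agent × ℤ} (ha : a ∈ F.arcs)
    (hg : ∀ t < F.M, ∀ i < 3, F.var t i / F.b < F.g) :
    (F.InRange a.1 ∧ lay a.1 ≤ F.M) ∧ F.InRange a.2.1 ∧ lay a.2.1 ≤ F.M := by
  rw [mem_arcs] at ha
  simp only [mem_pair] at ha
  obtain ⟨t, ht, ⟨β, i, hi, (rfl | rfl) | rfl | rfl⟩ | (rfl | rfl) | ⟨j, hj, rfl | rfl⟩ |
    ⟨i, hi, (rfl | rfl) | rfl | ⟨j, hj, rfl⟩⟩⟩ := ha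
  all_goals simp [InRange, lay, ht.le, *]
  all_goals first | done | omega | exact hi | exact hg t ht i hi | exact hj

theorem offset_lt {x : Agent} (hx : F.InRange x) : F.offset x < F.blockSize := by
  have := Nat.two_pow_pos F.b
  unfold blockSize
  rcases x with ⟨β, t⟩ | t | t | ⟨t, i⟩ | ⟨β, t, i⟩
  · have := β.toNat_lt
    simp only [offset]
    omega
  · simp [offset]
    omega
  · simp [offset]
    omega
  · simp only [InRange, offset] at hx ⊢
    omega
  · cases β <;> simp [offset, InRange, size] at hx ⊢ <;> omega

theorem num_mod {x : Agent} (hx : F.InRange x) : F.num x % F.blockSize = F.offset x := by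
  rw [num, Nat.mul_add_mod_self_right, Nat.mod_eq_of_lt (F.offset_lt hx)]

theorem num_div {x : Agent} (hx : F.InRange x) : F.num x / F.blockSize = lay x := by
  have := F.offset_lt hx
  rw [num, mul_comm, Nat.mul_add_div (by omega), Nat.div_eq_of_lt this, add_zero]

theorem eq_of_num_eq {x y : Agent} (hx : F.InRange x) (hy : F.InRange y)
    (h : F.num x = F.num y) : x = y := by
  have h1 : lay x = lay y := by rw [← F.num_div hx, ← F.num_div hy, h]
  have h2 : F.offset x = F.offset y := by rw [← F.num_mod hx, ← F.num_mod hy, h]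
  rcases x with ⟨β, t⟩ | t | t | ⟨t, i⟩ | ⟨β, t, i⟩ <;>
  rcases y with ⟨β', t'⟩ | t' | t' | ⟨t', i'⟩ | ⟨β', t', i'⟩ <;>
  simp only [lay, offset, InRange, size] at h1 h2 hx hy <;>
  try cases β
  all_goals try cases β'
  all_goals simp at h1 h2 hx hy ⊢
  all_goals omega

theorem nodup_map_flatMap_range {β γ : Type} {n : ℕ} {f : ℕ → List β} {p : β → γ}
    (h : ∀ i < n, ((f i).map p).Nodup)
    (h' : ∀ i < n, ∀ j < n, ∀ a ∈ f i, ∀ b ∈ f j, p a = p b → i = j) :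
    (((List.range n).flatMap f).map p).Nodup := by
  rw [List.map_flatMap, List.nodup_flatMap]
  refine ⟨fun i hi => h i (List.mem_range.1 hi), List.nodup_range.pairwise_of_forall_ne ?_⟩
  intro i hi j hj hij y hy hy'
  obtain ⟨a, ha, rfl⟩ := List.mem_map.1 hy
  obtain ⟨b, hb, e⟩ := List.mem_map.1 hy'
  exact hij (h' i (List.mem_range.1 hi) j (List.mem_range.1 hj) a ha b hb e.symm)

theorem nodup_map_append {β γ : Type} {l l' : List β} {p : β → γ} (h : (l.map p).Nodup)
    (h' : (l'.map p).Nodup) (h'' : ∀ a ∈ l, ∀ b ∈ l', p a ≠ p b) : ((l ++ l').map p).Nodup := by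
  rw [List.map_append, List.nodup_append]
  refine ⟨h, h', fun x hx y hy e => ?_⟩
  obtain ⟨a, ha, rfl⟩ := List.mem_map.1 hx
  obtain ⟨b, hb, rfl⟩ := List.mem_map.1 hy
  exact h'' a ha b hb e

theorem nodup_map_pair {x y : Agent} (h : x ≠ y) (w : ℤ) :
    ((pair x y w).map fun a => (a.1, a.2.1)).Nodup := by
  simp [pair, h]

theorem nodup_hubArcs (β : Bool) (t : ℕ) :
    ((F.hubArcs β t).map fun a => (a.1, a.2.1)).Nodup := by
  refine nodup_map_flatMap_range (fun i hi => nodup_map_append (nodup_map_pair (by simp) _)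
    (nodup_map_pair (by simp) _) ?_) ?_
  all_goals
    simp only [mem_pair, List.mem_append]
    aesop

theorem nodup_chkArcs (t : ℕ) : ((F.chkArcs t).map fun a => (a.1, a.2.1)).Nodup := by
  refine nodup_map_append (nodup_map_pair (by simp) _)
    (nodup_map_flatMap_range (fun i hi => nodup_map_pair (by simp) _) ?_) ?_
  all_goals
    simp only [mem_pair, List.mem_flatMap]
    aesop

theorem nodup_litArcs (t i : ℕ) : ((F.litArcs t i).map fun a => (a.1, a.2.1)).Nodup := by
  refine nodup_map_append (nodup_map_pair (by simp) _) (nodup_map_append (by simp)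
    (nodup_map_flatMap_range (fun i hi => by simp) ?_) ?_) ?_
  all_goals
    simp only [mem_pair, List.mem_flatMap, List.mem_append, List.mem_singleton]
    aesop

theorem mem_hubArcs {β : Bool} {t : ℕ} {a : Agent × Agent × ℤ} (ha : a ∈ F.hubArcs β t) :
    (a.1 = hub β t ∧ ∃ t' i, a.2.1 = itm β t' i) ∨ a.2.1 = hub β t ∧ ∃ t' i, a.1 = itm β t' i := by
  simp only [hubArcs, List.mem_flatMap, List.mem_append, mem_pair] at ha
  aesop

theorem mem_chkArcs {t : ℕ} {a : Agent × Agent × ℤ} (ha : a ∈ F.chkArcs t) :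
    (a.1 = chk t ∧ ((∃ t', a.2.1 = grb t') ∨ ∃ t' i, a.2.1 = itm true t' i)) ∨
      (a.2.1 = chk t ∧ ((∃ t', a.1 = grb t') ∨ ∃ t' i, a.1 = itm true t' i)) := by
  simp only [chkArcs, List.mem_flatMap, List.mem_append, mem_pair] at ha
  aesop

theorem mem_litArcs {t i : ℕ} {a : Agent × Agent × ℤ} (ha : a ∈ F.litArcs t i) :
    (a.1 = lit t i ∧ ((∃ t', a.2.1 = chk t') ∨ ∃ β t' i, a.2.1 = itm β t' i)) ∨
      (a.2.1 = lit t i ∧ ∃ t', a.1 = chk t') := by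
  simp only [litArcs, List.mem_flatMap, List.mem_append, mem_pair, List.mem_singleton] at ha
  aesop

theorem mem_layer {t : ℕ} {a : Agent × Agent × ℤ} (ha : a ∈ F.layer t) :
    (∃ β, a ∈ F.hubArcs β t) ∨ a ∈ F.chkArcs t ∨ ∃ i, a ∈ F.litArcs t i := by
  simp only [layer, List.mem_append, List.mem_flatMap] at ha
  rcases ha with (ha | ha) | ha | ⟨i, -, ha⟩
  · exact Or.inl ⟨_, ha⟩
  · exact Or.inl ⟨_, ha⟩
  · exact Or.inr (Or.inl ha)
  · exact Or.inr (Or.inr ⟨i, ha⟩)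

/-- The endpoints of an arc determine its group and layer: literal arcs contain their literal, hub
arcs their hub, and check arcs their check agent but no literal. -/
theorem nodup_arcs : (F.arcs.map fun a => (a.1, a.2.1)).Nodup := by
  refine nodup_map_flatMap_range (fun t _ => ?_) fun t _ t' _ a ha b hb e => ?_
  · refine nodup_map_append (nodup_map_append (F.nodup_hubArcs _ _) (F.nodup_hubArcs _ _) ?_)
      (nodup_map_append (F.nodup_chkArcs _)
        (nodup_map_flatMap_range (fun i _ => F.nodup_litArcs _ _) ?_) ?_) ?_
    · intro a ha b hb e
      have ha := F.mem_hubArcs ha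
      have hb := F.mem_hubArcs hb
      aesop
    · intro i _ j _ a ha b hb e
      have ha := F.mem_litArcs ha
      have hb := F.mem_litArcs hb
      aesop
    · intro a ha b hb e
      obtain ⟨i, -, hb⟩ := List.mem_flatMap.1 hb
      have ha := F.mem_chkArcs ha
      have hb := F.mem_litArcs hb
      aesop
    · intro a ha b hb e
      have ha : ∃ β, a ∈ F.hubArcs β t := by
        rcases List.mem_append.1 ha with ha | ha <;> exact ⟨_, ha⟩
      obtain ⟨β, ha⟩ := ha
      have ha := F.mem_hubArcs ha
      rcases List.mem_append.1 hb with hb | hb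
      · have hb := F.mem_chkArcs hb
        aesop
      · obtain ⟨i, -, hb⟩ := List.mem_flatMap.1 hb
        have hb := F.mem_litArcs hb
        aesop
  · simp only [Prod.mk.injEq] at e
    rcases F.mem_layer ha with ⟨β, ha⟩ | ha | ⟨i, ha⟩ <;>
    rcases F.mem_layer hb with ⟨β', hb⟩ | hb | ⟨j, hb⟩ <;>
    [have ha := F.mem_hubArcs ha; have ha := F.mem_hubArcs ha; have ha := F.mem_hubArcs ha;
     have ha := F.mem_chkArcs ha; have ha := F.mem_chkArcs ha; have ha := F.mem_chkArcs ha;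
     have ha := F.mem_litArcs ha; have ha := F.mem_litArcs ha; have ha := F.mem_litArcs ha] <;>
    [have hb := F.mem_hubArcs hb; have hb := F.mem_chkArcs hb; have hb := F.mem_litArcs hb;
     have hb := F.mem_hubArcs hb; have hb := F.mem_chkArcs hb; have hb := F.mem_litArcs hb;
     have hb := F.mem_hubArcs hb; have hb := F.mem_chkArcs hb; have hb := F.mem_litArcs hb] <;>
    aesop

/-- There is one layer more than there are clauses because the hubs of the last clause also refer to
items of layer `F.M`. -/
theorem isNumbering (hg : ∀ t < F.M, ∀ i < 3, F.var t i / F.b < F.g) :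
    IsNumbering ((F.M + 1) * F.blockSize) F.num F.arcs := by
  have hv : ∀ x ∈ verts F.arcs, F.InRange x ∧ lay x ≤ F.M := by
    rintro x ⟨a, ha, rfl | rfl⟩
    · exact (F.inRange_of_mem ha hg).1
    · exact (F.inRange_of_mem ha hg).2
  refine ⟨fun x hx => ?_, fun x hx y hy => F.eq_of_num_eq (hv x hx).1 (hv y hy).1,
    fun a ha e => ?_, F.nodup_arcs⟩
  · obtain ⟨h1, h2⟩ := hv x hx
    have h3 := F.offset_lt h1
    have h4 := Nat.mul_le_mul_right F.blockSize h2
    rw [num, add_mul, one_mul]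
    omega
  · rw [mem_arcs] at ha
    simp only [mem_pair] at ha
    aesop

variable (hg : ∀ t < F.M, ∀ i < 3, F.var t i / F.b < F.g)

theorem hasNash_iff (hb : 0 < F.b) :
    (game (F.isNumbering hg)).HasNashStablePartition ↔ F.Satisfiable := by
  constructor
  · intro h
    obtain ⟨c, hc⟩ := exists_stable_of_hasNash _ h
    exact satisfiable_of_stable hg hc
  · intro h
    obtain ⟨c, hc⟩ := exists_stable_of_satisfiable hb h
    exact hasNash_of_stable _ hc

/-- Offsets below 7 are the agents other than items. In an arc between layers, the hub has offset 0
or 1 and lies one layer before the item, which is taken as `s`. -/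
theorem pathwidth_game_le : pathwidth (game (F.isNumbering hg)).underlying ≤ 9 := by
  have key : ∀ a ∈ F.arcs, ∃ s ∈ ({F.num a.1, F.num a.2.1} : Set ℕ),
      ∀ w ∈ ({F.num a.1, F.num a.2.1} : Set ℕ),
      w = s ∨ w % F.blockSize < 7 ∧ (w / F.blockSize = s / F.blockSize ∨
        w % F.blockSize < 2 ∧ w / F.blockSize + 1 = s / F.blockSize) := by
    intro a ha
    have hr := F.inRange_of_mem ha hg
    have h1 := F.num_mod hr.1.1
    have h2 := F.num_mod hr.2.1
    have h3 := F.num_div hr.1.1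
    have h4 := F.num_div hr.2.1
    rw [mem_arcs] at ha
    simp only [mem_pair] at ha
    have hβ : ∀ β : Bool, β.toNat < 2 := fun β => β.toNat_lt
    obtain ⟨t, ht, ⟨β, i, hi, (rfl | rfl) | rfl | rfl⟩ | (rfl | rfl) | ⟨j, hj, rfl | rfl⟩ |
      ⟨i, hi, (rfl | rfl) | rfl | ⟨j, hj, rfl⟩⟩⟩ := ha
    · have := hβ β
      refine ⟨_, Or.inr rfl, ?_⟩
      rintro w (rfl | rfl) <;> simp [h1, h2, h3, h4, lay, offset]
      omega
    · have := hβ β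
      refine ⟨_, Or.inl rfl, ?_⟩
      rintro w (rfl | rfl) <;> simp [h1, h2, h3, h4, lay, offset]
      omega
    · have := hβ β
      refine ⟨_, Or.inr rfl, ?_⟩
      rintro w (rfl | rfl) <;> simp [h1, h2, h3, h4, lay, offset]
      omega
    · have := hβ β
      refine ⟨_, Or.inl rfl, ?_⟩
      rintro w (rfl | rfl) <;> simp [h1, h2, h3, h4, lay, offset]
      omega
    · refine ⟨_, Or.inr rfl, ?_⟩
      rintro w (rfl | rfl) <;> simp [h1, h2, h3, h4, lay, offset]
    · refine ⟨_, Or.inl rfl, ?_⟩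
      rintro w (rfl | rfl) <;> simp [h1, h2, h3, h4, lay, offset]
    · refine ⟨_, Or.inr rfl, ?_⟩
      rintro w (rfl | rfl) <;> simp [h1, h2, h3, h4, lay, offset]
    · refine ⟨_, Or.inl rfl, ?_⟩
      rintro w (rfl | rfl) <;> simp [h1, h2, h3, h4, lay, offset]
    · refine ⟨_, Or.inr rfl, ?_⟩
      rintro w (rfl | rfl) <;> simp [h1, h2, h3, h4, lay, offset]
    · refine ⟨_, Or.inl rfl, ?_⟩
      rintro w (rfl | rfl) <;> simp [h1, h2, h3, h4, lay, offset]
    · refine ⟨_, Or.inr rfl, ?_⟩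
      rintro w (rfl | rfl) <;> simp [h1, h2, h3, h4, lay, offset]
      omega
    · refine ⟨_, Or.inr rfl, ?_⟩
      rintro w (rfl | rfl) <;> simp [h1, h2, h3, h4, lay, offset]
      omega
  refine pathwidth_le_nine (K := F.blockSize) _ fun u v huv => ?_
  obtain ⟨a, ha, e⟩ := adj_underlying _ huv
  obtain ⟨s, hs, hw⟩ := key a ha
  have hset : ({F.num a.1, F.num a.2.1} : Set ℕ) = {(u : ℕ), (v : ℕ)} := by
    rcases e with ⟨e1, e2⟩ | ⟨e1, e2⟩
    · rw [e1, e2]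
    · rw [e1, e2, Set.pair_comm]
  rw [hset] at hs hw
  have hs' : ∃ s' ∈ ({u, v} : Set (Fin ((F.M + 1) * F.blockSize))), (s' : ℕ) = s := by
    rcases hs with rfl | rfl
    · exact ⟨u, Or.inl rfl, rfl⟩
    · exact ⟨v, Or.inr rfl, rfl⟩
  obtain ⟨s', hs', rfl⟩ := hs'
  refine ⟨s', hs', fun w hw' => ?_⟩
  have := hw w (by rcases hw' with rfl | rfl <;> simp)
  exact this.imp_left Fin.ext

/-- A superset of the neighbours of an agent. -/
def nbr : Agent → Finset Agent
  | hub β t => (Finset.range (F.size β)).image (itm β t) ∪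
      (Finset.range (F.size β)).image (itm β (t + 1))
  | chk t => {grb t} ∪ ((Finset.range (2 ^ F.b)).image (itm true t) ∪
      (Finset.range 3).image (lit t))
  | grb t => {chk t}
  | lit t i => {chk t, itm false t (F.var t i / F.b)} ∪ (Finset.range (2 ^ F.b)).image (itm true t)
  | itm β t _ => {hub β t, hub β (t - 1), chk t} ∪ (Finset.range 3).image (lit t)

theorem card_nbr_le (x : Agent) : (F.nbr x).card ≤ 2 * (F.g + 2 ^ F.b) + 6 := by
  have him : ∀ (n : ℕ) (f : ℕ → Agent), ((Finset.range n).image f).card ≤ n := fun n f =>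
    Finset.card_image_le.trans (Finset.card_range n).le
  rcases x with ⟨β, t⟩ | t | t | ⟨t, i⟩ | ⟨β, t, i⟩
  · have h1 := Finset.card_union_le ((Finset.range (F.size β)).image (itm β t))
      ((Finset.range (F.size β)).image (itm β (t + 1)))
    have h2 := him (F.size β) (itm β t)
    have h3 := him (F.size β) (itm β (t + 1))
    have h4 : F.size β ≤ F.g + 2 ^ F.b := by cases β <;> simp [size]
    simp only [nbr]
    omega
  · have h1 := Finset.card_union_le {grb t} ((Finset.range (2 ^ F.b)).image (itm true t) ∪
      (Finset.range 3).image (lit t))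
    have h2 := Finset.card_union_le ((Finset.range (2 ^ F.b)).image (itm true t))
      ((Finset.range 3).image (lit t))
    have h3 := him (2 ^ F.b) (itm true t)
    have h4 := him 3 (lit t)
    rw [Finset.card_singleton] at h1
    simp only [nbr]
    omega
  · simp [nbr]
  · have h1 := Finset.card_union_le {chk t, itm false t (F.var t i / F.b)}
      ((Finset.range (2 ^ F.b)).image (itm true t))
    have h3 := him (2 ^ F.b) (itm true t)
    have h4 := Finset.card_le_two (a := chk t) (b := itm false t (F.var t i / F.b))
    simp only [nbr]
    omega
  · have h1 := Finset.card_union_le {hub β t, hub β (t - 1), chk t} ((Finset.range 3).image (lit t))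
    have h3 := him 3 (lit t)
    have h4 := Finset.card_le_three (a := hub β t) (b := hub β (t - 1)) (c := chk t)
    simp only [nbr]
    omega

theorem maxDeg_game_le : (game (F.isNumbering hg)).maxDeg ≤ 2 * (F.g + 2 ^ F.b) + 6 := by
  refine ArcGame.maxDeg_game_le _ F.nbr F.card_nbr_le fun a ha => ?_
  rw [mem_arcs] at ha
  simp only [mem_pair] at ha
  obtain ⟨t, ht, ⟨β, i, hi, (rfl | rfl) | rfl | rfl⟩ | (rfl | rfl) | ⟨j, hj, rfl | rfl⟩ |
    ⟨i, hi, (rfl | rfl) | rfl | ⟨j, hj, rfl⟩⟩⟩ := ha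
  all_goals simp [nbr, *]

/-- The hub weights are powers of two bounded by the family size; the factor 3 absorbs the remaining
weights, down to `-3`. -/
theorem maxWeight_game_le :
    (game (F.isNumbering hg)).maxWeight ≤ 3 * 2 ^ (F.g + 2 ^ F.b) := by
  refine ArcGame.maxWeight_game_le _ fun a ha => ?_
  have h0 := Nat.two_pow_pos (F.g + 2 ^ F.b)
  have h2 := Nat.two_pow_pos F.b
  have h1 : ∀ β, ∀ i < F.size β, 2 ^ i ≤ 2 ^ (F.g + 2 ^ F.b) := fun β i hi =>
    Nat.pow_le_pow_right two_pos (by cases β <;> simp [size] at hi <;> omega)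
  rw [mem_arcs] at ha
  simp only [mem_pair] at ha
  obtain ⟨t, ht, ⟨β, i, hi, (rfl | rfl) | rfl | rfl⟩ | (rfl | rfl) | ⟨j, hj, rfl | rfl⟩ |
    ⟨i, hi, (rfl | rfl) | rfl | ⟨j, hj, rfl⟩⟩⟩ := ha
  · have := h1 β i hi
    simp [Int.natAbs_pow]
    omega
  · simp
    omega
  · have := h1 β i hi
    simp [Int.natAbs_pow]
    omega
  all_goals try (simp; omega)

end BlockedFormula

/-! ### The reduction -/

/-- Input on stack `0`, output on stack `1`. Clearing the input at the end yields the final stacks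
needed for running another machine. -/
theorem PolyTime.exists_runs {X : Type} {r f : X → List Γ'}
    (h : PolyTime (fun _ : Unit => r) f) : ∃ (p : Prog Γ') (c : ℕ → ℕ), PolyBound c ∧ ∀ x,
      (f x).length ≤ c (r x).length ∧ ∃ t ≤ c (r x).length,
        p.Runs (Function.update (fun _ => []) 0 (r x))
          (Function.update (fun _ => []) 1 (f x).reverse) t := by
  obtain ⟨b, hb, hlen, hp⟩ := h
  obtain ⟨p, hp⟩ := hp (fun _ => 0) 1 2 (by simp) (by simp) (by simp)
  refine ⟨.seq p (Prog.clear 0), _, hb.add (((PolyBound.const 2).mul .id).add (.const 1)),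
    fun x => ⟨?_, ?_⟩⟩
  · exact (hlen x _ fun _ => le_rfl).trans (Nat.le_add_right _ _)
  · have h1 := hp x (Function.update (fun _ => []) 0 (r x)) (r x).length (fun _ => by simp)
      (fun k hk => Function.update_of_ne (by omega) _ _) fun _ => le_rfl
    have h2 := h1.seq (Prog.does_clear 0 _)
    obtain ⟨t, ht, h2⟩ := h2
    refine ⟨t, ?_, ?_⟩
    · simpa using ht
    · convert h2 using 1
      funext k
      by_cases h0 : k = 0
      · simp [h0]
      · by_cases h1 : k = 1 <;> simp [Function.update, h0, h1]

/-! ### Reading and writing fields in polynomial time -/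

/-- The symbols of field number `k` of a string. -/
def field : ℕ → List Γ' → List Γ'
  | _, [] => []
  | 0, Γ'.comma :: _ => []
  | k + 1, Γ'.comma :: l => field k l
  | 0, a :: l => a :: field 0 l
  | k + 1, _ :: l => field (k + 1) l

theorem field_zero {w : List Γ'} (hw : Γ'.comma ∉ w) (l : List Γ') :
    field 0 (w ++ Γ'.comma :: l) = w := by
  induction w with
  | nil => simp [field]
  | cons a w ih =>
    rw [List.mem_cons, not_or] at hw
    rw [List.cons_append, field, ih hw.2]
    exact fun h => hw.1 h.symm

theorem field_succ {w : List Γ'} (hw : Γ'.comma ∉ w) (l : List Γ') (k : ℕ) :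
    field (k + 1) (w ++ Γ'.comma :: l) = field k l := by
  induction w with
  | nil => simp [field]
  | cons a w ih =>
    rw [List.mem_cons, not_or] at hw
    rw [List.cons_append, field, ih hw.2]
    exact fun h => hw.1 h.symm

/-- The symbols other than commas. -/
def content : Option Γ' → List Γ'
  | none => []
  | some Γ'.comma => []
  | some a => [a]

/-- This is the form of a loop over positions: a position contributes its symbol if exactly `k`
commas precede it. -/
theorem field_eq_flatMap (k : ℕ) (l : List Γ') :
    field k l = (List.range l.length).flatMap fun i =>
      if (l.take i).reverse.count Γ'.comma = k then content (l.drop i).head? else [] := by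
  induction l generalizing k with
  | nil => rfl
  | cons a l ih =>
    rw [List.length_cons, List.range_succ_eq_map, List.flatMap_cons, List.flatMap_map]
    by_cases ha : a = Γ'.comma
    · subst ha
      rcases k with _ | k
      · simp [field, content]
      · simp [field, ih]
    · have e : ∀ i, (((a :: l).take (i + 1)).reverse.count Γ'.comma) =
          (l.take i).reverse.count Γ'.comma := fun i => by
        simp [ha]
      simp only [e, List.drop_succ_cons, Nat.succ_eq_add_one]
      rw [← ih]
      have hc : content (some a) = [a] := by
        cases a <;> first | rfl | exact absurd rfl ha
      rcases k with _ | k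
      · rw [field]
        · simp [hc]
        · exact ha
      · rw [field]
        · simp
        · exact ha

section

variable {ι X : Type} {rs : ι → X → List Γ'}

theorem PolyTime.head {f : X → List Γ'} (hf : PolyTime rs f) (d : Option Γ' → List Γ') :
    PolyTime rs fun x => d (f x).head? :=
  hf.case (f := fun o _ => d o) fun _ => .const _

theorem PolyTime.head_eq {f : X → List Γ'} (hf : PolyTime rs f) (a : Γ') :
    DecTime rs fun x => (f x).head? = some a :=
  ⟨_, hf.head fun o => if o = some a then [a] else [], fun x => by simp⟩

theorem PolyTime.count {f : X → List Γ'} (hf : PolyTime rs f) (a : Γ') :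
    UnaryTime rs fun x => (f x).count a := by
  refine (hf.flatMap (rs' := fun (_ : Unit) (l : List Γ') => l)
    (h := fun l => if l.head? = some a then unary 1 else [])
    ((PolyTime.head_eq (.reg ()) a).ite_polyTime (.const _) .nil) (fun _ => some none)
    (fun x i => (f x).drop i) fun _ _ _ _ => rfl).congr fun x => ?_
  dsimp only
  induction f x with
  | nil => rfl
  | cons b l ih =>
    rw [List.length_cons, List.range_succ_eq_map, List.flatMap_cons, List.flatMap_map]
    simp only [Nat.succ_eq_add_one, List.drop_succ_cons, ih]
    by_cases h : b = a
    · simp [h, ← unary_add, Nat.add_comm]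
    · simp [h]

theorem PolyTime.field {f : X → List Γ'} (hf : PolyTime rs f) {k : X → ℕ}
    (hk : UnaryTime rs k) : PolyTime rs fun x => field (k x) (f x) := by
  refine (hf.flatMap (rs' := fun (j : Option (Option ι)) (y : X × List Γ' × List Γ') =>
      j.elim y.2.1 fun o => o.elim y.2.2 fun i => rs i y.1)
    (h := fun y => if y.2.1.count Γ'.comma = k y.1 then content y.2.2.head? else [])
    (((PolyTime.count (.reg none) Γ'.comma).eq
      (hk.reindex (fun i => some (some i)) Prod.fst fun _ _ => rfl)).ite_polyTime
      (PolyTime.head (.reg (some none)) content) .nil) id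
    (fun x i => (x, ((f x).take i).reverse, (f x).drop i)) fun x i _ j => ?_).congr fun x =>
      (field_eq_flatMap (k x) (f x)).symm
  rcases j with _ | _ | j <;> rfl

theorem UnaryTime.unaryField {n : X → ℕ} (hn : UnaryTime rs n) :
    PolyTime rs fun x => unaryField (n x) :=
  PolyTime.append hn (.const [Γ'.comma])

theorem bits_two_pow (i : ℕ) : (2 ^ i).bits = List.replicate i false ++ [true] := by
  induction i with
  | zero => rfl
  | succ i ih => rw [pow_succ', Nat.bit0_bits _ (by positivity), ih]; rfl

/-- The weight is exponential in `n x`, but its binary form is `n x` zeros followed by a one, so a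
loop writes it. -/
theorem UnaryTime.intField_two_pow {n : X → ℕ} (hn : UnaryTime rs n) :
    PolyTime rs fun x => intField (2 ^ n x) := by
  refine ((PolyTime.const [Γ'.bit false]).append ((PolyTime.flatMap_range hn
    (.const [Γ'.bit false])).append (.const [Γ'.bit true, Γ'.comma]))).congr fun x => ?_
  have h : ¬ (2 ^ n x : ℤ) < 0 := not_lt.2 (by positivity)
  simp [intField, h, Int.natAbs_pow, bits_two_pow, ← List.map_eq_flatMap, List.map_const']

theorem UnaryTime.intField_neg_two_pow {n : X → ℕ} (hn : UnaryTime rs n) :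
    PolyTime rs fun x => intField (-2 ^ n x) := by
  refine ((PolyTime.const [Γ'.bit true]).append ((PolyTime.flatMap_range hn
    (.const [Γ'.bit false])).append (.const [Γ'.bit true, Γ'.comma]))).congr fun x => ?_
  have h : (-2 ^ n x : ℤ) < 0 := neg_lt_zero.2 (by positivity)
  simp [intField, Int.natAbs_pow, bits_two_pow, ← List.map_eq_flatMap, List.map_const']

end

/-! ### Writing the arcs of the game in polynomial time -/

namespace BlockedFormula

open Agent ArcGame

/-- The encoding of an arc. -/
def arcCode (F : BlockedFormula) (a : Agent × Agent × ℤ) : List Γ' :=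
  unaryField (F.num a.1) ++ unaryField (F.num a.2.1) ++ intField a.2.2

/-- The parameters of a formula can be computed in polynomial time. -/
structure ParamTime {ι X : Type} (rs : ι → X → List Γ') (F : X → BlockedFormula) : Prop where
  b_pos : ∀ x, 0 < (F x).b
  g : UnaryTime rs fun x => (F x).g
  b : UnaryTime rs fun x => (F x).b
  pow : UnaryTime rs fun x => 2 ^ (F x).b

section

variable {ι X : Type} {rs : ι → X → List Γ'} {F : X → BlockedFormula}

theorem ParamTime.weaken (hF : ParamTime rs F) {Y : Type} {r : Y → List Γ'} :
    ParamTime (extend rs r) fun y => F y.1 :=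
  ⟨fun y => hF.b_pos y.1, hF.g.weaken, hF.b.weaken, hF.pow.weaken⟩

theorem ParamTime.blockSize (hF : ParamTime rs F) : UnaryTime rs fun x => (F x).blockSize :=
  ((UnaryTime.const 7).add hF.g).add hF.pow

theorem ParamTime.hub (hF : ParamTime rs F) {t : X → ℕ} (ht : UnaryTime rs t) (β : Bool) :
    UnaryTime rs fun x => (F x).num (hub β (t x)) :=
  (ht.mul hF.blockSize).add (.const β.toNat)

theorem ParamTime.chk (hF : ParamTime rs F) {t : X → ℕ} (ht : UnaryTime rs t) :
    UnaryTime rs fun x => (F x).num (chk (t x)) :=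
  (ht.mul hF.blockSize).add (.const 2)

theorem ParamTime.grb (hF : ParamTime rs F) {t : X → ℕ} (ht : UnaryTime rs t) :
    UnaryTime rs fun x => (F x).num (grb (t x)) :=
  (ht.mul hF.blockSize).add (.const 3)

theorem ParamTime.lit (hF : ParamTime rs F) {t i : X → ℕ} (ht : UnaryTime rs t) (hi : UnaryTime rs i) :
    UnaryTime rs fun x => (F x).num (lit (t x) (i x)) :=
  (ht.mul hF.blockSize).add ((UnaryTime.const 4).add hi)

theorem ParamTime.itm (hF : ParamTime rs F) {t i : X → ℕ} (ht : UnaryTime rs t) (hi : UnaryTime rs i) (β : Bool) :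
    UnaryTime rs fun x => (F x).num (itm β (t x) (i x)) :=
  (ht.mul hF.blockSize).add ((UnaryTime.const 7).add (((UnaryTime.const β.toNat).mul hF.g).add hi))

/-- A list of arcs can be written in polynomial time. -/
def ArcsTime (rs : ι → X → List Γ') (F : X → BlockedFormula)
    (l : X → List (Agent × Agent × ℤ)) : Prop :=
  PolyTime rs fun x => (l x).flatMap (F x).arcCode

theorem ArcsTime.append {l l' : X → List (Agent × Agent × ℤ)} (h : ArcsTime rs F l)
    (h' : ArcsTime rs F l') : ArcsTime rs F fun x => l x ++ l' x :=
  (PolyTime.append h h').congr fun x => by rw [List.flatMap_append]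

theorem ArcsTime.flatMap_range {n : X → ℕ} (hn : UnaryTime rs n)
    {l : X × ℕ → List (Agent × Agent × ℤ)} (h : ArcsTime (extend rs unary) (fun y => F y.1) l) :
    ArcsTime rs F fun x => (List.range (n x)).flatMap fun i => l (x, i) :=
  (PolyTime.flatMap_range hn h).congr fun x => by rw [List.flatMap_assoc]

variable {u v : X → Agent} {w : X → ℤ}

theorem ArcsTime.single (hu : UnaryTime rs fun x => (F x).num (u x))
    (hv : UnaryTime rs fun x => (F x).num (v x)) (hw : PolyTime rs fun x => intField (w x)) :
    ArcsTime rs F fun x => [(u x, v x, w x)] :=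
  ((hu.unaryField.append hv.unaryField).append hw).congr fun x => by simp [arcCode]

theorem ArcsTime.pair (hu : UnaryTime rs fun x => (F x).num (u x))
    (hv : UnaryTime rs fun x => (F x).num (v x)) (hw : PolyTime rs fun x => intField (w x)) :
    ArcsTime rs F fun x => pair (u x) (v x) (w x) :=
  (ArcsTime.single hu hv hw).append (.single hv hu (.const _))

theorem ParamTime.size (hF : ParamTime rs F) (β : Bool) : UnaryTime rs fun x => (F x).size β := by
  cases β
  · exact hF.g
  · exact hF.pow

theorem ParamTime.hubArcs (hF : ParamTime rs F) {t : X → ℕ} (ht : UnaryTime rs t) (β : Bool) :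
    ArcsTime rs F fun x => (F x).hubArcs β (t x) := by
  have hF' : ParamTime (extend rs unary) fun y => F y.1 := hF.weaken
  have ht' : UnaryTime (extend rs unary) fun y => t y.1 := ht.weaken
  exact .flatMap_range (hF.size β) ((ArcsTime.pair (hF'.hub ht' β) (hF'.itm ht' .var β)
    UnaryTime.var.intField_two_pow).append (.pair (hF'.hub ht' β)
      (hF'.itm (ht'.add (.const 1)) .var β) UnaryTime.var.intField_neg_two_pow))

theorem ParamTime.chkArcs (hF : ParamTime rs F) {t : X → ℕ} (ht : UnaryTime rs t) :
    ArcsTime rs F fun x => (F x).chkArcs (t x) := by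
  have hF' : ParamTime (extend rs unary) fun y => F y.1 := hF.weaken
  have ht' : UnaryTime (extend rs unary) fun y => t y.1 := ht.weaken
  exact (ArcsTime.pair (hF.chk ht) (hF.grb ht) (.const _)).append
    (.flatMap_range hF.pow (.pair (hF'.chk ht') (hF'.itm ht' .var true) (.const _)))

theorem ParamTime.litArcs (hF : ParamTime rs F) {t i : X → ℕ} (ht : UnaryTime rs t)
    (hi : UnaryTime rs i) (hvar : UnaryTime rs fun x => (F x).var (t x) (i x))
    (hsgn : DecTime rs fun x => (F x).sgn (t x) (i x) = true) :
    ArcsTime rs F fun x => (F x).litArcs (t x) (i x) := by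
  have hF' : ParamTime (extend rs unary) fun y => F y.1 := hF.weaken
  have ht' : UnaryTime (extend rs unary) fun y => t y.1 := ht.weaken
  refine (ArcsTime.pair (hF.chk ht) (hF.lit ht hi) (.const _)).append
    ((ArcsTime.single (hF.lit ht hi) (hF.itm ht (hvar.div hF.b hF.b_pos) false)
      (.const _)).append (.flatMap_range hF.pow (ArcsTime.single (w := fun y => if y.2.testBit
        ((F y.1).var (t y.1) (i y.1) % (F y.1).b) = true ↔ (F y.1).sgn (t y.1) (i y.1) = true
        then -1 else -2) (hF'.lit ht' hi.weaken) (hF'.itm ht' .var true) ?_)))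
  -- The bit position is a residue modulo `b`, so `2 ^ b` is a computable cap for its power of two.
  have h := (UnaryTime.var.testBit (k := fun y : X × ℕ =>
    (F y.1).var (t y.1) (i y.1) % (F y.1).b) (hvar.mod hF.b hF.b_pos).weaken hF'.pow
    fun y => Nat.pow_le_pow_right two_pos (Nat.mod_lt _ (hF.b_pos _)).le).iff hsgn.weaken
  exact (h.ite_polyTime (.const (intField (-1))) (.const (intField (-2)))).congr fun y =>
    (apply_ite intField _ _ _).symm

theorem ParamTime.arcs (hF : ParamTime rs F) (hM : UnaryTime rs fun x => (F x).M)
    (hvar : UnaryTime (extend (extend rs unary) unary) fun y => (F y.1.1).var y.1.2 y.2)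
    (hsgn : DecTime (extend (extend rs unary) unary) fun y => (F y.1.1).sgn y.1.2 y.2 = true) :
    ArcsTime rs F fun x => (F x).arcs := by
  have hF' : ParamTime (extend rs unary) fun y => F y.1 := hF.weaken
  exact .flatMap_range hM (((hF'.hubArcs .var false).append (hF'.hubArcs .var true)).append
    ((hF'.chkArcs .var).append (.flatMap_range (.const 3)
      (hF'.weaken.litArcs UnaryTime.var.weaken .var hvar hsgn))))

/-- The encoding of the game of a formula. -/
def gameCode (F : BlockedFormula) : List Γ' :=
  unaryField ((F.M + 1) * F.blockSize) ++ F.arcs.flatMap F.arcCode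

theorem ParamTime.gameCode (hF : ParamTime rs F) (hM : UnaryTime rs fun x => (F x).M)
    (hvar : UnaryTime (extend (extend rs unary) unary) fun y => (F y.1.1).var y.1.2 y.2)
    (hsgn : DecTime (extend (extend rs unary) unary) fun y => (F y.1.1).sgn y.1.2 y.2 = true) :
    PolyTime rs fun x => (F x).gameCode :=
  ((hM.add (.const 1)).mul hF.blockSize).unaryField.append (hF.arcs hM hvar hsgn)

end

end BlockedFormula

/-! ### The game of a 3-CNF formula is computable from its encoding -/

namespace ThreeCNF

/-- The size of the blocks into which the variables of a formula are arranged. -/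
def blockLength (n : ℕ) : ℕ := Nat.log 2 n / 2 + 1

/-- The arrangement of a formula in blocks. -/
def blocked (φ : ThreeCNF) : BlockedFormula where
  -- The additional block holds the variables left over by the division.
  g := φ.n / blockLength φ.n + 1
  b := blockLength φ.n
  M := φ.clauses.length
  -- Reading literals off the encoding makes them computable and total. Field `0` is the number of
  -- variables, whence the shift by 1; the sign symbol accounts for the subtraction.
  var t i := (field (3 * t + i + 1) φ.encode).length - 1
  sgn t i := decide ((field (3 * t + i + 1) φ.encode).head? = some (Γ'.bit true))

theorem comma_notMem_unary (n : ℕ) : Γ'.comma ∉ unary n := by simp [unary]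

theorem encode_eq (φ : ThreeCNF) : φ.encode = unary φ.n ++ Γ'.comma ::
    φ.clauses.flatMap fun c => (List.ofFn c).flatMap fun x => Γ'.bit x.2 :: unaryField x.1 := by
  simp [encode, unaryField, unary]

theorem field_flatMap {n : ℕ} (l : List (Fin 3 → Fin n × Bool)) (t : ℕ) (ht : t < l.length)
    (i : Fin 3) : field (3 * t + i) (l.flatMap fun c => (List.ofFn c).flatMap fun x =>
      Γ'.bit x.2 :: unaryField x.1) = Γ'.bit (l[t] i).2 :: unary (l[t] i).1 := by
  have e : ∀ (x : Fin n × Bool) l, Γ'.bit x.2 :: unaryField x.1 ++ l =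
      (Γ'.bit x.2 :: unary x.1) ++ Γ'.comma :: l := fun x l => by simp [unaryField, unary]
  have hw : ∀ x : Fin n × Bool, Γ'.comma ∉ (Γ'.bit x.2 :: unary x.1 : List Γ') := fun x => by
    simp [comma_notMem_unary]
  induction l generalizing t with
  | nil => simp at ht
  | cons c l ih =>
    have hc : ∀ l', ((List.ofFn c).flatMap fun x => Γ'.bit x.2 :: unaryField x.1) ++ l' =
        (Γ'.bit (c 0).2 :: unary (c 0).1) ++ Γ'.comma ::
        ((Γ'.bit (c 1).2 :: unary (c 1).1) ++ Γ'.comma ::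
        ((Γ'.bit (c 2).2 :: unary (c 2).1) ++ Γ'.comma :: l')) := fun l' => by
      simp [List.ofFn_succ, unaryField, unary]
    rw [List.flatMap_cons, hc]
    rcases t with _ | t
    · fin_cases i
      · exact field_zero (hw _) _
      · exact (field_succ (hw _) _ 0).trans (field_zero (hw _) _)
      · exact (field_succ (hw _) _ 1).trans ((field_succ (hw _) _ 0).trans (field_zero (hw _) _))
    · rw [show 3 * (t + 1) + (i : ℕ) = 3 * t + i + 1 + 1 + 1 by ring, field_succ (hw _),
        field_succ (hw _), field_succ (hw _)]
      exact ih t (by simpa using ht)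

theorem field_encode (φ : ThreeCNF) {t : ℕ} (ht : t < φ.clauses.length) (i : Fin 3) :
    field (3 * t + i + 1) φ.encode =
      Γ'.bit (φ.clauses[t] i).2 :: unary (φ.clauses[t] i).1 := by
  rw [encode_eq, field_succ (comma_notMem_unary _), field_flatMap]

theorem var_blocked (φ : ThreeCNF) {t : ℕ} (ht : t < φ.clauses.length) (i : Fin 3) :
    φ.blocked.var t i = (φ.clauses[t] i).1 := by
  simp [blocked, field_encode φ ht i]

theorem sgn_blocked (φ : ThreeCNF) {t : ℕ} (ht : t < φ.clauses.length) (i : Fin 3) :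
    φ.blocked.sgn t i = (φ.clauses[t] i).2 := by
  simp [blocked, field_encode φ ht i]

theorem blocked_satisfiable (φ : ThreeCNF) : φ.blocked.Satisfiable ↔ φ.Satisfiable := by
  constructor
  · rintro ⟨a, ha⟩
    refine ⟨fun v => a v, fun c hc => ?_⟩
    obtain ⟨t, ht, rfl⟩ := List.getElem_of_mem hc
    obtain ⟨i, hi, h⟩ := ha t ht
    have h1 := φ.var_blocked ht ⟨i, hi⟩
    have h2 := φ.sgn_blocked ht ⟨i, hi⟩
    exact ⟨⟨i, hi⟩, by
      dsimp only at h1 h2 ⊢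
      rw [← h1, ← h2, h]⟩
  · rintro ⟨a, ha⟩
    refine ⟨fun v => if h : v < φ.n then a ⟨v, h⟩ else false, fun t ht => ?_⟩
    obtain ⟨i, h⟩ := ha _ (List.getElem_mem ht)
    exact ⟨i, i.2, by simp [φ.var_blocked ht i, φ.sgn_blocked ht i, h]⟩

theorem var_blocked_div_lt (φ : ThreeCNF) : ∀ t < φ.blocked.M, ∀ i < 3,
    φ.blocked.var t i / φ.blocked.b < φ.blocked.g := by
  intro t ht i hi
  have h := φ.var_blocked ht ⟨i, hi⟩
  dsimp only at h
  rw [h]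
  exact Nat.lt_succ_of_le (Nat.div_le_div_right (Fin.is_lt _).le)

/-- Counting commas and dividing by 3 lets a program recover the number of clauses. -/
theorem count_encode (φ : ThreeCNF) :
    φ.encode.count Γ'.comma = 3 * φ.clauses.length + 1 := by
  have h : ∀ n, (unary n).count Γ'.comma = 0 := fun n => by simp [unary, List.count_replicate]
  have h' : ∀ n, (unaryField n).count Γ'.comma = 1 := fun n => by
    simp [unaryField, List.count_replicate]
  rw [encode_eq, List.count_append, h, List.count_cons]
  induction φ.clauses with
  | nil => simp
  | cons c l ih =>
    simp [List.ofFn_succ, h'] at ih ⊢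
    omega

theorem blockLength_pos (n : ℕ) : 0 < blockLength n := Nat.succ_pos _

theorem two_pow_blockLength_le (n : ℕ) : 2 ^ blockLength n ≤ 2 * n + 2 := by
  rcases Nat.eq_zero_or_pos n with rfl | hn
  · simp [blockLength]
  · have h1 := Nat.pow_log_le_self 2 hn.ne'
    have h2 : 2 ^ (Nat.log 2 n / 2) ≤ 2 ^ Nat.log 2 n :=
      Nat.pow_le_pow_right two_pos (Nat.div_le_self _ _)
    rw [blockLength, pow_succ]
    omega

theorem polyTime_gameCode :
    PolyTime (fun _ : Unit => ThreeCNF.encode) fun φ => φ.blocked.gameCode := by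
  have hn : UnaryTime (fun _ : Unit => ThreeCNF.encode) fun φ => φ.n :=
    (PolyTime.length ((PolyTime.reg ()).field (.const 0))).congr fun φ => by
      rw [encode_eq, field_zero (comma_notMem_unary _), length_unary]
  have hb : UnaryTime (fun _ : Unit => ThreeCNF.encode) fun φ => blockLength φ.n :=
    (hn.log_two.div (.const 2) fun _ => two_pos).add (.const 1)
  have hM : UnaryTime (fun _ : Unit => ThreeCNF.encode) fun φ => φ.clauses.length :=
    ((PolyTime.count (.reg ()) Γ'.comma).div (.const 3) fun _ => three_pos).congr fun φ => by
      rw [count_encode]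
      omega
  have hs : PolyTime (extend (extend (fun _ : Unit => ThreeCNF.encode) unary) unary)
      fun y => y.1.1.encode := PolyTime.reg (some (some ()))
  have hf := hs.field (k := fun y => 3 * y.1.2 + y.2 + 1)
    ((((UnaryTime.const 3).mul UnaryTime.var.weaken).add .var).add (.const 1))
  refine BlockedFormula.ParamTime.gameCode (F := blocked)
    ⟨fun φ => blockLength_pos _, ?_, hb, ?_⟩ hM ?_ ?_
  · exact (hn.div hb fun _ => blockLength_pos _).add (.const 1)
  · exact (hb.two_pow (((UnaryTime.const 2).mul hn).add (.const 2))).congr fun φ =>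
      Nat.min_eq_left (two_pow_blockLength_le _)
  · exact (PolyTime.length hf).pred
  · exact (hf.head_eq (Γ'.bit true)).congr fun y => by simp [blocked]

end ThreeCNF

/-! ### The running time -/

/-- The maximum of the absolute values of `f` up to `d`. -/
noncomputable def maxAbs (f : ℕ → ℝ) (d : ℕ) : ℝ :=
  (Finset.range (d + 1)).sup' ⟨0, by simp⟩ fun i => |f i|

theorem abs_le_maxAbs (f : ℕ → ℝ) {i d : ℕ} (h : i ≤ d) : |f i| ≤ maxAbs f d :=
  Finset.le_sup' (fun i => |f i|) (Finset.mem_range.2 (Nat.lt_succ_of_le h))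

theorem maxAbs_nonneg (f : ℕ → ℝ) (d : ℕ) : 0 ≤ maxAbs f d :=
  (abs_nonneg _).trans (abs_le_maxAbs f (Nat.zero_le d))

/-- Only an upper bound for the degree is known and `f` need not be monotone, so `f` is replaced by
its running maximum. -/
theorem isLittleO_maxAbs {f : ℕ → ℝ} (hf : f =o[Filter.atTop] fun d : ℕ => (d : ℝ)) :
    maxAbs f =o[Filter.atTop] fun d : ℕ => (d : ℝ) := by
  refine Asymptotics.isLittleO_iff.2 fun ε hε => ?_
  obtain ⟨d₀, h₀⟩ := Filter.eventually_atTop.1 (Asymptotics.isLittleO_iff.1 hf hε)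
  -- Beyond `d₁`, the line `ε * d` also dominates the finitely many values up to `d₀`.
  obtain ⟨d₁, h₁⟩ := exists_nat_gt (maxAbs f d₀ / ε)
  filter_upwards [Filter.eventually_ge_atTop d₁] with d hd
  have hd' : (d₁ : ℝ) ≤ d := by exact_mod_cast hd
  rw [Real.norm_of_nonneg (maxAbs_nonneg f d), Real.norm_of_nonneg (Nat.cast_nonneg d)]
  refine Finset.sup'_le _ _ fun i hi => ?_
  rcases le_total i d₀ with h | h
  · rw [div_lt_iff₀ hε] at h₁
    have := abs_le_maxAbs f h
    nlinarith
  · have h2 := h₀ i h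
    rw [Real.norm_eq_abs, Real.norm_of_nonneg (Nat.cast_nonneg i)] at h2
    have : (i : ℝ) ≤ d := by exact_mod_cast Nat.lt_succ_iff.1 (Finset.mem_range.1 hi)
    exact h2.trans (mul_le_mul_of_nonneg_left this hε.le)

/-! ### The degree bound and the exponent `o(n)` -/

namespace ThreeCNF

/-- A bound on the degrees in the game of a formula with `n` variables. -/
def degBound (n : ℕ) : ℕ := 2 * ((n / blockLength n + 1) + 2 ^ blockLength n) + 6

/-- With `two_pow_blockLength_sq_le`, this places `2 ^ b` between `√n` and `2 * √n`: few assignments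
per block, yet `b` of order `log n`. -/
theorem lt_two_pow_blockLength_sq (n : ℕ) : n < (2 ^ blockLength n) ^ 2 := by
  refine (Nat.lt_pow_succ_log_self Nat.one_lt_two n).trans_le ?_
  rw [← pow_mul]
  refine Nat.pow_le_pow_right two_pos ?_
  unfold blockLength
  omega

theorem two_pow_blockLength_sq_le {n : ℕ} (hn : 0 < n) : (2 ^ blockLength n) ^ 2 ≤ 4 * n := by
  refine le_trans ?_ (Nat.mul_le_mul_left 4 (Nat.pow_log_le_self 2 hn.ne'))
  rw [← pow_mul, show 4 = 2 ^ 2 by rfl, ← pow_add]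
  refine Nat.pow_le_pow_right two_pos ?_
  unfold blockLength
  omega

theorem tendsto_degBound : Filter.Tendsto degBound Filter.atTop Filter.atTop := by
  refine Filter.tendsto_atTop.2 fun K => ?_
  filter_upwards [Filter.eventually_ge_atTop (K ^ 2)] with n hn
  have h1 := lt_of_pow_lt_pow_left₀ 2 (Nat.zero_le _)
    (hn.trans_lt (lt_two_pow_blockLength_sq n))
  have h2 := Nat.zero_le (n / blockLength n)
  unfold degBound
  omega

theorem degBound_le (n : ℕ) : degBound n ≤ 2 ^ (7 * blockLength n) := by
  have h1 := lt_two_pow_blockLength_sq n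
  have h2 := two_pow_blockLength_le n
  have h3 := Nat.div_le_self n (blockLength n)
  have h4 : 2 ^ (2 * blockLength n + 5) ≤ 2 ^ (7 * blockLength n) :=
    Nat.pow_le_pow_right two_pos (by have := blockLength_pos n; omega)
  rw [pow_add, Nat.mul_comm 2, pow_mul] at h4
  unfold degBound
  omega

/-- The terms are bounded by `n / b * b ≤ n`, `2 ^ b * b ≤ (2 ^ b) ^ 2 ≤ 4 * n` and `b ≤ 4 * n`, and
`2 + 2 * 4 + 8 * 4 = 42`. -/
theorem degBound_mul_le {n : ℕ} (hn : 0 < n) : degBound n * blockLength n ≤ 42 * n := by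
  have h1 := two_pow_blockLength_sq_le hn
  have h2 : blockLength n ≤ 2 ^ blockLength n := Nat.lt_two_pow_self.le
  have h3 := Nat.div_mul_le_self n (blockLength n)
  have h4 : 2 ^ blockLength n * blockLength n ≤ 4 * n := by nlinarith
  have h5 : blockLength n ≤ 4 * n := by nlinarith [blockLength_pos n]
  have h6 : degBound n * blockLength n = 2 * (n / blockLength n * blockLength n) +
      2 * (2 ^ blockLength n * blockLength n) + 8 * blockLength n := by
    unfold degBound
    ring
  omega

theorem logb_degBound_nonneg (n : ℕ) : 0 ≤ Real.logb 2 (degBound n) := by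
  refine Real.logb_nonneg one_lt_two ?_
  have : 1 ≤ degBound n := by unfold degBound; omega
  exact_mod_cast this

/-- The logarithm of the degree bound is at most `7 * b`, and the degree bound times `b` is at most
`42 * n`. -/
theorem isBigO_degBound_mul_logb : (fun n => (degBound n : ℝ) * Real.logb 2 (degBound n))
    =O[Filter.atTop] fun n : ℕ => (n : ℝ) := by
  refine Asymptotics.IsBigO.of_bound 294 ?_
  filter_upwards [Filter.eventually_gt_atTop 0] with n hn
  have h0 : (0 : ℝ) < degBound n := by
    have : 0 < degBound n := by unfold degBound; omega
    exact_mod_cast this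
  have h1 : Real.logb 2 (degBound n) ≤ 7 * blockLength n := by
    rw [Real.logb_le_iff_le_rpow one_lt_two h0]
    have := degBound_le n
    exact_mod_cast this
  have h2 : (degBound n : ℝ) * blockLength n ≤ 42 * n := by exact_mod_cast degBound_mul_le hn
  rw [Real.norm_of_nonneg (mul_nonneg h0.le (logb_degBound_nonneg n)),
    Real.norm_of_nonneg (Nat.cast_nonneg n)]
  have := mul_le_mul_of_nonneg_left h1 h0.le
  linarith

/-- The exponent of the running time for formulas with `n` variables. -/
noncomputable def exponent (f : ℕ → ℝ) (k n : ℕ) : ℝ :=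
  maxAbs f (degBound n) * Real.logb 2 (degBound n) + k * degBound n

theorem exponent_nonneg (f : ℕ → ℝ) (k n : ℕ) : 0 ≤ exponent f k n :=
  add_nonneg (mul_nonneg (maxAbs_nonneg _ _) (logb_degBound_nonneg n)) (by positivity)

theorem isLittleO_exponent {f : ℕ → ℝ} (hf : f =o[Filter.atTop] fun d : ℕ => (d : ℝ)) (k : ℕ) :
    exponent f k =o[Filter.atTop] fun n : ℕ => (n : ℝ) := by
  refine Asymptotics.IsLittleO.add ?_ (Asymptotics.IsLittleO.const_mul_left ?_ _)
  · exact (((isLittleO_maxAbs hf).comp_tendsto tendsto_degBound).mul_isBigO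
      (Asymptotics.isBigO_refl _ _)).trans_isBigO isBigO_degBound_mul_logb
  · have h1 : (fun _ : ℕ => (1 : ℝ)) =o[Filter.atTop] fun n => Real.logb 2 (degBound n) := by
      refine Asymptotics.isLittleO_const_left.2 (Or.inr ?_)
      exact tendsto_norm_atTop_atTop.comp ((Real.tendsto_logb_atTop one_lt_two).comp
        (tendsto_natCast_atTop_atTop.comp tendsto_degBound))
    simpa using ((Asymptotics.isBigO_refl (fun n => (degBound n : ℝ)) Filter.atTop).mul_isLittleO
      h1).trans_isBigO isBigO_degBound_mul_logb

theorem length_encode_le (φ : ThreeCNF) :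
    φ.encode.length ≤ 6 * (φ.n + φ.clauses.length + 1) ^ 2 := by
  have h : ∀ l : List (Fin 3 → Fin φ.n × Bool), (l.flatMap fun c =>
      (List.ofFn c).flatMap fun x => Γ'.bit x.2 :: unaryField x.1).length ≤
      l.length * (3 * (φ.n + 2)) := by
    intro l
    induction l with
    | nil => simp
    | cons c l ih =>
      have h0 := (c 0).1.2
      have h1 := (c 1).1.2
      have h2 := (c 2).1.2
      simp [List.ofFn_succ, unaryField, add_mul] at ih ⊢
      omega
  have h1 := h φ.clauses
  rw [encode_eq, List.length_append, List.length_cons, length_unary]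
  nlinarith

/-- The game of a formula. -/
noncomputable def game (φ : ThreeCNF) : ASHG :=
  ArcGame.game (φ.blocked.isNumbering φ.var_blocked_div_lt)

theorem isEncoding_game (φ : ThreeCNF) : φ.game.IsEncoding φ.blocked.gameCode :=
  ArcGame.isEncoding_game _

theorem game_hasNash_iff (φ : ThreeCNF) : φ.game.HasNashStablePartition ↔ φ.Satisfiable :=
  (φ.blocked.hasNash_iff φ.var_blocked_div_lt (blockLength_pos _)).trans φ.blocked_satisfiable

theorem maxDeg_game_le (φ : ThreeCNF) : φ.game.maxDeg ≤ degBound φ.n :=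
  φ.blocked.maxDeg_game_le φ.var_blocked_div_lt

theorem game_size_le (φ : ThreeCNF) : max φ.game.n 1 * max φ.game.maxWeight 1 ≤
    30 * (φ.n + φ.clauses.length + 1) ^ 2 * 2 ^ degBound φ.n := by
  have h1 : φ.game.n ≤ 10 * (φ.n + φ.clauses.length + 1) ^ 2 := by
    change (φ.clauses.length + 1) * (7 + (φ.n / blockLength φ.n + 1) + 2 ^ blockLength φ.n) ≤ _
    have h2 := two_pow_blockLength_le φ.n
    have h3 := Nat.div_le_self φ.n (blockLength φ.n)
    calc _ ≤ (φ.n + φ.clauses.length + 1) * (10 * (φ.n + φ.clauses.length + 1)) :=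
          Nat.mul_le_mul (by omega) (by omega)
      _ = _ := by ring
  have h2 : φ.game.maxWeight ≤ 3 * 2 ^ degBound φ.n := by
    refine (φ.blocked.maxWeight_game_le φ.var_blocked_div_lt).trans (Nat.mul_le_mul_left 3
      (Nat.pow_le_pow_right two_pos ?_))
    change (φ.n / blockLength φ.n + 1) + 2 ^ blockLength φ.n ≤ degBound φ.n
    unfold degBound
    omega
  have h3 : 0 < (φ.n + φ.clauses.length + 1) ^ 2 := by positivity
  have h4 : 0 < 2 ^ degBound φ.n := by positivity
  calc _ ≤ (10 * (φ.n + φ.clauses.length + 1) ^ 2) * (3 * 2 ^ degBound φ.n) :=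
        Nat.mul_le_mul (max_le h1 (by omega)) (max_le h2 (by omega))
    _ = _ := by ring

theorem time_game_le (φ : ThreeCNF) (f : ℕ → ℝ) (C k : ℕ) :
    (C : ℝ) * ((max φ.game.maxDeg 2 : ℕ) : ℝ) ^ f φ.game.maxDeg *
      ((max φ.game.n 1 * max φ.game.maxWeight 1 : ℕ) : ℝ) ^ k ≤
    (C * 30 ^ k : ℕ) * (2 : ℝ) ^ exponent f k φ.n *
      ((φ.n + φ.clauses.length + 1 : ℕ) : ℝ) ^ (2 * k) := by
  have h1 : ((max φ.game.maxDeg 2 : ℕ) : ℝ) ^ f φ.game.maxDeg ≤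
      (2 : ℝ) ^ (maxAbs f (degBound φ.n) * Real.logb 2 (degBound φ.n)) := by
    have hD : ((max φ.game.maxDeg 2 : ℕ) : ℝ) ≤ degBound φ.n := by
      have : max φ.game.maxDeg 2 ≤ degBound φ.n :=
        max_le φ.maxDeg_game_le (by unfold degBound; omega)
      exact_mod_cast this
    have h1' : (1 : ℝ) ≤ (max φ.game.maxDeg 2 : ℕ) := by
      have : 1 ≤ max φ.game.maxDeg 2 := by omega
      exact_mod_cast this
    -- The base is at least 1, so the exponent is enlarged first; it is then nonnegative, so the
    -- base can be enlarged too.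
    calc _ ≤ ((max φ.game.maxDeg 2 : ℕ) : ℝ) ^ maxAbs f (degBound φ.n) :=
          Real.rpow_le_rpow_of_exponent_le h1'
            ((le_abs_self _).trans (abs_le_maxAbs f φ.maxDeg_game_le))
      _ ≤ (degBound φ.n : ℝ) ^ maxAbs f (degBound φ.n) :=
          Real.rpow_le_rpow (by positivity) hD (maxAbs_nonneg _ _)
      _ = _ := by
          rw [mul_comm, Real.rpow_mul two_pos.le, Real.rpow_logb two_pos (by norm_num)
            (by linarith)]
  have h2 : ((max φ.game.n 1 * max φ.game.maxWeight 1 : ℕ) : ℝ) ^ k ≤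
      (30 : ℝ) ^ k * ((φ.n + φ.clauses.length + 1 : ℕ) : ℝ) ^ (2 * k) *
        (2 : ℝ) ^ ((k : ℝ) * degBound φ.n) := by
    have h3 := Nat.pow_le_pow_left φ.game_size_le k
    have h4 : ((2 : ℝ) ^ ((k : ℝ) * degBound φ.n)) = (2 ^ degBound φ.n) ^ k := by
      rw [mul_comm, Real.rpow_mul two_pos.le, Real.rpow_natCast, Real.rpow_natCast]
    rw [h4, pow_mul, ← mul_pow, ← mul_pow]
    exact_mod_cast h3
  calc _ ≤ (C : ℝ) * (2 : ℝ) ^ (maxAbs f (degBound φ.n) * Real.logb 2 (degBound φ.n)) *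
        ((30 : ℝ) ^ k * ((φ.n + φ.clauses.length + 1 : ℕ) : ℝ) ^ (2 * k) *
        (2 : ℝ) ^ ((k : ℝ) * degBound φ.n)) := by gcongr
    _ = _ := by
        rw [exponent, Real.rpow_add two_pos]
        push_cast
        ring

end ThreeCNF

/-- If the Exponential Time Hypothesis holds, there is a constant `p` such that no algorithm decides
whether a game on a graph of pathwidth at most `p` admits a Nash stable partition in time
`Δ ^ o(Δ) * (n * W) ^ O(1)`. -/
theorem mainTheorem7 (hETH : ETH) :
    ∃ p : ℕ, ¬ NashStabilitySolvable p := by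
  refine ⟨9, fun ⟨f, C, k, hf, M, hM⟩ => hETH ?_⟩
  obtain ⟨p, c, ⟨c₀, k₀, hc⟩, hp⟩ := ThreeCNF.polyTime_gameCode.exists_runs
  -- The summand with factor 2 pays for running the program and for transferring its output, both
  -- bounded by `c`; the rest is one further step and the given machine. The `7` comes from `6 * Q ^
  -- 2 + 1 ≤ 7 * Q ^ 2`.
  refine ⟨ThreeCNF.exponent f k, 2 * (c₀ * 7 ^ k₀) + 1 + C * 30 ^ k, 2 * k₀ + 2 * k,
    ThreeCNF.isLittleO_exponent hf k, p.thenMachine M, ?_⟩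
  rintro φ _ rfl
  obtain ⟨hlen, t, ht, hrun⟩ := hp φ
  obtain ⟨b, t', hb, ht', hout⟩ := hM
    ⟨φ.game, φ.blocked.pathwidth_game_le φ.var_blocked_div_lt⟩ _ φ.isEncoding_game
  refine ⟨b, t + (φ.blocked.gameCode.length + 1) + t', hb.trans φ.game_hasNash_iff, ?_,
    Prog.outputsInTime_thenMachine hrun hout⟩
  set Q : ℕ := φ.n + φ.clauses.length + 1 with hQ
  have hQ1 : 1 ≤ Q := by omega
  have h1 : c φ.encode.length ≤ c₀ * 7 ^ k₀ * Q ^ (2 * k₀) := by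
    refine (hc _).trans ?_
    rw [mul_assoc, pow_mul, ← mul_pow]
    refine Nat.mul_le_mul_left _ (Nat.pow_le_pow_left ?_ _)
    have : φ.encode.length ≤ 6 * Q ^ 2 := φ.length_encode_le
    have := Nat.one_le_pow 2 Q hQ1
    omega
  have h2 : ((t + (φ.blocked.gameCode.length + 1) : ℕ) : ℝ) ≤
      ((2 * (c₀ * 7 ^ k₀) : ℕ) : ℝ) * (Q : ℝ) ^ (2 * k₀) + 1 := by
    have : t + (φ.blocked.gameCode.length + 1) ≤ 2 * (c₀ * 7 ^ k₀) * Q ^ (2 * k₀) + 1 := by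
      rw [mul_assoc]
      omega
    exact_mod_cast this
  have h3 := ht'.trans (φ.time_game_le f C k)
  rw [← hQ] at h3
  have hQ' : (1 : ℝ) ≤ Q := by exact_mod_cast hQ1
  have he : (1 : ℝ) ≤ 2 ^ ThreeCNF.exponent f k φ.n :=
    Real.one_le_rpow one_le_two (ThreeCNF.exponent_nonneg _ _ _)
  have hk₀ : (1 : ℝ) ≤ (Q : ℝ) ^ (2 * k₀) := one_le_pow₀ hQ'
  have hk : (1 : ℝ) ≤ (Q : ℝ) ^ (2 * k) := one_le_pow₀ hQ'
  dsimp only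
  rw [← hQ, Nat.cast_add _ t', pow_add]
  calc _ ≤ (((2 * (c₀ * 7 ^ k₀) : ℕ) : ℝ) * (Q : ℝ) ^ (2 * k₀) + 1) + _ := add_le_add h2 h3
    -- Each summand is padded with ones, which are then raised to the missing factors, all at least
    -- 1.
    _ ≤ (((2 * (c₀ * 7 ^ k₀) : ℕ) : ℝ) * (1 * ((Q : ℝ) ^ (2 * k₀) * 1)) + 1 * (1 * 1)) +
        (C * 30 ^ k : ℕ) * ((2 : ℝ) ^ ThreeCNF.exponent f k φ.n * (1 * (Q : ℝ) ^ (2 * k))) := by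
        simp only [mul_one, one_mul, mul_assoc, le_refl]
    _ ≤ (((2 * (c₀ * 7 ^ k₀) : ℕ) : ℝ) * ((2 : ℝ) ^ ThreeCNF.exponent f k φ.n *
          ((Q : ℝ) ^ (2 * k₀) * (Q : ℝ) ^ (2 * k))) +
          1 * ((2 : ℝ) ^ ThreeCNF.exponent f k φ.n * ((Q : ℝ) ^ (2 * k₀) * (Q : ℝ) ^ (2 * k)))) +
        (C * 30 ^ k : ℕ) * ((2 : ℝ) ^ ThreeCNF.exponent f k φ.n *
          ((Q : ℝ) ^ (2 * k₀) * (Q : ℝ) ^ (2 * k))) := by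
        have h4 : (1 : ℝ) ≤ (Q : ℝ) ^ (2 * k₀) * (Q : ℝ) ^ (2 * k) :=
          one_le_mul_of_one_le_of_one_le hk₀ hk
        rw [one_mul (1 : ℝ)]
        gcongr
        exact one_le_mul_of_one_le_of_one_le he h4
    _ = _ := by
        push_cast
        ring
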